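/- Let $\Omega\subset\mathbb R^2$ be a nonempty bounded open convex set, $0<\alpha<1$, $0<\lambda$, $0<\Lambda$, and let $\sigma,R\in\mathbb R$ and $\kappa>0$ be mesh constants. There is a constant $C>0$, depending only on $\Omega,\alpha,\lambda,\Lambda,\sigma,R,\kappa$, such that the following holds. *The equation.* Let $A=(a_{ij}):\Omega\to\mathbb R^{2\times2}$ be measurable, symmetric, with $\lambda|\xi|^2\le \xi^{T}A(x)\xi\le\Lambda|\xi|^2$ for all $x\in\Omega$, $\xi\in\mathbb R^2$, and with the Cordes condition $|A|^2/(\operatorname{tr}A)^2\le 1/(1+\varepsilon)$ in $\Omega$ for some $\varepsilon\in[0,1]$, where $|A|^2=\sum_{i,j} a_{ij}^2$. Let $f\in L^2(\Omega)$ and let $u\in H^{2+\alpha}(\Omega)$, taken continuous on $\overline\Omega$, satisfy $A:D^2u=\sum_{i,j}a_{ij}\partial^2_{ij}u=f$ a.e. in $\Omega$ and $u=0$ on $\partial\Omega$. Here $\|u\|_{2+\alpha}^2=\|u\|_0^2+\|\nabla u\|_0^2+\|D^2u\|_0^2+\iint_{\Omega\times\Omega}\frac{|D^2u(x)-D^2u(y)|^2}{|x-y|^{2+2\alpha}}\,dx\,dy$,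 and $\|\cdot\|_0$ is the $L^2(\Omega)$ norm. *The mesh and the recovery.* Let $\mathcal T_h$ be a conforming triangulation of $\overline\Omega$ (so $\Omega$ is a convex polygon) with mesh size $h=\max_{T\in\mathcal T_h}\operatorname{diam}T$, every triangle $T$ of which contains a disc of radius $\rho>0$ with $\operatorname{diam}T\le\sigma\rho$. Let $V_h$ be the space of continuous functions on $\overline\Omega$ that are affine on each triangle, $V_h^0$ its subspace of functions vanishing on $\partial\Omega$, and $w_I$ the piecewise linear nodal interpolant of $w$. For each vertex $z$ let $\omega_z$ be the union of the triangles containing $z$, $d_z=\operatorname{diam}\omega_z$, and let $S_z$ be a finite nonempty set of vertices within distance $R\,d_z$ of $z$, such that $\frac1{|S_z|}\sum_{x\in S_z}q\big(\frac{x-z}{d_z}\big)^2\ge\kappa|q|^2$ for every quadratic polynomial $q$ in two variables, $|q|$ being the Euclidean norm of its coefficient vector in the monomial basis. The PPR gradient recovery $G_h:V_h\to V_h\times V_h$ is the piecewise linear interpolation of the nodal values $G_hv_h(z)=\nabla p_z(z)$, where $p_z$ is the polynomial of degree at most 2 with $\sum_{x\in S_z}(p_z(x)-v_h(x))\,q(x)=0$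 for all polynomials $q$ of degree at most 2. $DG_hv_h$ is the piecewise constant derivative matrix of $G_hv_h$, and $\operatorname{rot}(v_1,v_2)=\partial_yv_1-\partial_xv_2$. Put $V_h^{0,0}=\{v_h\in V_h^0:\ \text{the tangential trace of } G_hv_h \text{ on }\partial\Omega\text{ vanishes}\}$, $$a_{1,h}(v_h,w_h)=\sum_{T\in\mathcal T_h}\int_T\big[(A:DG_hv_h)(A:DG_hw_h)+\operatorname{rot}G_hv_h\,\operatorname{rot}G_hw_h\big]\,dx\,dy,\qquad \|v_h\|_{a,1}^2=a_{1,h}(v_h,v_h).$$ *The scheme.* Let $u_h\in V_h^{0,0}$ satisfy $$a_{1,h}(u_h,v_h)=(f,A:DG_hv_h)\qquad\text{for all }v_h\in V_h,$$ or, in case $u_I\in V_h^{0,0}$, only for all $v_h\in V_h^{0,0}$. *Conclusion.* Then $$\|u_h-u_I\|_{a,1}\le C\,h^\alpha\|u\|_{2+\alpha}\qquad\text{and}\qquad \|D^2u-DG_hu_h\|_0\le C\,h^\alpha\|u\|_{2+\alpha}.$$ -/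

import Mathlib

open MeasureTheory Set
open scoped ContDiff RealInnerProductSpace

noncomputable section

namespace GRBL

/-- The Euclidean plane. -/
abbrev Plane : Type := EuclideanSpace ℝ (Fin 2)

/-- The `i`-th standard unit vector of the plane. -/
def basisVec (i : Fin 2) : Plane := EuclideanSpace.single i (1 : ℝ)

/-! ### Matrices: contraction and rotation -/

/-- The contraction `A : B = ∑ a_{ij} b_{ij}`. -/
def contract (A B : Matrix (Fin 2) (Fin 2) ℝ) : ℝ := ∑ i, ∑ j, A i j * B i j

/-- The rotation `∂_y v₁ - ∂_x v₂` of a vector field `v`, read off from the matrix with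
entries `M i j = ∂_i v_j`. -/
def rot (M : Matrix (Fin 2) (Fin 2) ℝ) : ℝ := M 1 0 - M 0 1

/-! ### Sobolev spaces through weak derivatives -/

/-- `g` is the weak partial derivative `∂_i w` on the open set `Ω`. -/
def HasWeakPartial (Ω : Set Plane) (i : Fin 2) (w g : Plane → ℝ) : Prop :=
  ∀ φ : Plane → ℝ, ContDiff ℝ ∞ φ → HasCompactSupport φ → tsupport φ ⊆ Ω →
    ∫ x in Ω, w x * fderiv ℝ φ x (basisVec i) = -∫ x in Ω, g x * φ x

/-- The integrand of the squared Sobolev-Slobodeckij seminorm of order `α` of the matrix field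
`H` in two dimensions. -/
def slobodeckij (α : ℝ) (H : Plane → Matrix (Fin 2) (Fin 2) ℝ) (xy : Plane × Plane) : ℝ :=
  contract (H xy.1 - H xy.2) (H xy.1 - H xy.2) / ‖xy.1 - xy.2‖ ^ (2 + 2 * α)

/-- `u ∈ H^{2+α}(Ω)` for `0 < α < 1`, with weak gradient `p` and weak Hessian `H`. -/
structure IsSobolev (Ω : Set Plane) (α : ℝ) (u : Plane → ℝ) (p : Plane → Plane)
    (H : Plane → Matrix (Fin 2) (Fin 2) ℝ) : Prop where
  memLp_fun : MemLp u 2 (volume.restrict Ω)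
  memLp_grad : ∀ i, MemLp (fun x => p x i) 2 (volume.restrict Ω)
  memLp_hess : ∀ i j, MemLp (fun x => H x i j) 2 (volume.restrict Ω)
  weak_grad : ∀ i, HasWeakPartial Ω i u (fun x => p x i)
  weak_hess : ∀ i j, HasWeakPartial Ω i (fun x => p x j) (fun x => H x i j)
  integrable_slobodeckij :
    Integrable (slobodeckij α H) ((volume.restrict Ω).prod (volume.restrict Ω))

/-- The norm `‖u‖_{2+α}` of `H^{2+α}(Ω)`, where `p` and `H` are the weak gradient and Hessian. -/
def sobolevNorm (Ω : Set Plane) (α : ℝ) (u : Plane → ℝ) (p : Plane → Plane)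
    (H : Plane → Matrix (Fin 2) (Fin 2) ℝ) : ℝ :=
  Real.sqrt ((∫ x in Ω, u x ^ 2) + (∫ x in Ω, ‖p x‖ ^ 2) + (∫ x in Ω, contract (H x) (H x))
    + ∫ xy, slobodeckij α H xy ∂((volume.restrict Ω).prod (volume.restrict Ω)))

/-! ### The equation -/

/-- The coefficient tensor is measurable, symmetric and uniformly positive definite on `Ω`,
with constants `lam` and `Lam`. -/
structure IsElliptic (Ω : Set Plane) (lam Lam : ℝ)
    (A : Plane → Matrix (Fin 2) (Fin 2) ℝ) : Prop where
  aestronglyMeasurable :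
    ∀ i j, AEStronglyMeasurable (fun x => A x i j) (volume.restrict Ω)
  isSymm : ∀ x ∈ Ω, (A x).IsSymm
  lower : ∀ x ∈ Ω, ∀ ξ : Fin 2 → ℝ, lam * (ξ ⬝ᵥ ξ) ≤ ξ ⬝ᵥ (A x).mulVec ξ
  upper : ∀ x ∈ Ω, ∀ ξ : Fin 2 → ℝ, ξ ⬝ᵥ (A x).mulVec ξ ≤ Lam * (ξ ⬝ᵥ ξ)

/-- The Cordes condition `|A|² / (tr A)² ≤ 1 / (d - 1 + ε)` in dimension `d = 2`. -/
def IsCordes (Ω : Set Plane) (ε : ℝ) (A : Plane → Matrix (Fin 2) (Fin 2) ℝ) : Prop :=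
  ∀ x ∈ Ω, contract (A x) (A x) / (A x).trace ^ 2 ≤ 1 / (2 - 1 + ε)

/-- `u`, with weak Hessian `H`, solves `A : D²u = f` almost everywhere in `Ω` and `u = 0` on the
boundary; `u` stands for its representative that is continuous up to the boundary. -/
structure IsStrongSolution (Ω : Set Plane) (A : Plane → Matrix (Fin 2) (Fin 2) ℝ)
    (f u : Plane → ℝ) (H : Plane → Matrix (Fin 2) (Fin 2) ℝ) : Prop where
  continuousOn : ContinuousOn u (closure Ω)
  equation : ∀ᵐ x ∂(volume.restrict Ω), contract (A x) (H x) = f x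
  boundary : ∀ x ∈ frontier Ω, u x = 0

/-! ### Triangulations -/

/-- A conforming triangulation of `Ω`. An element is given by the set of its three vertices;
two elements meet in the convex hull of their common vertices (nothing, a vertex, an edge, or
the whole element), and the closed elements cover exactly the closure of `Ω`. -/
structure Triangulation (Ω : Set Plane) where
  elems : Finset (Finset Plane)
  card_eq : ∀ t ∈ elems, t.card = 3
  indep : ∀ t ∈ elems, AffineIndependent ℝ ((↑) : t → Plane)
  inter_eq : ∀ s ∈ elems, ∀ t ∈ elems,
    convexHull ℝ (s : Set Plane) ∩ convexHull ℝ (t : Set Plane)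
      = convexHull ℝ ((s : Set Plane) ∩ (t : Set Plane))
  cover : ⋃ t ∈ elems, convexHull ℝ (t : Set Plane) = closure Ω

/-- The closed triangle with vertex set `t`. -/
def tri (t : Finset Plane) : Set Plane := convexHull ℝ (t : Set Plane)

/-- The affine map on the element `t` with the values of `g` at the vertices of `t`
(it exists and is unique when `t` consists of three affinely independent points). -/
def localAffine {F : Type*} [AddCommGroup F] [Module ℝ F] (t : Finset Plane) (g : Plane → F) :
    Plane →ᵃ[ℝ] F :=
  Classical.epsilon fun a : Plane →ᵃ[ℝ] F => ∀ z ∈ t, a z = g z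

theorem localAffine_apply {F : Type*} [AddCommGroup F] [Module ℝ F] {t : Finset Plane}
    (hcard : t.card = 3) (ht : AffineIndependent ℝ ((↑) : t → Plane)) (g : Plane → F)
    {z : Plane} (hz : z ∈ t) : localAffine t g z = g z := by
  have hex : ∃ a : Plane →ᵃ[ℝ] F, ∀ z ∈ t, a z = g z := by
    have htop : affineSpan ℝ (range ((↑) : t → Plane)) = ⊤ := by
      rw [ht.affineSpan_eq_top_iff_card_eq_finrank_add_one]
      simp [hcard]
    let b : AffineBasis t ℝ Plane := ⟨(↑), ht, htop⟩
    refine ⟨∑ i : t, (LinearMap.toSpanSingleton ℝ F (g i)).toAffineMap.comp (b.coord i), ?_⟩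
    intro z hz
    have hb : z = b ⟨z, hz⟩ := rfl
    have key : ∀ s : Finset t, (∑ i ∈ s,
        (LinearMap.toSpanSingleton ℝ F (g i)).toAffineMap.comp (b.coord i)) z
        = ∑ i ∈ s, b.coord i z • g i := by
      intro s
      classical
      induction s using Finset.induction_on with
      | empty => simp
      | insert i s hi ih => rw [Finset.sum_insert hi, Finset.sum_insert hi, ← ih]; simp
    rw [key]
    classical
    rw [Finset.sum_eq_single (⟨z, hz⟩ : t)]
    · have h1 : b.coord ⟨z, hz⟩ z = 1 := b.coord_apply_eq ⟨z, hz⟩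
      rw [h1, one_smul]
    · intro j _ hj
      rw [hb, b.coord_apply_ne hj, zero_smul]
    · simp
  exact Classical.epsilon_spec hex z hz

namespace Triangulation

variable {Ω : Set Plane} (T : Triangulation Ω)

/-- The vertices of the triangulation. -/
def vertices : Set Plane := {z | ∃ t ∈ T.elems, z ∈ t}

/-- The mesh size `h`, the largest diameter of an element. -/
def meshSize : ℝ := ⨆ t : T.elems, Metric.diam (tri t)

/-- The element patch `ω_z`, the union of the elements that contain `z`. -/
def patch (z : Plane) : Set Plane := ⋃ t ∈ {t | t ∈ T.elems ∧ z ∈ tri t}, tri t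

/-- Regularity with constant `σ`: every element `t` contains a disc of radius `ρ` with
`diam t ≤ σ ρ`. -/
def IsRegular (σ : ℝ) : Prop :=
  ∀ t ∈ T.elems, ∃ (c : Plane) (ρ : ℝ), 0 < ρ ∧ Metric.closedBall c ρ ⊆ tri t ∧
    Metric.diam (tri t) ≤ σ * ρ

/-- The `C⁰` linear finite element space `V_h`: functions that are affine on every closed element
(hence continuous on the closure of `Ω`). Values off the closure of `Ω` play no role. -/
def V : Set (Plane → ℝ) :=
  {v | ∀ t ∈ T.elems, ∃ a : Plane →ᵃ[ℝ] ℝ, ∀ x ∈ tri t, v x = a x}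

/-- The subspace `V_h^0` of functions of `V_h` that vanish on the boundary of `Ω`. -/
def V0 : Set (Plane → ℝ) := {v | v ∈ T.V ∧ ∀ x ∈ frontier Ω, v x = 0}

open Classical in
/-- The continuous piecewise linear interpolation of `g`, that is `∑_z g(z) φ_z` with the nodal
shape functions `φ_z`: on each element the affine function with the values of `g` at its
vertices. It is set to zero off the closure of `Ω`. -/
def interp {F : Type*} [AddCommGroup F] [Module ℝ F] (g : Plane → F) (x : Plane) : F :=
  if h : ∃ t ∈ T.elems, x ∈ tri t then localAffine h.choose g x else 0

end Triangulation

/-! ### Polynomial preserving recovery (PPR) -/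

/-- The quadratic polynomial in two variables with coefficient vector `c`. -/
def quad (c : Fin 6 → ℝ) (x : Plane) : ℝ :=
  c 0 + c 1 * x 0 + c 2 * x 1 + c 3 * x 0 ^ 2 + c 4 * (x 0 * x 1) + c 5 * x 1 ^ 2

/-- The gradient of `quad c` at `x`. -/
def quadGrad (c : Fin 6 → ℝ) (x : Plane) : Plane :=
  !₂[c 1 + 2 * c 3 * x 0 + c 4 * x 1, c 2 + c 4 * x 0 + 2 * c 5 * x 1]

/-- The quadratic polynomial with coefficients `c` is the discrete least-squares fit of `v` at
the sampling points in `P`. -/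
def IsFit (P : Finset Plane) (v : Plane → ℝ) (c : Fin 6 → ℝ) : Prop :=
  ∀ d : Fin 6 → ℝ, ∑ x ∈ P, (quad c x - v x) * quad d x = 0

/-- The nodal value `G_h v (z)`: the gradient at `z` of the quadratic least-squares fit of `v` at
the sampling points `S z`. -/
def recoverAt (S : Plane → Finset Plane) (v : Plane → ℝ) (z : Plane) : Plane :=
  quadGrad (Classical.epsilon fun c => IsFit (S z) v c) z

namespace Triangulation

variable {Ω : Set Plane} (T : Triangulation Ω)

/-- Sampling sets for PPR. The sampling points of a vertex `z` are vertices of the mesh, at a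
distance of at most `R` patch diameters from `z` (so that patches with too few vertices, as near
the boundary, may be enlarged), and they are unisolvent for quadratic polynomials with constant
`κ`: in the coordinates centred at `z` and scaled by the patch diameter, the mean of the squares
of a quadratic polynomial over the sampling points is at least `κ` times the sum of the squares
of its coefficients. -/
structure IsSampling (R κ : ℝ) (S : Plane → Finset Plane) : Prop where
  subset : ∀ z ∈ T.vertices, ∀ x ∈ S z, x ∈ T.vertices
  dist_le : ∀ z ∈ T.vertices, ∀ x ∈ S z, dist x z ≤ R * Metric.diam (T.patch z)
  unisolvent : ∀ z ∈ T.vertices, ∀ c : Fin 6 → ℝ,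
    κ * ∑ i, c i ^ 2 ≤
      (∑ x ∈ S z, quad c ((Metric.diam (T.patch z))⁻¹ • (x - z)) ^ 2) / ((S z).card : ℝ)

/-- The recovered gradient `G_h v`. -/
def G (S : Plane → Finset Plane) (v : Plane → ℝ) : Plane → Plane := T.interp (recoverAt S v)

/-- The space `V_h^{0,0}`: the functions of `V_h^0` whose recovered gradient has vanishing
tangential trace, that is, is normal to every mesh edge on the boundary of `Ω`. -/
def V00 (S : Plane → Finset Plane) : Set (Plane → ℝ) :=
  {v | v ∈ T.V0 ∧ ∀ t ∈ T.elems, ∀ a ∈ t, ∀ b ∈ t, segment ℝ a b ⊆ frontier Ω →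
    ∀ x ∈ segment ℝ a b, ⟪T.G S v x, b - a⟫ = 0}

end Triangulation

/-- The value of `D G_h v` on the element `t`, with entries `(i, j) ↦ ∂_i (G_h v)_j`. -/
def DG (S : Plane → Finset Plane) (v : Plane → ℝ) (t : Finset Plane) :
    Matrix (Fin 2) (Fin 2) ℝ :=
  fun i j => (localAffine t (recoverAt S v)).linear (basisVec i) j

namespace Triangulation

variable {Ω : Set Plane} (T : Triangulation Ω)

/-- The bilinear form `a_{1,h}`. -/
def form (S : Plane → Finset Plane) (A : Plane → Matrix (Fin 2) (Fin 2) ℝ)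
    (v w : Plane → ℝ) : ℝ :=
  ∑ t ∈ T.elems, ∫ x in tri t,
    (contract (A x) (DG S v t) * contract (A x) (DG S w t) + rot (DG S v t) * rot (DG S w t))

/-- The right-hand side `(f, A : D G_h v)`. -/
def load (S : Plane → Finset Plane) (A : Plane → Matrix (Fin 2) (Fin 2) ℝ)
    (f v : Plane → ℝ) : ℝ :=
  ∑ t ∈ T.elems, ∫ x in tri t, f x * contract (A x) (DG S v t)

/-- The energy seminorm `‖v‖_{a,1}`. -/
def energyNorm (S : Plane → Finset Plane) (A : Plane → Matrix (Fin 2) (Fin 2) ℝ)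
    (v : Plane → ℝ) : ℝ :=
  Real.sqrt (T.form S A v v)

/-- The `L²` norm of `H - D G_h v`. -/
def hessError (S : Plane → Finset Plane) (H : Plane → Matrix (Fin 2) (Fin 2) ℝ)
    (v : Plane → ℝ) : ℝ :=
  Real.sqrt (∑ t ∈ T.elems, ∫ x in tri t, contract (H x - DG S v t) (H x - DG S v t))

/-- `u_h ∈ V_h^{0,0}` satisfies the equation of the GRBL scheme for all test functions in `W`. -/
structure IsGRBLSolution (S : Plane → Finset Plane) (A : Plane → Matrix (Fin 2) (Fin 2) ℝ)
    (f : Plane → ℝ) (W : Set (Plane → ℝ)) (uh : Plane → ℝ) : Prop where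
  mem : uh ∈ T.V00 S
  equation : ∀ v ∈ W, T.form S A uh v = T.load S A f v

end Triangulation

end GRBL

end

open GRBL

/-! The scheme minimises a least-squares residual, so the error splits into a Galerkin part and an
approximation part.

Energy. The Hessian satisfies `A : D²u = f` and, being symmetric, has rotation zero. If `e = u_h -
u_I` is an admissible test function, the residual of `u_I` equals the residual of `u_h` plus the
energy of `e`, up to terms that the discrete equation removes. Hence the energy of `e` is at most a
constant times the squared `L²` norm of `D²u - DG_h u_I` (`form_self_le`).

Hessian. For a 2×2 matrix `M`, ellipticity bounds `|M|²` by `(A : M)²`, `(rot M)²` and `-det M`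
(`IsElliptic.contract_self_le`). The determinant has no sign, but it is a null Lagrangian: for a
continuous piecewise linear field its integral is a sum of edge terms, in which interior edges
cancel and boundary edges vanish when the tangential trace does (`sum_volume_mul_det_eq_zero`). This
is applied to `G_h u_h` minus the nodal interpolant of `∇u`, not to `G_h(u_h - u_I)`: the recovered
gradient of `u_I` need not be normal to the boundary, whereas `∇u` is, because `u` vanishes there.
Both conclusions thus reduce to two approximation errors: that of the interpolated gradient, and
that of the recovery applied to `u_I`.

Approximation. Over a disc, average the second-order Taylor polynomials of `u`, with the Hessian
frozen at its disc mean. Following `u` along homotheties towards a point gives a pointwise error of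
order `L^(1+α)` times the fractional seminorm (`abs_sub_quad_taylorCoeff_le`). Comparing these
polynomials on discs shrinking dyadically to a point gives the nodal values of `∇u`, with error of
order `L^α` (`exists_pointwise_gradient`). The least-squares fit reproduces quadratics and is stable
by the unisolvence constant, so the recovered gradient has the same accuracy at vertices
(`norm_recoverAt_sub_le_of_mem`).

Summation. The recovery error lives on neighbourhoods of the elements, and on a graded mesh many of
these may meet at a point. Their overlap weighted by `diam^(2α)` is nevertheless bounded by
comparison with the integral of `|y-x|^(2α-2)` (`IsRegular.sum_diam_rpow_le`). This gives the factor
`h^(2α)` with shape regularity alone. -/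

noncomputable section

namespace GRBL

open Filter Topology

/-! ### Pairing with dilated kernels -/

/-- The kernel `ζ` recentred at `x` and dilated by the factor `s`, with its integral preserved. -/
def dilate (x : Plane) (s : ℝ) (ζ : Plane → ℝ) (y : Plane) : ℝ :=
  (s ^ 2)⁻¹ * ζ (s⁻¹ • (y - x))

lemma sum_smul_basisVec (v : Plane) : ∑ i, v i • basisVec i = v := by
  ext j
  fin_cases j <;> simp [basisVec, Fin.sum_univ_two]

lemma fderiv_apply_eq_sum (ζ : Plane → ℝ) (a v : Plane) :
    fderiv ℝ ζ a v = ∑ i, v i * fderiv ℝ ζ a (basisVec i) := by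
  conv_lhs => rw [← sum_smul_basisVec v, map_sum]
  simp

lemma contDiff_coord (i : Fin 2) : ContDiff ℝ ∞ (fun v : Plane => v i) :=
  (EuclideanSpace.proj i : Plane →L[ℝ] ℝ).contDiff

lemma contDiff_dilate {x : Plane} {s : ℝ} {ζ : Plane → ℝ} (hζ : ContDiff ℝ ∞ ζ) :
    ContDiff ℝ ∞ (dilate x s ζ) := by
  unfold dilate
  fun_prop

lemma hasCompactSupport_dilate {x : Plane} {s : ℝ} (hs : s ≠ 0) {ζ : Plane → ℝ}
    (hζ : HasCompactSupport ζ) : HasCompactSupport (dilate x s ζ) := by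
  have h1 : HasCompactSupport (fun y : Plane => ζ (s⁻¹ • (y - x))) := by
    have := hζ.comp_homeomorph
      ((Homeomorph.subRight x).trans (Homeomorph.smulOfNeZero (s⁻¹) (inv_ne_zero hs)))
    exact this
  exact h1.mul_left

lemma tsupport_dilate_subset {x : Plane} {s : ℝ} {ζ : Plane → ℝ} {y : Plane}
    (hy : y ∈ tsupport (dilate x s ζ)) : s⁻¹ • (y - x) ∈ tsupport ζ := by
  have hcont : Continuous (fun y : Plane => s⁻¹ • (y - x)) := by fun_prop
  have hcl : IsClosed ((fun y : Plane => s⁻¹ • (y - x)) ⁻¹' tsupport ζ) :=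
    (isClosed_tsupport ζ).preimage hcont
  refine closure_minimal ?_ hcl hy
  intro y hy
  apply subset_tsupport
  simp only [Function.mem_support, dilate] at hy ⊢
  exact fun h => hy (by rw [h, mul_zero])

lemma HasCompactSupport.exists_abs_le {ζ : Plane → ℝ} (hc : HasCompactSupport ζ)
    (hζ : Continuous ζ) : ∃ K, 0 ≤ K ∧ ∀ v, |ζ v| ≤ K := by
  obtain ⟨K, hK⟩ := hζ.bounded_above_of_compact_support hc
  exact ⟨K, (norm_nonneg _).trans (hK 0), hK⟩

lemma hasDerivAt_dilate {ζ : Plane → ℝ} (hζ : ContDiff ℝ ∞ ζ) (x y : Plane) {s : ℝ}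
    (hs : s ≠ 0) :
    HasDerivAt (fun s => dilate x s ζ y)
      (-(s ^ 3)⁻¹ * (2 * ζ (s⁻¹ • (y - x)) +
        fderiv ℝ ζ (s⁻¹ • (y - x)) (s⁻¹ • (y - x)))) s := by
  have h1 : HasDerivAt (fun s : ℝ => s⁻¹ • (y - x)) ((-(s ^ 2)⁻¹) • (y - x)) s :=
    (hasDerivAt_inv hs).smul_const (y - x)
  have hd : DifferentiableAt ℝ ζ (s⁻¹ • (y - x)) :=
    (hζ.differentiable (by simp)).differentiableAt
  have h2 := hd.hasFDerivAt.comp_hasDerivAt s h1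
  have h3 : HasDerivAt (fun s : ℝ => (s ^ 2)⁻¹) (-(2 * s) / (s ^ 2) ^ 2) s := by
    have := (hasDerivAt_pow 2 s).fun_inv (pow_ne_zero 2 hs)
    simpa using this
  have h4 := h3.mul h2
  refine h4.congr_deriv ?_
  simp only [map_smul, smul_eq_mul, Function.comp]
  field_simp
  ring

lemma fderiv_dilate_coord_mul {ζ : Plane → ℝ} (hζ : ContDiff ℝ ∞ ζ) (x y : Plane) {s : ℝ}
    (i : Fin 2) :
    fderiv ℝ (dilate x s (fun v => v i * ζ v)) y (basisVec i) =
      (s ^ 2)⁻¹ * s⁻¹ * (ζ (s⁻¹ • (y - x)) +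
        (s⁻¹ • (y - x)) i * fderiv ℝ ζ (s⁻¹ • (y - x)) (basisVec i)) := by
  have hd : DifferentiableAt ℝ ζ (s⁻¹ • (y - x)) :=
    (hζ.differentiable (by simp)).differentiableAt
  have h1 : HasFDerivAt (fun y : Plane => s⁻¹ • (y - x)) (s⁻¹ • ContinuousLinearMap.id ℝ Plane) y :=
    ((hasFDerivAt_id y).sub_const x).const_smul s⁻¹
  have h0 : HasFDerivAt (fun v : Plane => v i) (EuclideanSpace.proj i : Plane →L[ℝ] ℝ)
      (s⁻¹ • (y - x)) := (EuclideanSpace.proj i : Plane →L[ℝ] ℝ).hasFDerivAt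
  have h2 := ((h0.mul hd.hasFDerivAt).comp y h1).const_mul (s ^ 2)⁻¹
  have h3 : HasFDerivAt (dilate x s (fun v => v i * ζ v)) _ y := h2
  rw [h3.fderiv]
  simp [basisVec]
  ring

/-- Formally this differentiates `∫ w(x + s v) ζ(v) dv` under the integral, giving `∫ v·∇w(x + s v)
ζ(v) dv`. To do it weakly, the `s`-derivative of the dilated kernel is recognised as minus the
divergence of the dilated field `v ζ(v)`, and the components of that field serve as test functions.
-/
theorem hasDerivAt_integral_dilate {Ω : Set Plane} {w : Plane → ℝ} {g : Fin 2 → Plane → ℝ}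
    (hw : IntegrableOn w Ω) (hweak : ∀ i, HasWeakPartial Ω i w (g i))
    {ζ : Plane → ℝ} (hζ : ContDiff ℝ ∞ ζ) (hc : HasCompactSupport ζ) {x : Plane} {s : ℝ}
    (hs : 0 < s) (hsupp : ∀ y, s⁻¹ • (y - x) ∈ tsupport ζ → y ∈ Ω) :
    HasDerivAt (fun s => ∫ y in Ω, w y * dilate x s ζ y)
      (∑ i, ∫ y in Ω, g i y * dilate x s (fun v => v i * ζ v) y) s := by
  set ψ : Plane → ℝ := fun v => 2 * ζ v + fderiv ℝ ζ v v with hψ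
  have hfd : Continuous (fderiv ℝ ζ) := hζ.continuous_fderiv (by simp)
  have hψc : Continuous ψ := by
    have := hζ.continuous
    exact (continuous_const.mul this).add (hfd.clm_apply continuous_id)
  have hψs : HasCompactSupport ψ := by
    refine HasCompactSupport.add hc.mul_left ?_
    refine (hc.fderiv (𝕜 := ℝ)).mono fun v hv => ?_
    simp only [Function.mem_support] at hv ⊢
    exact fun h => hv (by rw [h]; simp)
  obtain ⟨K, hK0, hK⟩ := HasCompactSupport.exists_abs_le hψs hψc
  have hcont : ∀ (s : ℝ) (ζ : Plane → ℝ), Continuous ζ → Continuous (dilate x s ζ) := by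
    intro s ζ h
    unfold dilate
    fun_prop
  have hbd : ∀ (s : ℝ) (ζ : Plane → ℝ), Continuous ζ → HasCompactSupport ζ → ∀ w : Plane → ℝ,
      IntegrableOn w Ω → IntegrableOn (fun y => w y * dilate x s ζ y) Ω := by
    intro s ζ h h' w hw
    obtain ⟨K, -, hK⟩ := HasCompactSupport.exists_abs_le h' h
    refine hw.mul_bdd (c := (s ^ 2)⁻¹ * K) (hcont s ζ h).aestronglyMeasurable
      (Eventually.of_forall fun y => ?_)
    rw [dilate, Real.norm_eq_abs, abs_mul, abs_of_nonneg (by positivity)]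
    gcongr
    exact hK _
  -- Staying above `s / 2` keeps the factor `s⁻³` bounded, which yields an integrable dominating
  -- function.
  have key := hasDerivAt_integral_of_dominated_loc_of_deriv_le
    (μ := volume.restrict Ω) (F := fun s y => w y * dilate x s ζ y)
    (F' := fun s y => w y * (-(s ^ 3)⁻¹ * ψ (s⁻¹ • (y - x))))
    (bound := fun y => |w y| * (((s / 2) ^ 3)⁻¹ * K)) (x₀ := s)
    (s := Ioi (s / 2)) (Ioi_mem_nhds (by linarith))
    (Eventually.of_forall fun s' => (hbd s' ζ hζ.continuous hc w hw).aestronglyMeasurable)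
    (hbd s ζ hζ.continuous hc w hw)
    (by
      refine hw.aestronglyMeasurable.mul (Continuous.aestronglyMeasurable ?_)
      fun_prop)
    (Eventually.of_forall fun y s' hs' => by
      have hs'' : 0 < s' := lt_trans (by linarith) hs'
      rw [Real.norm_eq_abs, abs_mul, abs_mul, abs_neg, abs_of_nonneg (by positivity : 0 ≤ (s' ^ 3)⁻¹)]
      have : s / 2 ≤ s' := le_of_lt hs'
      gcongr
      exact hK _)
    ((hw.abs).mul_const _)
    (Eventually.of_forall fun y s' hs' =>
      (hasDerivAt_dilate hζ x y (ne_of_gt (lt_trans (by linarith) hs'))).const_mul (w y))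
  refine key.2.congr_deriv ?_
  have hφ : ∀ i, ContDiff ℝ ∞ (fun v : Plane => v i * ζ v) := fun i => (contDiff_coord i).mul hζ
  have hφc : ∀ i : Fin 2, HasCompactSupport (fun v : Plane => v i * ζ v) := fun i => hc.mul_left
  have htest : ∀ i, ∫ y in Ω, g i y * dilate x s (fun v => v i * ζ v) y
      = -∫ y in Ω, w y * fderiv ℝ (dilate x s (fun v => v i * ζ v)) y (basisVec i) := by
    intro i
    rw [hweak i _ (contDiff_dilate (hφ i)) (hasCompactSupport_dilate hs.ne' (hφc i)), neg_neg]
    intro y hy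
    refine hsupp y (closure_mono ?_ (tsupport_dilate_subset hy))
    intro v hv
    simp only [Function.mem_support] at hv ⊢
    exact fun h => hv (by rw [h, mul_zero])
  simp_rw [htest]
  rw [Finset.sum_neg_distrib, ← integral_finsetSum, ← integral_neg]
  · refine integral_congr_ae (Eventually.of_forall fun y => ?_)
    simp only [fderiv_dilate_coord_mul hζ, hψ]
    rw [fderiv_apply_eq_sum ζ _ (s⁻¹ • (y - x))]
    simp only [Fin.sum_univ_two]
    field_simp
    ring
  · intro i _
    simp only [fderiv_dilate_coord_mul hζ]
    have h1 : Continuous (fun v : Plane => ζ v + v i * fderiv ℝ ζ v (basisVec i)) := by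
      have := hζ.continuous
      exact this.add (((contDiff_coord i).continuous).mul (hfd.clm_apply continuous_const))
    have h2 : HasCompactSupport (fun v : Plane => ζ v + v i * fderiv ℝ ζ v (basisVec i)) := by
      refine hc.add (HasCompactSupport.mul_left ?_)
      refine (hc.fderiv (𝕜 := ℝ)).mono fun v hv => ?_
      simp only [Function.mem_support] at hv ⊢
      exact fun h => hv (by rw [h]; simp)
    refine ((hbd s _ h1 h2 w hw).mul_const s⁻¹).congr (Eventually.of_forall fun y => ?_)
    simp only [dilate]
    ring

/-! ### The weak Hessian -/

lemma integrableOn_of_memLp_two {Ω : Set Plane} (hΩ : volume Ω ≠ ⊤) {w : Plane → ℝ}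
    (hw : MemLp w 2 (volume.restrict Ω)) : IntegrableOn w Ω := by
  have : IsFiniteMeasure (volume.restrict Ω) := ⟨by simpa using hΩ.lt_top⟩
  exact hw.integrable one_le_two

/-- Paired with a test function, either mixed entry becomes `u` paired with a second derivative of
that function. Those commute, and the fundamental lemma of the calculus of variations concludes. -/
theorem IsSobolev.hess_symm {Ω : Set Plane} (hΩo : IsOpen Ω) (hΩ : volume Ω ≠ ⊤) {α : ℝ}
    {u : Plane → ℝ} {p : Plane → Plane} {H : Plane → Matrix (Fin 2) (Fin 2) ℝ}
    (h : IsSobolev Ω α u p H) (i j : Fin 2) :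
    ∀ᵐ x ∂(volume.restrict Ω), H x i j = H x j i := by
  have hH : ∀ i j, IntegrableOn (fun x => H x i j) Ω := fun i j =>
    integrableOn_of_memLp_two hΩ (h.memLp_hess i j)
  have hprod : ∀ i j (φ : Plane → ℝ), Continuous φ → HasCompactSupport φ →
      IntegrableOn (fun x => H x i j * φ x) Ω := by
    intro i j φ hφ hc
    obtain ⟨K, -, hK⟩ := HasCompactSupport.exists_abs_le hc hφ
    exact (hH i j).mul_bdd (c := K) hφ.aestronglyMeasurable (Eventually.of_forall hK)
  have key : ∀ i j (φ : Plane → ℝ), ContDiff ℝ ∞ φ → HasCompactSupport φ → tsupport φ ⊆ Ω →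
      ∫ x in Ω, H x i j * φ x
        = ∫ x in Ω, u x * fderiv ℝ (fderiv ℝ φ) x (basisVec j) (basisVec i) := by
    intro i j φ hφ hc hs
    have h1 := h.weak_hess i j φ hφ hc hs
    have hfd : ContDiff ℝ ∞ (fderiv ℝ φ) := hφ.fderiv_right (by simp)
    have h2 := h.weak_grad j (fun x => fderiv ℝ φ x (basisVec i)) (hfd.clm_apply contDiff_const)
      (hc.fderiv_apply (𝕜 := ℝ) _) ((tsupport_fderiv_apply_subset ℝ _).trans hs)
    have h3 : ∀ x, fderiv ℝ (fun x => fderiv ℝ φ x (basisVec i)) x (basisVec j)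
        = fderiv ℝ (fderiv ℝ φ) x (basisVec j) (basisVec i) := by
      intro x
      have hd : DifferentiableAt ℝ (fderiv ℝ φ) x :=
        (hfd.differentiable (by simp)).differentiableAt
      rw [(hd.hasFDerivAt.clm_apply (hasFDerivAt_const (basisVec i) x)).fderiv]
      simp
    simp_rw [h3] at h2
    linarith
  have hz := hΩo.ae_eq_zero_of_integral_contDiff_smul_eq_zero (μ := volume)
    (f := fun x => H x i j - H x j i) ((hH i j).sub (hH j i)).locallyIntegrableOn (by
      intro φ hφ hc hs
      have h1 := key i j φ hφ hc hs
      have h2 := key j i φ hφ hc hs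
      have hsy : ∀ x, fderiv ℝ (fderiv ℝ φ) x (basisVec j) (basisVec i)
          = fderiv ℝ (fderiv ℝ φ) x (basisVec i) (basisVec j) := fun x =>
        (hφ.contDiffAt.isSymmSndFDerivAt (by
          simpa using! WithTop.coe_le_coe.mpr (le_top : (2 : ℕ∞) ≤ ⊤))) _ _
      simp_rw [hsy] at h1
      rw [← setIntegral_eq_integral_of_forall_compl_eq_zero (s := Ω)]
      · rw [← sub_eq_zero.mpr (h1.trans h2.symm),
          ← integral_sub (hprod i j φ hφ.continuous hc) (hprod j i φ hφ.continuous hc)]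
        refine integral_congr_ae (Eventually.of_forall fun x => ?_)
        simp only [smul_eq_mul]
        ring
      · intro x hx
        rw [image_eq_zero_of_notMem_tsupport (fun hx' => hx (hs hx')), zero_smul])
  rw [ae_restrict_iff' hΩo.measurableSet]
  filter_upwards [hz] with x hx hxΩ
  linarith [hx hxΩ]

/-! ### The fractional seminorm -/

/-- The squared Sobolev-Slobodeckij seminorm of `H` on `U`. -/
def slobSq (α : ℝ) (H : Plane → Matrix (Fin 2) (Fin 2) ℝ) (U : Set Plane) : ℝ :=
  ∫ xy, slobodeckij α H xy ∂((volume.restrict U).prod (volume.restrict U))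

lemma contract_self_nonneg (M : Matrix (Fin 2) (Fin 2) ℝ) : 0 ≤ contract M M :=
  Finset.sum_nonneg fun _ _ => Finset.sum_nonneg fun _ _ => mul_self_nonneg _

lemma slobodeckij_nonneg (α : ℝ) (H : Plane → Matrix (Fin 2) (Fin 2) ℝ) (xy : Plane × Plane) :
    0 ≤ slobodeckij α H xy :=
  div_nonneg (contract_self_nonneg _) (by positivity)

lemma slobSq_nonneg (α : ℝ) (H : Plane → Matrix (Fin 2) (Fin 2) ℝ) (U : Set Plane) :
    0 ≤ slobSq α H U :=
  integral_nonneg fun _ => slobodeckij_nonneg _ _ _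

lemma slobSq_mono {α : ℝ} {H : Plane → Matrix (Fin 2) (Fin 2) ℝ} {U V : Set Plane}
    (hUV : U ⊆ V)
    (hint : Integrable (slobodeckij α H) ((volume.restrict V).prod (volume.restrict V))) :
    slobSq α H U ≤ slobSq α H V := by
  refine integral_mono_measure ?_ (Eventually.of_forall fun _ => slobodeckij_nonneg _ _ _) hint
  exact Measure.prod_mono (Measure.restrict_mono_set _ hUV) (Measure.restrict_mono_set _ hUV)

lemma contract_sub_le_slobodeckij {α L : ℝ} (hα : 0 < α)
    (H : Plane → Matrix (Fin 2) (Fin 2) ℝ) {y y' : Plane} (hL : dist y y' ≤ L) :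
    contract (H y - H y') (H y - H y') ≤ L ^ (2 + 2 * α) * slobodeckij α H (y, y') := by
  rcases eq_or_ne y y' with rfl | hne
  · have h0 : contract (H y - H y) (H y - H y) = 0 := by simp [contract]
    rw [h0]
    exact mul_nonneg (Real.rpow_nonneg (dist_nonneg.trans hL) _) (slobodeckij_nonneg _ _ _)
  · have hpos : 0 < ‖y - y'‖ := norm_pos_iff.mpr (sub_ne_zero.mpr hne)
    have hp : 0 < ‖y - y'‖ ^ (2 + 2 * α) := Real.rpow_pos_of_pos hpos _
    have hle : ‖y - y'‖ ^ (2 + 2 * α) ≤ L ^ (2 + 2 * α) :=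
      Real.rpow_le_rpow hpos.le (by rwa [← dist_eq_norm]) (by linarith)
    simp only [slobodeckij]
    rw [mul_div_assoc', le_div_iff₀ hp, mul_comm]
    exact mul_le_mul_of_nonneg_right hle (contract_self_nonneg _)

lemma sq_integral_le {X : Type*} [MeasurableSpace X] {μ : Measure X} [IsFiniteMeasure μ]
    {f : X → ℝ} (hf : MemLp f 2 μ) : (∫ x, f x ∂μ) ^ 2 ≤ μ.real univ * ∫ x, f x ^ 2 ∂μ := by
  have h1 : Integrable f μ := hf.integrable one_le_two
  have h2 : Integrable (fun x => f x ^ 2) μ := hf.integrable_sq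
  set m := μ.real univ with hm
  set I := ∫ x, f x ∂μ with hI
  -- Cauchy–Schwarz from the variance: the expansion is `m` times the defect, so only `m = 0` needs
  -- separate treatment.
  have h0 : 0 ≤ ∫ x, (m * f x - I) ^ 2 ∂μ := integral_nonneg fun _ => sq_nonneg _
  have h3 : ∫ x, (m * f x - I) ^ 2 ∂μ = m * (m * ∫ x, f x ^ 2 ∂μ - I ^ 2) := by
    have : ∀ x, (m * f x - I) ^ 2 = m ^ 2 * f x ^ 2 - 2 * m * I * f x + I ^ 2 := fun x => by ring
    simp_rw [this]
    rw [integral_add (f := fun x => m ^ 2 * f x ^ 2 - 2 * m * I * f x)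
        ((h2.const_mul _).sub (h1.const_mul _)) (integrable_const _),
      integral_sub (h2.const_mul _) (h1.const_mul _), integral_const_mul, integral_const_mul,
      integral_const, smul_eq_mul, ← hI, ← hm]
    ring
  rcases (measureReal_nonneg : 0 ≤ m).eq_or_lt with hm0 | hm0
  · have : μ = 0 := by
      rw [← Measure.measure_univ_eq_zero, ← measureReal_eq_zero_iff]; exact hm0.symm
    simp [hI, this]
  · rw [h3] at h0
    have := nonneg_of_mul_nonneg_right h0 hm0
    linarith

/-- The mean value of `H` over the disc with centre `c` and radius `ρ`. -/
def discMean (H : Plane → Matrix (Fin 2) (Fin 2) ℝ) (c : Plane) (ρ : ℝ) :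
    Matrix (Fin 2) (Fin 2) ℝ :=
  fun i j => (volume.real (Metric.closedBall c ρ))⁻¹ * ∫ y in Metric.closedBall c ρ, H y i j

lemma volume_real_closedBall (c : Plane) {ρ : ℝ} (hρ : 0 ≤ ρ) :
    volume.real (Metric.closedBall c ρ) = Real.pi * ρ ^ 2 := by
  rw [measureReal_def, EuclideanSpace.volume_closedBall_fin_two]
  simp [hρ, Real.pi_nonneg]
  ring

lemma discMean_symm {H : Plane → Matrix (Fin 2) (Fin 2) ℝ} {c : Plane} {ρ : ℝ} {Ω : Set Plane}
    (hsub : Metric.closedBall c ρ ⊆ Ω)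
    (hsym : ∀ i j, ∀ᵐ x ∂(volume.restrict Ω), H x i j = H x j i) (i j : Fin 2) :
    discMean H c ρ i j = discMean H c ρ j i := by
  simp only [discMean]
  rw [integral_congr_ae (ae_restrict_of_ae_restrict_of_subset hsub (hsym i j))]

/-- A Poincaré inequality: the oscillation of `H` on `U` about its mean value over a disc. -/
theorem integral_contract_sub_discMean_le {α : ℝ} (hα : 0 < α)
    {H : Plane → Matrix (Fin 2) (Fin 2) ℝ} {U : Set Plane} (hU : MeasurableSet U)
    (hUfin : volume U ≠ ⊤)
    (hH : ∀ i j, MemLp (fun x => H x i j) 2 (volume.restrict U))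
    (hint : Integrable (slobodeckij α H) ((volume.restrict U).prod (volume.restrict U)))
    {L : ℝ} (hL : ∀ y ∈ U, ∀ y' ∈ U, dist y y' ≤ L) {c : Plane} {ρ : ℝ} (hρ : 0 < ρ)
    (hsub : Metric.closedBall c ρ ⊆ U) :
    ∫ y in U, contract (H y - discMean H c ρ) (H y - discMean H c ρ)
      ≤ L ^ (2 + 2 * α) * (Real.pi * ρ ^ 2)⁻¹ * slobSq α H U := by
  set B := Metric.closedBall c ρ with hB
  set M := discMean H c ρ with hM
  have : IsFiniteMeasure (volume.restrict U) := ⟨by simpa using hUfin.lt_top⟩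
  have hBfin : volume B ≠ ⊤ := ne_top_of_le_ne_top hUfin (measure_mono hsub)
  have : IsFiniteMeasure (volume.restrict B) := ⟨by simpa using hBfin.lt_top⟩
  have hHB : ∀ i j, MemLp (fun x => H x i j) 2 (volume.restrict B) := fun i j =>
    (hH i j).mono_measure (Measure.restrict_mono_set _ hsub)
  have hm : volume.real B = Real.pi * ρ ^ 2 := volume_real_closedBall c hρ.le
  have hm0 : 0 < Real.pi * ρ ^ 2 := by positivity
  have hLnn : 0 ≤ L := by
    have hc : c ∈ U := hsub (Metric.mem_closedBall_self hρ.le)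
    exact dist_nonneg.trans (hL c hc c hc)
  -- Jensen's inequality: the deviation from a mean is the mean deviation. Inserting the weight,
  -- which is at least `L^(-2-2α)` on `U`, turns the mean square into the fractional integrand.
  have hentry : ∀ y i j, (H y i j - M i j) ^ 2
      ≤ (Real.pi * ρ ^ 2)⁻¹ * ∫ y' in B, (H y i j - H y' i j) ^ 2 := by
    intro y i j
    have hmem : MemLp (fun y' => H y i j - H y' i j) 2 (volume.restrict B) :=
      (memLp_const _).sub (hHB i j)
    have h1 := sq_integral_le hmem
    rw [integral_sub (integrable_const _) ((hHB i j).integrable one_le_two), integral_const,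
      measureReal_restrict_apply_univ, hm, smul_eq_mul] at h1
    have h2 : H y i j - M i j = (Real.pi * ρ ^ 2)⁻¹ *
        (Real.pi * ρ ^ 2 * H y i j - ∫ y' in B, H y' i j) := by
      rw [hM, discMean, ← hB, hm]
      field_simp
    rw [h2, mul_pow, sq (Real.pi * ρ ^ 2)⁻¹, mul_assoc]
    refine mul_le_mul_of_nonneg_left ?_ (by positivity)
    rw [inv_mul_le_iff₀ hm0]
    exact h1
  have hcon : ∀ X : Matrix (Fin 2) (Fin 2) ℝ, contract X X = ∑ i, ∑ j, X i j ^ 2 := fun X => by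
    simp [contract, sq]
  have hpt : ∀ᵐ y ∂(volume.restrict U), contract (H y - M) (H y - M)
      ≤ L ^ (2 + 2 * α) * (Real.pi * ρ ^ 2)⁻¹ *
        ∫ y', slobodeckij α H (y, y') ∂(volume.restrict U) := by
    filter_upwards [hint.prod_right_ae, ae_restrict_mem hU] with y hy hyU
    have h1 : contract (H y - M) (H y - M)
        ≤ (Real.pi * ρ ^ 2)⁻¹ * ∫ y' in B, contract (H y - H y') (H y - H y') := by
      simp_rw [hcon, Matrix.sub_apply]
      have hint2 : ∀ i j, IntegrableOn (fun y' => (H y i j - H y' i j) ^ 2) B := fun i j =>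
        ((memLp_const (H y i j)).sub (hHB i j)).integrable_sq
      rw [integral_finsetSum _ (fun i _ => integrable_finsetSum _ fun j _ => hint2 i j),
        Finset.mul_sum]
      refine Finset.sum_le_sum fun i _ => ?_
      rw [integral_finsetSum _ (fun j _ => hint2 i j), Finset.mul_sum]
      exact Finset.sum_le_sum fun j _ => hentry y i j
    refine h1.trans ?_
    rw [mul_comm (L ^ _), mul_assoc]
    refine mul_le_mul_of_nonneg_left ?_ (by positivity)
    calc ∫ y' in B, contract (H y - H y') (H y - H y')
        ≤ ∫ y' in B, L ^ (2 + 2 * α) * slobodeckij α H (y, y') := by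
          refine integral_mono_of_nonneg (Eventually.of_forall fun _ => contract_self_nonneg _)
            ((hy.mono_measure (Measure.restrict_mono_set _ hsub)).const_mul _) ?_
          filter_upwards [ae_restrict_mem measurableSet_closedBall] with y' hy'
          exact contract_sub_le_slobodeckij hα H (hL y hyU y' (hsub hy'))
      _ ≤ ∫ y' in U, L ^ (2 + 2 * α) * slobodeckij α H (y, y') := by
          refine setIntegral_mono_set (hy.const_mul _) (Eventually.of_forall fun _ =>
            mul_nonneg (Real.rpow_nonneg hLnn _) (slobodeckij_nonneg _ _ _))
            (Eventually.of_forall hsub)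
      _ = _ := integral_const_mul _ _
  calc ∫ y in U, contract (H y - M) (H y - M)
      ≤ ∫ y in U, L ^ (2 + 2 * α) * (Real.pi * ρ ^ 2)⁻¹ *
        ∫ y', slobodeckij α H (y, y') ∂(volume.restrict U) :=
        integral_mono_of_nonneg (Eventually.of_forall fun _ => contract_self_nonneg _)
          (hint.integral_prod_left.const_mul _) hpt
    _ = _ := by rw [integral_const_mul, slobSq, integral_prod _ hint]

/-! ### The smooth kernel of a disc -/

/-- A fixed smooth probability density supported in the closed unit disc. -/
def bump : Plane → ℝ :=
  (⟨1 / 2, 1, by norm_num, by norm_num⟩ : ContDiffBump (0 : Plane)).normed volume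

lemma contDiff_bump : ContDiff ℝ ∞ bump := ContDiffBump.contDiff_normed _

lemma bump_nonneg (v : Plane) : 0 ≤ bump v := ContDiffBump.nonneg_normed _ _

lemma integral_bump : ∫ v, bump v = 1 := ContDiffBump.integral_normed _

lemma tsupport_bump : tsupport bump = Metric.closedBall 0 1 := ContDiffBump.tsupport_normed_eq _

lemma hasCompactSupport_bump : HasCompactSupport bump := by
  rw [HasCompactSupport, tsupport_bump]
  exact isCompact_closedBall _ _

lemma exists_bump_le : ∃ K, 0 ≤ K ∧ ∀ v, bump v ≤ K := by
  obtain ⟨K, hK, h⟩ := HasCompactSupport.exists_abs_le hasCompactSupport_bump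
    contDiff_bump.continuous
  exact ⟨K, hK, fun v => (le_abs_self _).trans (h v)⟩

/-- An upper bound of `bump`. -/
def bumpBound : ℝ := exists_bump_le.choose

lemma bumpBound_nonneg : 0 ≤ bumpBound := exists_bump_le.choose_spec.1

lemma bump_le (v : Plane) : bump v ≤ bumpBound := exists_bump_le.choose_spec.2 v

lemma integral_dilate (x : Plane) {s : ℝ} (hs : 0 < s) (ζ : Plane → ℝ) :
    ∫ y, dilate x s ζ y = ∫ v, ζ v := by
  simp only [dilate]
  rw [integral_const_mul, integral_sub_right_eq_self (fun y => ζ (s⁻¹ • y)) x,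
    Measure.integral_comp_smul]
  simp only [finrank_euclideanSpace, Fintype.card_fin, smul_eq_mul]
  rw [abs_of_nonneg (by positivity)]
  field_simp

lemma tsupport_dilate_bump {c : Plane} {ρ : ℝ} (hρ : 0 < ρ) :
    tsupport (dilate c ρ bump) ⊆ Metric.closedBall c ρ := by
  intro y hy
  have h := tsupport_dilate_subset hy
  rw [tsupport_bump, mem_closedBall_zero_iff, norm_smul, norm_inv, Real.norm_of_nonneg hρ.le,
    inv_mul_le_iff₀ hρ, mul_one] at h
  rwa [Metric.mem_closedBall, dist_eq_norm]

lemma mem_closedBall_of_dilate {x c y : Plane} {s ρ : ℝ} (hs : 0 < s)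
    (h : s⁻¹ • (y - x) ∈ Metric.closedBall (c - x) ρ) :
    y ∈ Metric.closedBall (x + s • (c - x)) (s * ρ) := by
  rw [Metric.mem_closedBall, dist_eq_norm] at h ⊢
  have : y - (x + s • (c - x)) = s • (s⁻¹ • (y - x) - (c - x)) := by
    rw [smul_sub s (s⁻¹ • (y - x)), smul_smul, mul_inv_cancel₀ hs.ne', one_smul]
    abel
  rw [this, norm_smul, Real.norm_of_nonneg hs.le]
  gcongr

lemma continuous_dilate (x : Plane) (s : ℝ) {ζ : Plane → ℝ} (h : Continuous ζ) :
    Continuous (dilate x s ζ) := by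
  unfold dilate
  fun_prop

lemma integrableOn_mul_dilate {Ω : Set Plane} {w : Plane → ℝ} (hw : IntegrableOn w Ω)
    (x : Plane) (s : ℝ) {ζ : Plane → ℝ} (h : Continuous ζ) (h' : HasCompactSupport ζ) :
    IntegrableOn (fun y => w y * dilate x s ζ y) Ω := by
  obtain ⟨K, -, hK⟩ := HasCompactSupport.exists_abs_le h' h
  refine hw.mul_bdd (c := (s ^ 2)⁻¹ * K) (continuous_dilate x s h).aestronglyMeasurable
    (Eventually.of_forall fun y => ?_)
  rw [dilate, Real.norm_eq_abs, abs_mul, abs_of_nonneg (by positivity)]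
  gcongr
  exact hK _

/-- Pairing of an `L²` function with a dilated kernel supported in a disc. -/
lemma abs_integral_mul_dilate_le {Ω : Set Plane} (hΩ : MeasurableSet Ω) {w : Plane → ℝ}
    (hw : MemLp w 2 (volume.restrict Ω)) {ζ : Plane → ℝ} {K : ℝ}
    (hK0 : 0 ≤ K) (hK : ∀ v, |ζ v| ≤ K) {x c : Plane} {ρ s : ℝ} (hρ : 0 < ρ) (hs : 0 < s)
    (hsupp : tsupport ζ ⊆ Metric.closedBall (c - x) ρ)
    (hsub : Metric.closedBall (x + s • (c - x)) (s * ρ) ⊆ Ω) :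
    |∫ y in Ω, w y * dilate x s ζ y| ≤
      2 * K * ρ * s⁻¹ *
        √(∫ y in Metric.closedBall (x + s • (c - x)) (s * ρ), w y ^ 2) := by
  set B := Metric.closedBall (x + s • (c - x)) (s * ρ) with hB
  have hBfin : volume B ≠ ⊤ := measure_closedBall_lt_top.ne
  have : IsFiniteMeasure (volume.restrict B) := ⟨by simpa using hBfin.lt_top⟩
  have hwB : MemLp w 2 (volume.restrict B) := hw.mono_measure (Measure.restrict_mono_set _ hsub)
  have hzero : ∀ y, y ∉ B → dilate x s ζ y = 0 := by
    intro y hy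
    have : s⁻¹ • (y - x) ∉ tsupport ζ := fun h => hy (mem_closedBall_of_dilate hs (hsupp h))
    rw [dilate, image_eq_zero_of_notMem_tsupport this, mul_zero]
  have h1 : ∫ y in Ω, w y * dilate x s ζ y = ∫ y in B, w y * dilate x s ζ y :=
    setIntegral_eq_of_subset_of_forall_sdiff_eq_zero hΩ hsub fun y hy => by
      rw [hzero y hy.2, mul_zero]
  have h2 : |∫ y in B, w y * dilate x s ζ y| ≤ (s ^ 2)⁻¹ * K * ∫ y in B, |w y| := by
    rw [← integral_const_mul, ← Real.norm_eq_abs]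
    refine norm_integral_le_of_norm_le ((hwB.integrable one_le_two).abs.const_mul _)
      (Eventually.of_forall fun y => ?_)
    rw [dilate, Real.norm_eq_abs, abs_mul, abs_mul, abs_of_nonneg (by positivity : 0 ≤ (s ^ 2)⁻¹),
      mul_comm]
    gcongr
    exact hK _
  -- The factor `2` is `√π` rounded up. The gain `s ρ` from the area leaves only `s⁻¹` of the `s⁻²`
  -- in the kernel.
  have h3 : ∫ y in B, |w y| ≤ 2 * (s * ρ) * √(∫ y in B, w y ^ 2) := by
    have h4 := sq_integral_le hwB.abs
    rw [measureReal_restrict_apply_univ, hB, volume_real_closedBall _ (by positivity), ← hB] at h4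
    have hnn : 0 ≤ ∫ y in B, w y ^ 2 := integral_nonneg fun _ => sq_nonneg _
    refine abs_le_of_sq_le_sq' ?_ (by positivity) |>.2
    rw [mul_pow, Real.sq_sqrt hnn]
    refine h4.trans ?_
    simp only [Pi.abs_apply, sq_abs]
    refine mul_le_mul_of_nonneg_right ?_ hnn
    nlinarith [Real.pi_le_four, sq_nonneg (s * ρ)]
  rw [h1]
  refine h2.trans ((mul_le_mul_of_nonneg_left h3 (by positivity)).trans (le_of_eq ?_))
  field_simp

/-! ### The averaged Taylor polynomial -/

/-- The coefficients of the quadratic polynomial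
`x ↦ ∫ (u(y) + p(y)·(x - y) + ½ (x - y)ᵀ M (x - y)) η(y) dy` for a symmetric matrix `M`, with `η` the
smooth kernel of the disc with centre `c` and radius `ρ`. -/
def taylorCoeff (Ω : Set Plane) (u : Plane → ℝ) (p : Plane → Plane)
    (M : Matrix (Fin 2) (Fin 2) ℝ) (c : Plane) (ρ : ℝ) : Fin 6 → ℝ :=
  let I : (Plane → ℝ) → ℝ := fun w => ∫ y in Ω, w y * dilate c ρ bump y
  ![I u - I (fun y => p y 0 * y 0) - I (fun y => p y 1 * y 1)
      + (M 0 0 * I (fun y => y 0 * y 0) + 2 * M 0 1 * I (fun y => y 0 * y 1)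
        + M 1 1 * I (fun y => y 1 * y 1)) / 2,
    I (fun y => p y 0) - M 0 0 * I (fun y => y 0) - M 0 1 * I (fun y => y 1),
    I (fun y => p y 1) - M 0 1 * I (fun y => y 0) - M 1 1 * I (fun y => y 1),
    M 0 0 / 2, M 0 1, M 1 1 / 2]

lemma dilate_one_recentred (c x : Plane) (ρ : ℝ) (q : Plane → ℝ) (y : Plane) :
    dilate x 1 (fun v => q v * dilate (c - x) ρ bump v) y
      = q (y - x) * dilate c ρ bump y := by
  simp [dilate]

lemma abs_coord_le_norm (v : Plane) (i : Fin 2) : |v i| ≤ ‖v‖ := by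
  simpa using PiLp.norm_apply_le v i

section Taylor

variable {Ω : Set Plane} {α : ℝ} {u : Plane → ℝ} {p : Plane → Plane}
  {H : Plane → Matrix (Fin 2) (Fin 2) ℝ}

/-- Shows that the listed coefficients are those of the averaged Taylor polynomial, written in the
variables centred at `x` used below. The unit mass of the kernel on `Ω` produces the pure `x i * x
j` terms. -/
lemma quad_taylorCoeff (hΩb : Bornology.IsBounded Ω)
    (h : IsSobolev Ω α u p H) {M : Matrix (Fin 2) (Fin 2) ℝ} (hM : ∀ i j, M i j = M j i)
    {c : Plane} {ρ : ℝ} (hρ : 0 < ρ) (hsub : Metric.closedBall c ρ ⊆ Ω) (x : Plane) :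
    quad (taylorCoeff Ω u p M c ρ) x
      = (∫ y in Ω, u y * dilate c ρ bump y)
        - (∑ i, ∫ y in Ω, p y i * ((y - x) i * dilate c ρ bump y))
        + (∑ i, ∑ j, M j i * ∫ y in Ω, (y - x) j * ((y - x) i * dilate c ρ bump y)) / 2 := by
  have hfin : volume Ω ≠ ⊤ := hΩb.measure_lt_top.ne
  have hcont := continuous_dilate c ρ contDiff_bump.continuous
  have hcs := hasCompactSupport_dilate (x := c) hρ.ne' hasCompactSupport_bump
  have hi : ∀ i : Fin 2, Continuous fun y : Plane => y i := fun i => (contDiff_coord i).continuous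
  have hone : ∫ y in Ω, dilate c ρ bump y = 1 := by
    rw [setIntegral_eq_integral_of_forall_compl_eq_zero, integral_dilate c hρ, integral_bump]
    intro y hy
    exact image_eq_zero_of_notMem_tsupport fun h' => hy (hsub (tsupport_dilate_bump hρ h'))
  have hint : ∀ q : Plane → ℝ, Continuous q →
      IntegrableOn (fun y => q y * dilate c ρ bump y) Ω := fun q hq =>
    ((hq.mul hcont).integrable_of_hasCompactSupport hcs.mul_left).integrableOn
  have hintw : ∀ (w q : Plane → ℝ), IntegrableOn w Ω → Continuous q →
      IntegrableOn (fun y => w y * (q y * dilate c ρ bump y)) Ω := by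
    intro w q hw hq
    obtain ⟨K, -, hK⟩ := HasCompactSupport.exists_abs_le (ζ := fun y => q y * dilate c ρ bump y)
      hcs.mul_left (hq.mul hcont)
    exact hw.mul_bdd (c := K) (hq.mul hcont).aestronglyMeasurable (Eventually.of_forall hK)
  have hp : ∀ i, IntegrableOn (fun y => p y i) Ω := fun i =>
    integrableOn_of_memLp_two hfin (h.memLp_grad i)
  have h1 : ∀ i, ∫ y in Ω, p y i * ((y - x) i * dilate c ρ bump y)
      = (∫ y in Ω, p y i * y i * dilate c ρ bump y)
        - x i * ∫ y in Ω, p y i * dilate c ρ bump y := by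
    intro i
    rw [← integral_const_mul, ← integral_sub]
    · refine integral_congr_ae (Eventually.of_forall fun y => ?_)
      simp only [PiLp.sub_apply]
      ring
    · exact (hintw _ _ (hp i) (hi i)).congr (Eventually.of_forall fun y => by ring)
    · refine ((hintw _ _ (hp i) (continuous_const (y := (1 : ℝ)))).const_mul (x i)).congr
        (Eventually.of_forall fun y => by ring)
  have h2 : ∀ i j, ∫ y in Ω, (y - x) j * ((y - x) i * dilate c ρ bump y)
      = (∫ y in Ω, y i * y j * dilate c ρ bump y) - x i * (∫ y in Ω, y j * dilate c ρ bump y)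
        - x j * (∫ y in Ω, y i * dilate c ρ bump y) + x i * x j := by
    intro i j
    have e : ∀ y : Plane, (y - x) j * ((y - x) i * dilate c ρ bump y)
        = ((y i * y j * dilate c ρ bump y - x i * (y j * dilate c ρ bump y))
          - x j * (y i * dilate c ρ bump y)) + x i * x j * (1 * dilate c ρ bump y) := by
      intro y
      simp only [PiLp.sub_apply]
      ring
    simp_rw [e]
    have i1 := hint (fun y => y i * y j) ((hi i).mul (hi j))
    have i2 := (hint _ (hi j)).const_mul (x i)
    have i3 := (hint _ (hi i)).const_mul (x j)
    have i4 := (hint _ (continuous_const (y := (1 : ℝ)))).const_mul (x i * x j)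
    rw [integral_add ?_ i4, integral_sub ?_ i3, integral_sub i1 i2]
    rotate_left
    · exact i1.sub i2
    · exact (i1.sub i2).sub i3
    simp only [integral_const_mul, one_mul, hone, mul_one]
  simp_rw [h1, h2]
  simp only [quad, taylorCoeff, Fin.sum_univ_two, Matrix.cons_val]
  rw [hM 1 0]
  have e : ∫ y in Ω, y 1 * y 0 * dilate c ρ bump y = ∫ y in Ω, y 0 * y 1 * dilate c ρ bump y :=
    integral_congr_ae (Eventually.of_forall fun y => by ring)
  rw [e]
  ring

end Taylor

section Taylor

variable {Ω : Set Plane} {α : ℝ} {u : Plane → ℝ} {p : Plane → Plane}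
  {H : Plane → Matrix (Fin 2) (Fin 2) ℝ}

/-- The disc shrinks towards `x`; convexity keeps it inside even when `x` is only a boundary point,
as a proper mixture of a closure point and an interior point is interior. -/
lemma closedBall_homothety_subset {U : Set Plane} (hUo : IsOpen U) (hUc : Convex ℝ U)
    {x c : Plane} {ρ s : ℝ} (hx : x ∈ closure U) (hsub : Metric.closedBall c ρ ⊆ U)
    (hs : 0 < s) (hs1 : s ≤ 1) : Metric.closedBall (x + s • (c - x)) (s * ρ) ⊆ U := by
  intro y hy
  have hy' : x + s⁻¹ • (y - x) ∈ interior U := by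
    rw [hUo.interior_eq]
    refine hsub ?_
    rw [Metric.mem_closedBall, dist_eq_norm] at hy ⊢
    have e : x + s⁻¹ • (y - x) - c = s⁻¹ • (y - (x + s • (c - x))) := by
      rw [← sub_sub, smul_sub s⁻¹ (y - x), smul_smul, inv_mul_cancel₀ hs.ne', one_smul]
      abel
    rw [e, norm_smul, norm_inv, Real.norm_of_nonneg hs.le, inv_mul_le_iff₀ hs]
    exact hy
  have h := hUc.combo_closure_interior_mem_interior hx hy' (sub_nonneg.mpr hs1) hs
    (sub_add_cancel 1 s)
  rw [hUo.interior_eq] at h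
  convert h using 1
  rw [smul_add, smul_smul, mul_inv_cancel₀ hs.ne', one_smul, sub_smul, one_smul]
  abel

lemma dist_le_of_mem_closure {U : Set Plane} {L : ℝ} (hL : ∀ y ∈ U, ∀ y' ∈ U, dist y y' ≤ L)
    {x y : Plane} (hx : x ∈ closure U) (hy : y ∈ closure U) : dist x y ≤ L := by
  have h : ∀ q ∈ closure (U ×ˢ U), dist q.1 q.2 ≤ L := fun q hq =>
    le_on_closure (f := fun q : Plane × Plane => dist q.1 q.2) (g := fun _ => L)
      (fun q hq => hL _ hq.1 _ hq.2) (by fun_prop) (by fun_prop) hq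
  exact h (x, y) (by rw [closure_prod_eq]; exact ⟨hx, hy⟩)

/-- An approximate identity whose mass sits in the discs shrinking to `x`. They stay in `U`, so
continuity up to the boundary recovers the value at boundary points too. -/
lemma tendsto_integral_mul_dilate {w : Plane → ℝ} (hΩo : IsOpen Ω) (hw : IntegrableOn w Ω)
    (hwc : ContinuousOn w (closure Ω)) {U : Set Plane} (hUo : IsOpen U) (hUc : Convex ℝ U)
    (hUΩ : U ⊆ Ω) {x c : Plane} {ρ : ℝ} (hρ : 0 < ρ) (hx : x ∈ closure U)
    (hsub : Metric.closedBall c ρ ⊆ U) :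
    Tendsto (fun s => ∫ y in Ω, w y * dilate x s (dilate (c - x) ρ bump) y) (𝓝[>] 0)
      (𝓝 (w x)) := by
  set ξ := dilate (c - x) ρ bump with hξ
  have hξc : Continuous ξ := continuous_dilate _ _ contDiff_bump.continuous
  have hξs : HasCompactSupport ξ := hasCompactSupport_dilate hρ.ne' hasCompactSupport_bump
  have hξ0 : ∀ v, 0 ≤ ξ v := fun v => mul_nonneg (by positivity) (bump_nonneg _)
  have hxΩ : x ∈ closure Ω := closure_mono hUΩ hx
  rw [Metric.tendsto_nhds]
  intro ε hε
  have hcw := hwc x hxΩ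
  rw [Metric.continuousWithinAt_iff] at hcw
  obtain ⟨δ, hδ, hcw⟩ := hcw (ε / 2) (by linarith)
  set D := ‖c - x‖ + ρ with hD
  have hDpos : 0 < D := by positivity
  have hev : ∀ᶠ s : ℝ in 𝓝[>] 0, s ∈ Ioo (0 : ℝ) (min 1 (δ / D)) :=
    Ioo_mem_nhdsGT (by positivity)
  filter_upwards [hev] with s hs
  have hs0 : 0 < s := hs.1
  have hs1 : s ≤ 1 := (hs.2.trans_le (min_le_left _ _)).le
  have hsδ : s * D < δ := by
    rw [← lt_div_iff₀ hDpos]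
    exact hs.2.trans_le (min_le_right _ _)
  have hB := (closedBall_homothety_subset hUo hUc hx hsub hs0 hs1).trans hUΩ
  have hmem : ∀ y, dilate x s ξ y ≠ 0 → y ∈ Metric.closedBall (x + s • (c - x)) (s * ρ) := by
    intro y hy
    refine mem_closedBall_of_dilate hs0 (tsupport_dilate_bump hρ ?_)
    exact tsupport_dilate_subset (subset_tsupport _ hy)
  have hone : ∫ y in Ω, dilate x s ξ y = 1 := by
    rw [setIntegral_eq_integral_of_forall_compl_eq_zero, integral_dilate _ hs0, hξ,
      integral_dilate _ hρ, integral_bump]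
    intro y hy
    by_contra h
    exact hy (hB (hmem y h))
  have hdi : IntegrableOn (dilate x s ξ) Ω :=
    ((continuous_dilate x s hξc).integrable_of_hasCompactSupport
      (hasCompactSupport_dilate hs0.ne' hξs)).integrableOn
  have e : (∫ y in Ω, w y * dilate x s ξ y) - w x
      = ∫ y in Ω, (w y - w x) * dilate x s ξ y := by
    simp_rw [sub_mul]
    rw [integral_sub (integrableOn_mul_dilate hw x s hξc hξs) (hdi.const_mul _),
      integral_const_mul, hone, mul_one]
  rw [Real.dist_eq, e]
  have : ‖∫ y in Ω, (w y - w x) * dilate x s ξ y‖ ≤ ∫ y in Ω, ε / 2 * dilate x s ξ y := by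
    refine norm_integral_le_of_norm_le (hdi.const_mul _) ?_
    refine (ae_restrict_mem hΩo.measurableSet).mono fun y hy => ?_
    have hd0 : 0 ≤ dilate x s ξ y := mul_nonneg (by positivity) (hξ0 _)
    rw [norm_mul, Real.norm_of_nonneg hd0]
    rcases eq_or_ne (dilate x s ξ y) 0 with h0 | h0
    · rw [h0, mul_zero, mul_zero]
    · refine mul_le_mul_of_nonneg_right ?_ hd0
      have h1 := hmem y h0
      rw [Metric.mem_closedBall, dist_eq_norm] at h1
      have h2 : dist y x < δ := by
        rw [dist_eq_norm]
        calc ‖y - x‖ = ‖(y - (x + s • (c - x))) + s • (c - x)‖ := by congr 1; abel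
          _ ≤ s * ρ + s * ‖c - x‖ := by
            refine (norm_add_le _ _).trans ?_
            rw [norm_smul, Real.norm_of_nonneg hs0.le]
            gcongr
          _ = s * D := by rw [hD]; ring
          _ < δ := hsδ
      exact (hcw (subset_closure hy) h2).le
  rw [integral_const_mul, hone, mul_one] at this
  rw [← Real.norm_eq_abs]
  linarith

/-- Absolute continuity of the integral. It makes the first-order term `s F1 s` vanish as `s → 0`
although `p` is only known to be square integrable. -/
lemma tendsto_integral_closedBall_zero {w : Plane → ℝ} (hw : IntegrableOn w Ω) {x c : Plane}
    {ρ : ℝ} (hρ : 0 < ρ)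
    (hsub : ∀ s : ℝ, 0 < s → s ≤ 1 → Metric.closedBall (x + s • (c - x)) (s * ρ) ⊆ Ω) :
    Tendsto (fun s : ℝ => ∫ y in Metric.closedBall (x + s • (c - x)) (s * ρ), w y) (𝓝[>] 0)
      (𝓝 0) := by
  have h1 : Tendsto (fun s : ℝ => ∫ y in Metric.closedBall (x + s • (c - x)) (s * ρ), w y
      ∂(volume.restrict Ω)) (𝓝[>] 0) (𝓝 0) := by
    refine hw.tendsto_setIntegral_nhds_zero ?_
    have h2 : Tendsto (fun s : ℝ => ENNReal.ofReal (Real.pi * (s * ρ) ^ 2)) (𝓝[>] 0) (𝓝 0) := by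
      have h3 : Tendsto (fun s : ℝ => Real.pi * (s * ρ) ^ 2) (𝓝 0) (𝓝 0) := by
        have : Continuous (fun s : ℝ => Real.pi * (s * ρ) ^ 2) := by fun_prop
        simpa using this.tendsto 0
      simpa using (ENNReal.tendsto_ofReal h3).mono_left nhdsWithin_le_nhds
    refine tendsto_of_tendsto_of_tendsto_of_le_of_le' tendsto_const_nhds h2
      (Eventually.of_forall fun _ => zero_le) ?_
    filter_upwards [self_mem_nhdsWithin] with s hs
    have hs0 : 0 < s := hs
    rw [← volume_real_closedBall (x + s • (c - x)) (by positivity : 0 ≤ s * ρ),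
      ofReal_measureReal measure_closedBall_lt_top.ne]
    exact Measure.restrict_apply_le _ _
  refine h1.congr' ?_
  filter_upwards [Ioo_mem_nhdsGT (zero_lt_one (α := ℝ))] with s hs
  rw [Measure.restrict_restrict_of_subset (hsub s hs.1 hs.2.le)]

end Taylor

section Taylor

variable {Ω : Set Plane} {α : ℝ} {u : Plane → ℝ} {p : Plane → Plane}
  {H : Plane → Matrix (Fin 2) (Fin 2) ℝ}

/-- The averaged Taylor polynomial of a disc approximates `u` pointwise on every convex set that
contains the disc. -/
theorem abs_sub_quad_taylorCoeff_le (hα : 0 < α) (hΩo : IsOpen Ω) (hΩb : Bornology.IsBounded Ω)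
    (h : IsSobolev Ω α u p H) (hu : ContinuousOn u (closure Ω))
    {U : Set Plane} (hUo : IsOpen U) (hUc : Convex ℝ U) (hUΩ : U ⊆ Ω)
    {L : ℝ} (hL : ∀ y ∈ U, ∀ y' ∈ U, dist y y' ≤ L) {c : Plane} {ρ : ℝ} (hρ : 0 < ρ)
    (hsub : Metric.closedBall c ρ ⊆ U) {x : Plane} (hx : x ∈ closure U) :
    |u x - quad (taylorCoeff Ω u p (discMean H c ρ) c ρ) x|
      ≤ 8 * bumpBound * (L / ρ) ^ 2 * (L ^ (1 + α) * √(slobSq α H U)) := by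
  have hfin : volume Ω ≠ ⊤ := hΩb.measure_lt_top.ne
  have hUfin : volume U ≠ ⊤ := ne_top_of_le_ne_top hfin (measure_mono hUΩ)
  have hfinm : IsFiniteMeasure (volume.restrict Ω) := ⟨by simpa using hfin.lt_top⟩
  have hK0 := bumpBound_nonneg
  have hLnn : 0 ≤ L := by
    have hc : c ∈ U := hsub (Metric.mem_closedBall_self hρ.le)
    exact dist_nonneg.trans (hL c hc c hc)
  set M := discMean H c ρ with hM
  have hMs : ∀ i j, M i j = M j i :=
    discMean_symm (hsub.trans hUΩ) (fun i j => h.hess_symm hΩo hfin i j)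
  set ξ := dilate (c - x) ρ bump with hξ
  have hξd : ContDiff ℝ ∞ ξ := contDiff_dilate contDiff_bump
  have hξs : HasCompactSupport ξ := hasCompactSupport_dilate hρ.ne' hasCompactSupport_bump
  have hξt : tsupport ξ ⊆ Metric.closedBall (c - x) ρ := tsupport_dilate_bump hρ
  have hξ0 : ∀ v, 0 ≤ ξ v := fun v => mul_nonneg (by positivity) (bump_nonneg _)
  have hξle : ∀ v, ξ v ≤ (ρ ^ 2)⁻¹ * bumpBound := fun v =>
    mul_le_mul_of_nonneg_left (bump_le _) (by positivity)
  have hball : ∀ s : ℝ, 0 < s → s ≤ 1 → Metric.closedBall (x + s • (c - x)) (s * ρ) ⊆ U :=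
    fun s hs hs1 => closedBall_homothety_subset hUo hUc hx hsub hs hs1
  have hvL : ∀ v, ξ v ≠ 0 → ‖v‖ ≤ L := by
    intro v hv
    have h1 := hξt (subset_tsupport _ hv)
    have h2 : v + x ∈ Metric.closedBall c ρ := by
      rw [Metric.mem_closedBall, dist_eq_norm] at h1 ⊢
      convert h1 using 2
      abel
    have h3 := dist_le_of_mem_closure hL (subset_closure (hsub h2)) hx
    rwa [dist_eq_norm, add_sub_cancel_right] at h3
  have hsupp : ∀ (q : Plane → ℝ), tsupport (fun v => q v * ξ v) ⊆ Metric.closedBall (c - x) ρ :=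
    fun q => (closure_mono (Function.support_mul_subset_right q ξ)).trans hξt
  have hmemΩ : ∀ (ζ : Plane → ℝ), tsupport ζ ⊆ Metric.closedBall (c - x) ρ → ∀ s : ℝ, 0 < s →
      s ≤ 1 → ∀ y, s⁻¹ • (y - x) ∈ tsupport ζ → y ∈ Ω := fun ζ hζ s hs hs1 y hy =>
    hUΩ (hball s hs hs1 (mem_closedBall_of_dilate hs (hζ hy)))
  have hui := integrableOn_of_memLp_two hfin h.memLp_fun
  have hpi := fun i => integrableOn_of_memLp_two hfin (h.memLp_grad i)
  have hHi := fun i j => integrableOn_of_memLp_two hfin (h.memLp_hess i j)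
  set ξ1 : Fin 2 → Plane → ℝ := fun i v => v i * ξ v with hξ1
  set ξ2 : Fin 2 → Fin 2 → Plane → ℝ := fun i j v => v j * ξ1 i v with hξ2
  have hξ1d : ∀ i, ContDiff ℝ ∞ (ξ1 i) := fun i => (contDiff_coord i).mul hξd
  have hξ2d : ∀ i j, ContDiff ℝ ∞ (ξ2 i j) := fun i j => (contDiff_coord j).mul (hξ1d i)
  have hξ1s : ∀ i, HasCompactSupport (ξ1 i) := fun i => hξs.mul_left
  have hξ2s : ∀ i j, HasCompactSupport (ξ2 i j) := fun i j => (hξ1s i).mul_left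
  have hξ2t : ∀ i j, tsupport (ξ2 i j) ⊆ Metric.closedBall (c - x) ρ := fun i j => by
    have e : ξ2 i j = fun v => (v j * v i) * ξ v := by
      funext v
      simp only [hξ2, hξ1]
      ring
    rw [e]
    exact hsupp _
  set F : ℝ → ℝ := fun s => ∫ y in Ω, u y * dilate x s ξ y with hF
  set F1 : ℝ → ℝ := fun s => ∑ i, ∫ y in Ω, p y i * dilate x s (ξ1 i) y with hF1
  set F2 : ℝ → ℝ := fun s => ∑ i, ∑ j, ∫ y in Ω, H y j i * dilate x s (ξ2 i j) y with hF2
  have hdF : ∀ s, 0 < s → s ≤ 1 → HasDerivAt F (F1 s) s := fun s hs hs1 =>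
    hasDerivAt_integral_dilate hui h.weak_grad hξd hξs hs (hmemΩ ξ hξt s hs hs1)
  have hdF1 : ∀ s, 0 < s → s ≤ 1 → HasDerivAt F1 (F2 s) s := fun s hs hs1 =>
    HasDerivAt.fun_sum fun i _ => hasDerivAt_integral_dilate (hpi i)
      (fun j => h.weak_hess j i) (hξ1d i) (hξ1s i) hs (hmemΩ _ (hsupp _) s hs hs1)
  set m : ℝ := ∑ i, ∑ j, M j i * ∫ v, ξ2 i j v with hm
  -- Taylor's formula along the homotheties: `Ψ` joins `u x` at `s = 0` to the Taylor polynomial at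
  -- `s = 1`. Its derivative contains only `s` times the pairing of `M - H`, as the first-order
  -- terms cancel.
  set Ψ : ℝ → ℝ := fun s => F s - s * F1 s + s ^ 2 / 2 * m with hΨ
  have hdΨ : ∀ s, 0 < s → s ≤ 1 → HasDerivAt Ψ (s * (m - F2 s)) s := by
    intro s hs hs1
    have h1 := ((hdF s hs hs1).sub ((hasDerivAt_id s).mul (hdF1 s hs hs1))).add
      (((hasDerivAt_pow 2 s).div_const 2).mul_const m)
    refine h1.congr_deriv ?_
    simp
    ring
  have hintdil : ∀ s, 0 < s → s ≤ 1 → ∀ i j, ∫ y in Ω, dilate x s (ξ2 i j) y = ∫ v, ξ2 i j v := by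
    intro s hs hs1 i j
    rw [setIntegral_eq_integral_of_forall_compl_eq_zero, integral_dilate _ hs]
    intro y hy
    by_contra h0
    exact hy (hmemΩ _ (hξ2t i j) s hs hs1 y
      (tsupport_dilate_subset (subset_tsupport _ h0)))
  have hΨ1 : Ψ 1 = quad (taylorCoeff Ω u p M c ρ) x := by
    rw [quad_taylorCoeff hΩb h hMs hρ (hsub.trans hUΩ) x]
    have e0 : ∀ y, dilate x 1 ξ y = dilate c ρ bump y := fun y => by
      simpa using dilate_one_recentred c x ρ (fun _ => 1) y
    have e1 : ∀ i y, dilate x 1 (ξ1 i) y = (y - x) i * dilate c ρ bump y := fun i y =>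
      dilate_one_recentred c x ρ (fun v => v i) y
    have e2 : ∀ i j y, dilate x 1 (ξ2 i j) y = (y - x) j * ((y - x) i * dilate c ρ bump y) := by
      intro i j y
      have e : ξ2 i j = fun v => (v j * v i) * dilate (c - x) ρ bump v := by
        funext v
        simp only [hξ2, hξ1]
        ring
      rw [e, dilate_one_recentred c x ρ (fun v => v j * v i) y]
      ring
    simp only [hΨ, hF, hF1, hm, one_mul, one_pow]
    simp_rw [← hintdil 1 one_pos le_rfl, e0, e1, e2]
    ring
  set E := ∫ y in U, contract (H y - M) (H y - M) with hE
  have hHU : ∀ i j, MemLp (fun x => H x i j) 2 (volume.restrict U) := fun i j =>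
    (h.memLp_hess i j).mono_measure (Measure.restrict_mono_set _ hUΩ)
  have hElt : √E ≤ L ^ (1 + α) * ρ⁻¹ * √(slobSq α H U) := by
    have hE1 := integral_contract_sub_discMean_le hα hUo.measurableSet hUfin hHU
      (h.integrable_slobodeckij.mono_measure
        (Measure.prod_mono (Measure.restrict_mono_set _ hUΩ) (Measure.restrict_mono_set _ hUΩ)))
      hL hρ hsub
    rw [Real.sqrt_le_left (by positivity)]
    refine hE1.trans ?_
    rw [mul_pow, mul_pow, Real.sq_sqrt (slobSq_nonneg _ _ _), ← Real.rpow_natCast (L ^ (1 + α)),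
      ← Real.rpow_mul hLnn]
    refine mul_le_mul_of_nonneg_right ?_ (slobSq_nonneg _ _ _)
    have e : (1 + α) * ((2 : ℕ) : ℝ) = 2 + 2 * α := by push_cast; ring
    rw [e, inv_pow]
    refine mul_le_mul_of_nonneg_left ?_ (Real.rpow_nonneg hLnn _)
    refine inv_anti₀ (by positivity) ?_
    nlinarith [Real.pi_gt_three, sq_nonneg ρ]
  -- The factor `s` in the derivative cancels the `s⁻¹` of the kernel estimate, so the bound is
  -- uniform up to `s = 0`. The `8` is four matrix entries times the `2` of that estimate.
  have hbound : ∀ s, 0 < s → s ≤ 1 → |s * (m - F2 s)|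
      ≤ 8 * bumpBound * (L / ρ) ^ 2 * (L ^ (1 + α) * √(slobSq α H U)) := by
    intro s hs hs1
    have hterm : ∀ i j, |M j i * (∫ v, ξ2 i j v) - ∫ y in Ω, H y j i * dilate x s (ξ2 i j) y|
        ≤ 2 * (L * L * ((ρ ^ 2)⁻¹ * bumpBound)) * ρ * s⁻¹ * √E := by
      intro i j
      have e : M j i * (∫ v, ξ2 i j v) - ∫ y in Ω, H y j i * dilate x s (ξ2 i j) y
          = -∫ y in Ω, (H y j i - M j i) * dilate x s (ξ2 i j) y := by
        rw [← hintdil s hs hs1, ← integral_const_mul, ← integral_sub, ← integral_neg]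
        · refine integral_congr_ae (Eventually.of_forall fun y => ?_)
          simp only
          ring
        · exact integrableOn_mul_dilate (integrable_const _) x s (hξ2d i j).continuous (hξ2s i j)
        · exact integrableOn_mul_dilate (hHi j i) x s (hξ2d i j).continuous (hξ2s i j)
      rw [e, abs_neg]
      have hw : MemLp (fun y => H y j i - M j i) 2 (volume.restrict Ω) :=
        (h.memLp_hess j i).sub (memLp_const _)
      refine (abs_integral_mul_dilate_le hΩo.measurableSet hw
        (K := L * L * ((ρ ^ 2)⁻¹ * bumpBound)) (by positivity) ?_ hρ hs (hξ2t i j)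
        ((hball s hs hs1).trans hUΩ)).trans ?_
      · intro v
        simp only [hξ2, hξ1]
        rw [abs_mul, abs_mul, abs_of_nonneg (hξ0 v), ← mul_assoc]
        rcases eq_or_ne (ξ v) 0 with h0 | h0
        · rw [h0, mul_zero]
          positivity
        · have := hvL v h0
          exact mul_le_mul (mul_le_mul ((abs_coord_le_norm v j).trans this)
            ((abs_coord_le_norm v i).trans this) (abs_nonneg _) hLnn) (hξle v) (hξ0 v)
            (by positivity)
      · refine mul_le_mul_of_nonneg_left (Real.sqrt_le_sqrt ?_) (by positivity)
        have hwU : ∀ i j, IntegrableOn (fun y => (H y i j - M i j) ^ 2) U := fun i j => by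
          have : IsFiniteMeasure (volume.restrict U) := ⟨by simpa using hUfin.lt_top⟩
          exact ((hHU i j).sub (memLp_const _)).integrable_sq
        have hci : IntegrableOn (fun y => contract (H y - M) (H y - M)) U := by
          simp only [contract, Matrix.sub_apply, ← sq]
          exact integrable_finsetSum _ fun i _ => integrable_finsetSum _ fun j _ => hwU i j
        calc ∫ y in Metric.closedBall (x + s • (c - x)) (s * ρ), (H y j i - M j i) ^ 2
            ≤ ∫ y in U, (H y j i - M j i) ^ 2 :=
              setIntegral_mono_set (hwU j i) (Eventually.of_forall fun _ => sq_nonneg _)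
                (Eventually.of_forall (hball s hs hs1))
          _ ≤ E := by
              refine integral_mono (hwU j i) hci fun y => ?_
              simp only [contract, Matrix.sub_apply, ← sq]
              refine (Finset.single_le_sum (f := fun j => (H y j i - M j i) ^ 2)
                (fun _ _ => sq_nonneg _) (Finset.mem_univ j)).trans ?_
              exact Finset.sum_le_sum fun k _ => Finset.single_le_sum
                (f := fun i => (H y k i - M k i) ^ 2) (fun _ _ => sq_nonneg _) (Finset.mem_univ i)
    have hsum : |m - F2 s| ≤ 4 * (2 * (L * L * ((ρ ^ 2)⁻¹ * bumpBound)) * ρ * s⁻¹ * √E) := by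
      rw [hm, hF2]
      simp only [Fin.sum_univ_two]
      have t00 := abs_le.mp (hterm 0 0)
      have t01 := abs_le.mp (hterm 0 1)
      have t10 := abs_le.mp (hterm 1 0)
      have t11 := abs_le.mp (hterm 1 1)
      rw [abs_le]
      constructor <;> linarith [t00.1, t00.2, t01.1, t01.2, t10.1, t10.2, t11.1, t11.2]
    rw [abs_mul, abs_of_pos hs]
    calc s * |m - F2 s| ≤ s * (4 * (2 * (L * L * ((ρ ^ 2)⁻¹ * bumpBound)) * ρ * s⁻¹ *
          (L ^ (1 + α) * ρ⁻¹ * √(slobSq α H U)))) := by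
          refine mul_le_mul_of_nonneg_left (hsum.trans ?_) hs.le
          gcongr
      _ = _ := by field_simp; ring
  have hsF1 : Tendsto (fun s => s * F1 s) (𝓝[>] 0) (𝓝 0) := by
    have h1 : ∀ i, Tendsto (fun s => s * ∫ y in Ω, p y i * dilate x s (ξ1 i) y) (𝓝[>] 0)
        (𝓝 0) := by
      intro i
      have h2 := tendsto_integral_closedBall_zero (h.memLp_grad i).integrable_sq hρ
        (fun s hs hs1 => (hball s hs hs1).trans hUΩ)
      have h3 := (h2.sqrt).const_mul (2 * (L * ((ρ ^ 2)⁻¹ * bumpBound)) * ρ)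
      rw [Real.sqrt_zero, mul_zero] at h3
      refine squeeze_zero_norm' ?_ h3
      filter_upwards [Ioo_mem_nhdsGT (zero_lt_one (α := ℝ))] with s hs
      have hb := abs_integral_mul_dilate_le hΩo.measurableSet (h.memLp_grad i)
        (ζ := ξ1 i) (K := L * ((ρ ^ 2)⁻¹ * bumpBound)) (by positivity) (fun v => by
          simp only [hξ1]
          rw [abs_mul, abs_of_nonneg (hξ0 v)]
          rcases eq_or_ne (ξ v) 0 with h0 | h0
          · rw [h0, mul_zero]
            positivity
          · exact mul_le_mul ((abs_coord_le_norm v i).trans (hvL v h0)) (hξle v) (hξ0 v) hLnn)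
        hρ hs.1 (hsupp _) ((hball s hs.1 hs.2.le).trans hUΩ)
      rw [norm_mul, Real.norm_of_nonneg hs.1.le, Real.norm_eq_abs]
      refine (mul_le_mul_of_nonneg_left hb hs.1.le).trans (le_of_eq ?_)
      have := hs.1.ne'
      field_simp
    have h4 := (h1 0).add (h1 1)
    rw [add_zero] at h4
    refine h4.congr fun s => ?_
    simp only [hF1, Fin.sum_univ_two]
    ring
  have hΨlim : Tendsto Ψ (𝓝[>] 0) (𝓝 (u x)) := by
    have h1 := tendsto_integral_mul_dilate hΩo hui hu hUo hUc hUΩ hρ hx hsub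
    have h2 : Tendsto (fun s : ℝ => s ^ 2 / 2 * m) (𝓝[>] 0) (𝓝 0) := by
      have : Continuous (fun s : ℝ => s ^ 2 / 2 * m) := by fun_prop
      simpa using (this.tendsto 0).mono_left nhdsWithin_le_nhds
    have h3 := (h1.sub hsF1).add h2
    rwa [sub_zero, add_zero] at h3
  rw [← hΨ1]
  refine le_of_tendsto ((hΨlim.sub_const (Ψ 1)).abs) ?_
  -- Differentiability is available only for positive `s`; the mean value inequality is used on `[s,
  -- 1]` before letting `s` tend to zero.
  filter_upwards [Ioo_mem_nhdsGT (zero_lt_one (α := ℝ))] with s hs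
  have hmv := (convex_Icc s 1).norm_image_sub_le_of_norm_hasDerivWithin_le
    (f := Ψ) (f' := fun s => s * (m - F2 s))
    (C := 8 * bumpBound * (L / ρ) ^ 2 * (L ^ (1 + α) * √(slobSq α H U)))
    (fun t ht => (hdΨ t (hs.1.trans_le ht.1) ht.2).hasDerivWithinAt)
    (fun t ht => hbound t (hs.1.trans_le ht.1) ht.2)
    (right_mem_Icc.mpr hs.2.le) (left_mem_Icc.mpr hs.2.le)
  rw [Real.norm_eq_abs, Real.norm_eq_abs] at hmv
  refine hmv.trans (mul_le_of_le_one_right (by positivity) ?_)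
  rw [abs_le]
  constructor <;> linarith [hs.1, hs.2]

end Taylor

/-! ### Quadratic polynomials -/

lemma quad_sub (c d : Fin 6 → ℝ) (x : Plane) : quad (c - d) x = quad c x - quad d x := by
  simp only [quad, Pi.sub_apply]
  ring

lemma quadGrad_sub (c d : Fin 6 → ℝ) (x : Plane) :
    quadGrad (c - d) x = quadGrad c x - quadGrad d x := by
  ext i
  fin_cases i <;> simp [quadGrad] <;> ring

lemma inner_eq_sum (v w : Plane) : ⟪v, w⟫ = v 0 * w 0 + v 1 * w 1 := by
  simp [PiLp.inner_apply, Fin.sum_univ_two, mul_comm]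

lemma quad_add (c : Fin 6 → ℝ) (z v : Plane) :
    quad c (z + v) = quad c z + ⟪quadGrad c z, v⟫
      + (c 3 * v 0 ^ 2 + c 4 * (v 0 * v 1) + c 5 * v 1 ^ 2) := by
  rw [inner_eq_sum]
  simp [quad, quadGrad]
  ring

lemma norm_le_abs_add_abs (v : Plane) : ‖v‖ ≤ |v 0| + |v 1| := by
  rw [EuclideanSpace.norm_eq, Fin.sum_univ_two]
  rw [Real.sqrt_le_left (by positivity)]
  simp only [Real.norm_eq_abs]
  nlinarith [abs_nonneg (v 0), abs_nonneg (v 1)]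

lemma norm_vec_le (a b r : ℝ) (hr : 0 ≤ r) (h : a ^ 2 + b ^ 2 ≤ r ^ 2) :
    ‖(!₂[a, b] : Plane)‖ ≤ r := by
  rw [EuclideanSpace.norm_eq, Real.sqrt_le_left hr]
  simpa [Fin.sum_univ_two] using h

section
variable {e : Fin 6 → ℝ} {c : Plane} {r m : ℝ}

/-- Inverse estimate for quadratics: finite differences of the values at the centre and at the eight
points `(±r, 0)`, `(0, ±r)`, `(±r/2, ±r/2)` isolate each coefficient. -/
lemma abs_quad_coeff_le (hr : 0 < r) (h : ∀ y ∈ Metric.closedBall c r, |quad e y| ≤ m) :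
    |e 3| ≤ 4 * m / r ^ 2 ∧ |e 4| ≤ 4 * m / r ^ 2 ∧ |e 5| ≤ 4 * m / r ^ 2 ∧
      |quadGrad e c 0| ≤ m / r ∧ |quadGrad e c 1| ≤ m / r := by
  have hv : ∀ a b : ℝ, a ^ 2 + b ^ 2 ≤ r ^ 2 →
      |quad e c + (quadGrad e c 0 * a + quadGrad e c 1 * b)
        + (e 3 * a ^ 2 + e 4 * (a * b) + e 5 * b ^ 2)| ≤ m := by
    intro a b hab
    have h1 := h (c + !₂[a, b]) (by
      rw [Metric.mem_closedBall, dist_eq_norm, add_sub_cancel_left]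
      exact norm_vec_le a b r hr.le hab)
    rw [quad_add, inner_eq_sum] at h1
    simpa using h1
  have h0 := abs_le.mp (hv 0 0 (by nlinarith))
  have h1 := abs_le.mp (hv r 0 (by nlinarith))
  have h2 := abs_le.mp (hv (-r) 0 (by nlinarith))
  have h3 := abs_le.mp (hv 0 r (by nlinarith))
  have h4 := abs_le.mp (hv 0 (-r) (by nlinarith))
  have h5 := abs_le.mp (hv (r / 2) (r / 2) (by nlinarith))
  have h6 := abs_le.mp (hv (r / 2) (-(r / 2)) (by nlinarith))
  have h7 := abs_le.mp (hv (-(r / 2)) (r / 2) (by nlinarith))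
  have h8 := abs_le.mp (hv (-(r / 2)) (-(r / 2)) (by nlinarith))
  have hr2 : 0 < r ^ 2 := by positivity
  have hm : 0 ≤ m := by linarith [h0.1, h0.2]
  obtain ⟨h0a, h0b⟩ := h0
  obtain ⟨h1a, h1b⟩ := h1
  obtain ⟨h2a, h2b⟩ := h2
  obtain ⟨h3a, h3b⟩ := h3
  obtain ⟨h4a, h4b⟩ := h4
  obtain ⟨h5a, h5b⟩ := h5
  obtain ⟨h6a, h6b⟩ := h6
  obtain ⟨h7a, h7b⟩ := h7
  obtain ⟨h8a, h8b⟩ := h8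
  refine ⟨?_, ?_, ?_, ?_, ?_⟩
  · rw [le_div_iff₀ hr2, ← abs_of_pos hr2, ← abs_mul, abs_le]
    constructor <;> linarith
  · rw [le_div_iff₀ hr2, ← abs_of_pos hr2, ← abs_mul, abs_le]
    constructor <;> linarith
  · rw [le_div_iff₀ hr2, ← abs_of_pos hr2, ← abs_mul, abs_le]
    constructor <;> linarith
  · rw [le_div_iff₀ hr, ← abs_of_pos hr, ← abs_mul, abs_le]
    constructor <;> linarith
  · rw [le_div_iff₀ hr, ← abs_of_pos hr, ← abs_mul, abs_le]
    constructor <;> linarith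

/-- The gradient at the centre is at most `m / r` per coordinate and grows linearly with slope
controlled by the second-order coefficients; at each coordinate `12` comes from `2·4 + 4`. -/
lemma norm_quadGrad_le (hr : 0 < r) (h : ∀ y ∈ Metric.closedBall c r, |quad e y| ≤ m)
    (z : Plane) : ‖quadGrad e z‖ ≤ 2 * (m / r) * (1 + 12 * (‖z - c‖ / r)) := by
  obtain ⟨h3, h4, h5, g0, g1⟩ := abs_quad_coeff_le hr h
  have hm : 0 ≤ m := (abs_nonneg _).trans (h c (Metric.mem_closedBall_self hr.le))
  set w := z - c with hw
  have hw0 := abs_coord_le_norm w 0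
  have hw1 := abs_coord_le_norm w 1
  have hz : ∀ i, z i = c i + w i := fun i => by simp [hw]
  have e0 : quadGrad e z 0 = quadGrad e c 0 + 2 * (e 3 * w 0) + e 4 * w 1 := by
    simp [quadGrad, hz]
    ring
  have e1 : quadGrad e z 1 = quadGrad e c 1 + e 4 * w 0 + 2 * (e 5 * w 1) := by
    simp [quadGrad, hz]
    ring
  have hp : ∀ a b : ℝ, |a| ≤ 4 * m / r ^ 2 → |b| ≤ ‖w‖ → |a * b| ≤ 4 * (m / r) * (‖w‖ / r) := by
    intro a b ha hb
    rw [abs_mul]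
    refine (mul_le_mul ha hb (abs_nonneg _) (by positivity)).trans (le_of_eq ?_)
    field_simp
  have p30 := abs_le.mp (hp _ _ h3 hw0)
  have p41 := abs_le.mp (hp _ _ h4 hw1)
  have p40 := abs_le.mp (hp _ _ h4 hw0)
  have p51 := abs_le.mp (hp _ _ h5 hw1)
  have q0 := abs_le.mp g0
  have q1 := abs_le.mp g1
  have b0 : |quadGrad e z 0| ≤ m / r + 12 * (m / r) * (‖w‖ / r) := by
    rw [e0, abs_le]
    constructor <;> linarith [p30.1, p30.2, p41.1, p41.2, q0.1, q0.2]
  have b1 : |quadGrad e z 1| ≤ m / r + 12 * (m / r) * (‖w‖ / r) := by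
    rw [e1, abs_le]
    constructor <;> linarith [p40.1, p40.2, p51.1, p51.2, q1.1, q1.2]
  linarith [norm_le_abs_add_abs (quadGrad e z)]

end

/-- A majorant `K r^k` propagates through the recursion because `r` beats the contraction factor
`1/2`. It will show that the curvature terms are negligible although the second-order coefficients
may grow. -/
lemma tendsto_zero_of_le_half_add {a : ℕ → ℝ} {C r : ℝ} (ha : ∀ k, 0 ≤ a k) (hr : 1 / 2 < r)
    (hr1 : r < 1) (h : ∀ k, a (k + 1) ≤ a k / 2 + C * r ^ k) : Tendsto a atTop (𝓝 0) := by
  set K := max (a 0) (C / (r - 1 / 2)) with hK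
  have hKC : C ≤ K * (r - 1 / 2) := by
    rw [← div_le_iff₀ (by linarith)]
    exact le_max_right _ _
  have hb : ∀ k, a k ≤ K * r ^ k := by
    intro k
    induction k with
    | zero =>
      rw [pow_zero, mul_one]
      exact le_max_left _ _
    | succ k ih =>
      have hp : 0 < r ^ k := by positivity
      have := h k
      rw [pow_succ]
      nlinarith
  refine squeeze_zero ha hb ?_
  simpa using (tendsto_pow_atTop_nhds_zero_of_lt_one (by linarith) hr1).const_mul K

/-! ### Pointwise gradients from Taylor polynomials on dyadic discs -/

section Gradient

variable {Ω : Set Plane} {α : ℝ} {u : Plane → ℝ} {p : Plane → Plane}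
  {H : Plane → Matrix (Fin 2) (Fin 2) ℝ}

/-- The constant of the pointwise estimate of the gradient, for exponent `α` and chunkiness `θ`. -/
def gradConst (α θ : ℝ) : ℝ :=
  1024 * bumpBound * θ ^ 3 * 4 ^ (1 + α) * (1 + 12 * θ) / (1 - (1 / 2 : ℝ) ^ α)

/-- `u` has a gradient at `z` along the homotheties with centre `z` and ratio `2⁻ᵏ`; it is close to
the gradient of the averaged Taylor polynomial. -/
theorem exists_pointwise_gradient (hα : 0 < α) (hα1 : α < 1) (hΩo : IsOpen Ω)
    (hΩb : Bornology.IsBounded Ω)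
    (h : IsSobolev Ω α u p H) (hu : ContinuousOn u (closure Ω))
    {U : Set Plane} (hUo : IsOpen U) (hUc : Convex ℝ U) (hUΩ : U ⊆ Ω)
    {L θ : ℝ} (hL : ∀ y ∈ U, ∀ y' ∈ U, dist y y' ≤ L) {c : Plane} {ρ : ℝ} (hρ : 0 < ρ)
    (hθ : L ≤ θ * ρ)
    (hsub : Metric.closedBall c ρ ⊆ U) {z : Plane} (hz : z ∈ closure U) :
    ∃ g : Plane, ‖g - quadGrad (taylorCoeff Ω u p (discMean H c ρ) c ρ) z‖
        ≤ gradConst α θ * (L ^ α * √(slobSq α H U)) ∧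
      ∀ v, z + v ∈ closure U →
        Tendsto (fun k : ℕ => (2 : ℝ) ^ k * (u (z + (1 / 2 : ℝ) ^ k • v) - u z)) atTop
          (𝓝 ⟪g, v⟫) := by
  have hK0 := bumpBound_nonneg
  have hcU : c ∈ U := hsub (Metric.mem_closedBall_self hρ.le)
  have hdist : ∀ x ∈ closure U, ∀ y ∈ closure U, dist x y ≤ L := fun x hx y hy =>
    dist_le_of_mem_closure hL hx hy
  have hLρ : ρ ≤ L := by
    have h1 : c + !₂[ρ, 0] ∈ U := hsub (by
      rw [Metric.mem_closedBall, dist_eq_norm, add_sub_cancel_left]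
      exact norm_vec_le _ _ _ hρ.le (by nlinarith))
    have h2 := hL _ h1 _ hcU
    rw [dist_eq_norm, add_sub_cancel_left] at h2
    have h3 := abs_coord_le_norm (!₂[ρ, 0] : Plane) 0
    simp only [Matrix.cons_val_zero] at h3
    exact (le_abs_self ρ).trans (h3.trans h2)
  have hLpos : 0 < L := hρ.trans_le hLρ
  have hθ0 : 0 < θ := by
    by_contra hneg
    nlinarith
  set N := √(slobSq α H U) with hN
  have hN0 : 0 ≤ N := Real.sqrt_nonneg _
  set s : ℕ → ℝ := fun k => (1 / 2 : ℝ) ^ k with hs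
  have hs0 : ∀ k, 0 < s k := fun k => by positivity
  have hs1 : ∀ k, s k ≤ 1 := fun k => pow_le_one₀ (by norm_num) (by norm_num)
  have hss : ∀ k, s (k + 1) = s k / 2 := fun k => by simp only [hs, pow_succ]; ring
  set ck : ℕ → Plane := fun k => z + s k • (c - z) with hck
  set t : ℕ → Fin 6 → ℝ := fun k =>
    taylorCoeff Ω u p (discMean H (ck k) (s k * ρ)) (ck k) (s k * ρ) with ht
  have hballU : ∀ k, Metric.closedBall (ck k) (s k * ρ) ⊆ U := fun k =>
    closedBall_homothety_subset hUo hUc hz hsub (hs0 k) (hs1 k)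
  have hballdist : ∀ k, ∀ y ∈ Metric.closedBall (ck k) (s k * ρ), dist y z ≤ s k * L := by
    intro k y hy
    have h1 : z + (s k)⁻¹ • (y - z) ∈ Metric.closedBall c ρ := by
      rw [Metric.mem_closedBall, dist_eq_norm] at hy ⊢
      have e : z + (s k)⁻¹ • (y - z) - c = (s k)⁻¹ • (y - ck k) := by
        rw [hck, ← sub_sub, smul_sub (s k)⁻¹ (y - z), smul_smul, inv_mul_cancel₀ (hs0 k).ne',
          one_smul]
        abel
      rw [e, norm_smul, norm_inv, Real.norm_of_nonneg (hs0 k).le, inv_mul_le_iff₀ (hs0 k)]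
      exact hy
    have h2 := hdist _ (subset_closure (hsub h1)) z hz
    rwa [dist_eq_norm, add_sub_cancel_left, norm_smul, norm_inv, Real.norm_of_nonneg (hs0 k).le,
      inv_mul_le_iff₀ (hs0 k), ← dist_eq_norm] at h2
  set C1 := 8 * bumpBound * (4 * L / ρ) ^ 2 * ((4 * L) ^ (1 + α) * N) with hC1
  have hC10 : 0 ≤ C1 := by positivity
  -- The approximation theorem at scale `s k`. The ball has radius twice `s k * L` so that points at
  -- the extreme distance lie inside an open ball, and the chunkiness ratio `4 * L / ρ` does not
  -- depend on `k`.
  have happrox : ∀ k, ∀ x ∈ closure U, dist x z ≤ s k * L →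
      |u x - quad (t k) x| ≤ C1 * (s k) ^ (1 + α) := by
    intro k x hx hxz
    have hsk := hs0 k
    have hrad : 0 < s k * (2 * L) := by positivity
    have hlt : ∀ r, r ≤ s k * L → r < s k * (2 * L) := fun r hr =>
      hr.trans_lt (by nlinarith [mul_pos hsk hLpos])
    have key := abs_sub_quad_taylorCoeff_le hα hΩo hΩb h hu
      (U := U ∩ Metric.ball z (s k * (2 * L))) (hUo.inter Metric.isOpen_ball)
      (hUc.inter (convex_ball _ _)) (inter_subset_left.trans hUΩ) (L := s k * (4 * L))
      (fun y hy y' hy' => by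
        have h1 := Metric.mem_ball.mp hy.2
        have h2 := Metric.mem_ball.mp hy'.2
        linarith [dist_triangle_right y y' z])
      (c := ck k) (ρ := s k * ρ) (by positivity)
      (fun y hy => ⟨hballU k hy, Metric.mem_ball.mpr (hlt _ (hballdist k y hy))⟩)
      (Metric.isOpen_ball.closure_inter ⟨hx, Metric.mem_ball.mpr (hlt _ hxz)⟩)
    refine key.trans ?_
    have hmono : √(slobSq α H (U ∩ Metric.ball z (s k * (2 * L)))) ≤ N :=
      Real.sqrt_le_sqrt (slobSq_mono inter_subset_left
        (h.integrable_slobodeckij.mono_measure (Measure.prod_mono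
          (Measure.restrict_mono_set _ hUΩ) (Measure.restrict_mono_set _ hUΩ))))
    rw [Real.mul_rpow hsk.le (by positivity)]
    have e : s k * (4 * L) / (s k * ρ) = 4 * L / ρ := by field_simp
    rw [e, hC1]
    calc 8 * bumpBound * (4 * L / ρ) ^ 2 * (s k ^ (1 + α) * (4 * L) ^ (1 + α) *
          √(slobSq α H (U ∩ Metric.ball z (s k * (2 * L)))))
        ≤ 8 * bumpBound * (4 * L / ρ) ^ 2 * (s k ^ (1 + α) * (4 * L) ^ (1 + α) * N) := by gcongr
      _ = _ := by ring
  have hdiff : ∀ k, ∀ y ∈ Metric.closedBall (ck (k + 1)) (s (k + 1) * ρ),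
      |quad (t (k + 1) - t k) y| ≤ 2 * C1 * (s k) ^ (1 + α) := by
    intro k y hy
    have hyU := subset_closure (hballU _ hy)
    have hd := hballdist _ y hy
    have h1 := happrox (k + 1) y hyU hd
    have h2 := happrox k y hyU (hd.trans (by
      rw [hss]
      nlinarith [mul_pos (hs0 k) hLpos]))
    have h3 : s (k + 1) ^ (1 + α) ≤ s k ^ (1 + α) :=
      Real.rpow_le_rpow (hs0 _).le (by rw [hss]; linarith [hs0 k]) (by linarith)
    have h4 := mul_le_mul_of_nonneg_left h3 hC10
    rw [quad_sub]
    have h1' := abs_le.mp h1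
    have h2' := abs_le.mp h2
    rw [abs_le]
    constructor <;> linarith [h1'.1, h1'.2, h2'.1, h2'.2]
  set r : ℝ := (1 / 2 : ℝ) ^ α with hr
  have hr1 : r < 1 := Real.rpow_lt_one (by norm_num) (by norm_num) hα
  -- This is where `α < 1` enters: the increments must decay more slowly than the halving in the
  -- recursion for the second-order coefficients.
  have hr2 : 1 / 2 < r := by
    have := Real.rpow_lt_rpow_of_exponent_gt (x := (1 / 2 : ℝ)) (by norm_num) (by norm_num) hα1
    rwa [Real.rpow_one] at this
  have hsα : ∀ k, s k ^ α = r ^ k := fun k => (Real.rpow_pow_comm (by norm_num) _ _).symm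
  have hsα1 : ∀ k, s k ^ (1 + α) = s k * r ^ k := fun k => by
    rw [Real.rpow_add (hs0 k), Real.rpow_one, hsα]
  set g : ℕ → Plane := fun k => quadGrad (t k) z with hg
  set C2 := 8 * C1 / ρ * (1 + 12 * θ) with hC2
  -- Consecutive polynomials differ by order `s k ^ (1 + α)` on a disc of radius comparable to `s
  -- k`; one derivative costs `s k`, leaving a geometric series of ratio `2⁻ᵅ`.
  have hgdist : ∀ k, dist (g k) (g (k + 1)) ≤ C2 * r ^ k := by
    intro k
    have hsk := hs0 k
    have hrk : 0 < r ^ k := by positivity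
    have h1 := norm_quadGrad_le (mul_pos (hs0 (k + 1)) hρ) (hdiff k) z
    rw [quadGrad_sub] at h1
    rw [dist_comm, dist_eq_norm]
    refine h1.trans ?_
    have h2 : ‖z - ck (k + 1)‖ / (s (k + 1) * ρ) ≤ θ := by
      rw [div_le_iff₀ (mul_pos (hs0 _) hρ), ← dist_eq_norm, dist_comm]
      refine (hballdist (k + 1) _ (Metric.mem_closedBall_self (mul_pos (hs0 _) hρ).le)).trans ?_
      nlinarith [hs0 (k + 1)]
    rw [hsα1]
    have e : 2 * C1 * (s k * r ^ k) / (s (k + 1) * ρ) = 4 * C1 / ρ * r ^ k := by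
      rw [hss]
      field_simp
      ring
    rw [e, hC2]
    calc 2 * (4 * C1 / ρ * r ^ k) * (1 + 12 * (‖z - ck (k + 1)‖ / (s (k + 1) * ρ)))
        ≤ 2 * (4 * C1 / ρ * r ^ k) * (1 + 12 * θ) := by gcongr
      _ = _ := by ring
  obtain ⟨G, hG⟩ := cauchySeq_tendsto_of_complete (cauchySeq_of_le_geometric r C2 hr1 hgdist)
  have hG0 := dist_le_of_le_geometric_of_tendsto₀ r C2 hr1 hgdist hG
  refine ⟨G, ?_, ?_⟩
  · have e0 : g 0 = quadGrad (taylorCoeff Ω u p (discMean H c ρ) c ρ) z := by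
      simp [hg, ht, hck, hs]
    rw [← e0, ← dist_eq_norm, dist_comm]
    refine hG0.trans ?_
    rw [gradConst, ← hr, div_mul_eq_mul_div]
    refine div_le_div_of_nonneg_right ?_ (by linarith)
    rw [hC2, hC1, Real.mul_rpow (by norm_num) hLpos.le, Real.rpow_add hLpos, Real.rpow_one]
    have hLθ : L / ρ ≤ θ := (div_le_iff₀ hρ).mpr hθ
    have hq0 : 0 ≤ L / ρ := by positivity
    calc 8 * (8 * bumpBound * (4 * L / ρ) ^ 2 * (4 ^ (1 + α) * (L * L ^ α) * N)) / ρ *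
          (1 + 12 * θ)
        = 1024 * bumpBound * (L / ρ) ^ 3 * 4 ^ (1 + α) * (1 + 12 * θ) * (L ^ α * N) := by
          field_simp
          ring
      _ ≤ _ := by gcongr
  · intro v hv
    -- Two derivatives leave increments of order `r ^ k / s k`, which need not be summable; only the
    -- product with `s k` tends to zero, and that suffices.
    have hcoef : ∀ i : Fin 6, (∀ k, |t (k + 1) i - t k i| ≤
        4 * (2 * C1 * s k ^ (1 + α)) / (s (k + 1) * ρ) ^ 2) →
        Tendsto (fun k => s k * |t k i|) atTop (𝓝 0) := by
      intro i hi
      refine tendsto_zero_of_le_half_add (C := 16 * C1 / ρ ^ 2)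
        (fun k => mul_nonneg (hs0 k).le (abs_nonneg _)) hr2 hr1 fun k => ?_
      have hsk := hs0 k
      have h1 : |t (k + 1) i| ≤ |t k i| + 4 * (2 * C1 * s k ^ (1 + α)) / (s (k + 1) * ρ) ^ 2 := by
        have h2 := abs_sub_abs_le_abs_sub (t (k + 1) i) (t k i)
        linarith [hi k]
      rw [hsα1, hss] at h1
      rw [hss]
      calc s k / 2 * |t (k + 1) i|
          ≤ s k / 2 * (|t k i| + 4 * (2 * C1 * (s k * r ^ k)) / (s k / 2 * ρ) ^ 2) := by gcongr
        _ = _ := by field_simp; ring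
    have hb := fun k => abs_quad_coeff_le (mul_pos (hs0 (k + 1)) hρ) (hdiff k)
    have l3 := hcoef 3 fun k => (hb k).1
    have l4 := hcoef 4 fun k => (hb k).2.1
    have l5 := hcoef 5 fun k => (hb k).2.2.1
    have hvL : ‖v‖ ≤ L := by
      have := hdist _ hv z hz
      rwa [dist_eq_norm, add_sub_cancel_left] at this
    have hlim1 : Tendsto (fun k => ⟪g k, v⟫) atTop (𝓝 ⟪G, v⟫) := hG.inner tendsto_const_nhds
    have hlim2 : Tendsto (fun k : ℕ => 2 * C1 * r ^ k
        + (s k * |t k 3| + s k * |t k 4| + s k * |t k 5|) * ‖v‖ ^ 2) atTop (𝓝 0) := by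
      have h1 := (tendsto_pow_atTop_nhds_zero_of_lt_one (by linarith) hr1).const_mul (2 * C1)
      have h2 := ((l3.add l4).add l5).mul_const (‖v‖ ^ 2)
      simpa using h1.add h2
    -- Replacing `u` by its polynomial in the difference quotient costs `r ^ k` for the values and
    -- `s k` times the second-order part.
    have hlim3 : Tendsto (fun k : ℕ => (2 : ℝ) ^ k * (u (z + (1 / 2 : ℝ) ^ k • v) - u z)
        - ⟪g k, v⟫) atTop (𝓝 0) := by
      refine squeeze_zero_norm (fun k => ?_) hlim2
      have hsk := hs0 k
      have hx : z + s k • v ∈ closure U := by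
        have := hUc.closure hz hv (sub_nonneg.mpr (hs1 k)) hsk.le (sub_add_cancel 1 (s k))
        convert this using 1
        rw [smul_add, sub_smul, one_smul]
        abel
      have hxz : dist (z + s k • v) z ≤ s k * L := by
        rw [dist_eq_norm, add_sub_cancel_left, norm_smul, Real.norm_of_nonneg hsk.le]
        gcongr
      have a1 := abs_le.mp (happrox k _ hx hxz)
      have a2 := abs_le.mp (happrox k z hz (by rw [dist_self]; positivity))
      rw [hsα1] at a1 a2
      have hq := quad_add (t k) z (s k • v)
      rw [inner_smul_right] at hq
      simp only [PiLp.smul_apply, smul_eq_mul] at hq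
      have h2s : (2 : ℝ) ^ k * s k = 1 := by
        simp only [hs]
        rw [← mul_pow]
        norm_num
      have h2k : (2 : ℝ) ^ k = (s k)⁻¹ := eq_inv_of_mul_eq_one_left h2s
      have e : (2 : ℝ) ^ k * (u (z + s k • v) - u z) - ⟪g k, v⟫
          = (s k)⁻¹ * ((u (z + s k • v) - quad (t k) (z + s k • v)) - (u z - quad (t k) z))
            + s k * (t k 3 * v 0 ^ 2 + t k 4 * (v 0 * v 1) + t k 5 * v 1 ^ 2) := by
        rw [h2k, hq, hg]
        field_simp
        ring
      have b1 : |(s k)⁻¹ * ((u (z + s k • v) - quad (t k) (z + s k • v)) - (u z - quad (t k) z))|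
          ≤ 2 * C1 * r ^ k := by
        rw [abs_mul, abs_of_nonneg (by positivity), inv_mul_le_iff₀ hsk, abs_le]
        constructor <;> linarith [a1.1, a1.2, a2.1, a2.2]
      have hv0 := abs_coord_le_norm v 0
      have hv1 := abs_coord_le_norm v 1
      have b2 : |s k * (t k 3 * v 0 ^ 2 + t k 4 * (v 0 * v 1) + t k 5 * v 1 ^ 2)|
          ≤ (s k * |t k 3| + s k * |t k 4| + s k * |t k 5|) * ‖v‖ ^ 2 := by
        rw [abs_mul, abs_of_pos hsk, ← mul_add, ← mul_add, mul_assoc]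
        refine mul_le_mul_of_nonneg_left ?_ hsk.le
        rw [add_mul, add_mul]
        refine (abs_add_three _ _ _).trans ?_
        simp only [abs_mul, sq]
        gcongr
      rw [Real.norm_eq_abs, e]
      exact (abs_add_le _ _).trans (add_le_add b1 b2)
    have := hlim3.add hlim1
    simpa using this

end Gradient

/-! ### Triangles -/

/-- The cross product of two plane vectors. -/
def cross (v w : Plane) : ℝ := v 0 * w 1 - v 1 * w 0

lemma cross_self (v : Plane) : cross v v = 0 := by simp only [cross]; ring

lemma cross_zero_right (v : Plane) : cross v 0 = 0 := by simp [cross]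

/-- Cramer's rule in division-free form, valid also for dependent `v` and `w`. -/
lemma smul_eq_cross (v w x : Plane) : cross v w • x = cross x w • v + cross v x • w := by
  ext i
  fin_cases i <;> simp [cross] <;> ring

lemma exists_third_vertex {t : Finset Plane} (hcard : t.card = 3) {a b : Plane} (ha : a ∈ t)
    (hb : b ∈ t) (hab : a ≠ b) : ∃ c, c ≠ a ∧ c ≠ b ∧ t = {a, b, c} := by
  classical
  have h1 : ((t.erase a).erase b).card = 1 := by
    rw [Finset.card_erase_of_mem (Finset.mem_erase.mpr ⟨hab.symm, hb⟩),
      Finset.card_erase_of_mem ha, hcard]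
  obtain ⟨c, hc⟩ := Finset.card_eq_one.mp h1
  have hc' : c ∈ (t.erase a).erase b := by rw [hc]; exact Finset.mem_singleton_self c
  simp only [Finset.mem_erase] at hc'
  refine ⟨c, hc'.2.1, hc'.1, ?_⟩
  have h2 := Finset.insert_erase (Finset.mem_erase.mpr ⟨hab.symm, hb⟩ : b ∈ t.erase a)
  have h3 := Finset.insert_erase ha
  rw [← h3, ← h2, hc]

/-- A nondegenerate triangle, given by its vertices. -/
structure IsTriangle (t : Finset Plane) : Prop where
  card_eq : t.card = 3
  indep : AffineIndependent ℝ ((↑) : t → Plane)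

lemma Triangulation.isTriangle {Ω : Set Plane} (T : Triangulation Ω) {t : Finset Plane}
    (ht : t ∈ T.elems) : IsTriangle t :=
  ⟨T.card_eq t ht, T.indep t ht⟩

namespace IsTriangle

variable {t : Finset Plane} (ht : IsTriangle t)
include ht

lemma localAffine_eq {F : Type*} [AddCommGroup F] [Module ℝ F] (g : Plane → F) {z : Plane}
    (hz : z ∈ t) : localAffine t g z = g z :=
  localAffine_apply ht.card_eq ht.indep g hz

lemma exists_vertices : ∃ a b c : Plane, t = {a, b, c} ∧ a ≠ b ∧ a ≠ c ∧ b ≠ c := by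
  classical
  obtain ⟨a, b, c, hab, hac, hbc, h⟩ := Finset.card_eq_three.mp ht.card_eq
  exact ⟨a, b, c, h, hab, hac, hbc⟩

/-- If the edge vectors were parallel, Cramer's rule under the nodal affine function of `b` would
give `cross x (c - a) = 0` for all `x`, hence `c = a`. -/
lemma cross_ne_zero {a b c : Plane} (habc : t = {a, b, c}) (hab : a ≠ b) (hac : a ≠ c)
    (hbc : b ≠ c) : cross (b - a) (c - a) ≠ 0 := by
  classical
  intro h0
  have ha : a ∈ t := by simp [habc]
  have hb : b ∈ t := by simp [habc]
  have hc : c ∈ t := by simp [habc]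
  set f := localAffine t (fun z => if z = b then (1 : ℝ) else 0) with hf
  have fa : f a = 0 := by rw [hf, ht.localAffine_eq _ ha]; simp [hab]
  have fb : f b = 1 := by rw [hf, ht.localAffine_eq _ hb]; simp
  have fc : f c = 0 := by rw [hf, ht.localAffine_eq _ hc]; simp [hbc.symm]
  have flin : ∀ x y, f.linear (x - y) = f x - f y := fun x y => by
    simpa using f.linearMap_vsub x y
  have key : ∀ x, cross x (c - a) • (b - a) + cross (b - a) x • (c - a) = 0 := fun x => by
    rw [← smul_eq_cross, h0, zero_smul]
  have k1 : ∀ x, cross x (c - a) = 0 := fun x => by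
    have := congrArg f.linear (key x)
    rw [map_add, map_smul, map_smul, flin, flin, fa, fb, fc] at this
    simpa using this
  have e0 := k1 (!₂[1, 0])
  have e1 := k1 (!₂[0, 1])
  have : c - a = 0 := by
    ext i
    fin_cases i
    · simp only [cross, Matrix.cons_val_zero, Matrix.cons_val_one] at e1
      simp only [Fin.zero_eta, PiLp.zero_apply]
      linarith
    · simpa [cross] using e0
  exact hac (sub_eq_zero.mp this).symm

lemma eq_combination {a b c : Plane} (habc : t = {a, b, c}) (hab : a ≠ b) (hac : a ≠ c)
    (hbc : b ≠ c) (x : Plane) :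
    x - a = (cross (x - a) (c - a) / cross (b - a) (c - a)) • (b - a)
      + (cross (b - a) (x - a) / cross (b - a) (c - a)) • (c - a) := by
  have h := ht.cross_ne_zero habc hab hac hbc
  have e := smul_eq_cross (b - a) (c - a) (x - a)
  rw [div_eq_inv_mul, div_eq_inv_mul, mul_smul, mul_smul, ← smul_add, ← e, smul_smul,
    inv_mul_cancel₀ h, one_smul]

lemma affineMap_ext {F : Type*} [AddCommGroup F] [Module ℝ F] {f g : Plane →ᵃ[ℝ] F}
    (h : ∀ z ∈ t, f z = g z) : f = g := by
  obtain ⟨a, b, c, habc, hab, hac, hbc⟩ := ht.exists_vertices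
  have lin : ∀ (f : Plane →ᵃ[ℝ] F) x y, f.linear (x - y) = f x - f y := fun f x y => by
    simpa using f.linearMap_vsub x y
  ext x
  have hx := ht.eq_combination habc hab hac hbc x
  have e : ∀ f : Plane →ᵃ[ℝ] F, f x = f a + ((cross (x - a) (c - a) / cross (b - a) (c - a)) •
      (f b - f a) + (cross (b - a) (x - a) / cross (b - a) (c - a)) • (f c - f a)) := fun f => by
    rw [← lin, ← lin, ← map_smul, ← map_smul, ← map_add, ← hx, lin]
    abel
  rw [e f, e g, h a (by simp [habc]), h b (by simp [habc]), h c (by simp [habc])]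

lemma localAffine_eq_of_forall {F : Type*} [AddCommGroup F] [Module ℝ F] {f : Plane →ᵃ[ℝ] F}
    {g : Plane → F} (h : ∀ z ∈ t, f z = g z) : localAffine t g = f :=
  ht.affineMap_ext fun z hz => by rw [ht.localAffine_eq g hz, h z hz]

lemma notMem_affineSpan {z : Plane} (hz : z ∈ t) {s : Set Plane} (hs : s ⊆ t) (hzs : z ∉ s) :
    z ∉ affineSpan ℝ s := by
  have h := ht.indep.notMem_affineSpan_sdiff ⟨z, hz⟩ univ
  intro h'
  refine h (affineSpan_mono ℝ ?_ h')
  intro y hy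
  refine ⟨⟨y, hs hy⟩, ⟨mem_univ _, fun e => hzs ?_⟩, rfl⟩
  have e' : y = z := congrArg Subtype.val e
  rwa [e'] at hy

end IsTriangle

lemma subset_tri (t : Finset Plane) : (t : Set Plane) ⊆ tri t := subset_convexHull ℝ _

lemma convex_tri (t : Finset Plane) : Convex ℝ (tri t) := convex_convexHull ℝ _

lemma isCompact_tri (t : Finset Plane) : IsCompact (tri t) :=
  t.finite_toSet.isCompact_convexHull ℝ

lemma isClosed_tri (t : Finset Plane) : IsClosed (tri t) := (isCompact_tri t).isClosed

lemma measurableSet_tri (t : Finset Plane) : MeasurableSet (tri t) :=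
  (isClosed_tri t).measurableSet

lemma isBounded_tri (t : Finset Plane) : Bornology.IsBounded (tri t) :=
  (isCompact_tri t).isBounded

lemma volume_tri_ne_top (t : Finset Plane) : volume (tri t) ≠ ⊤ :=
  (isCompact_tri t).measure_lt_top.ne

lemma affineMap_eqOn_convexHull {F : Type*} [AddCommGroup F] [Module ℝ F] {f g : Plane →ᵃ[ℝ] F}
    {s : Set Plane} (h : ∀ z ∈ s, f z = g z) : ∀ x ∈ convexHull ℝ s, f x = g x := by
  have hc : Convex ℝ {x | f x = g x} := by
    intro x hx y hy a b _ _ hab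
    simp only [mem_ofPred_eq] at hx hy ⊢
    rw [Convex.combo_affine_apply hab, Convex.combo_affine_apply hab, hx, hy]
  exact fun x hx => convexHull_min h hc hx

namespace Triangulation

variable {Ω : Set Plane} (T : Triangulation Ω)
include T

lemma tri_subset_closure {t : Finset Plane} (ht : t ∈ T.elems) : tri t ⊆ closure Ω := by
  rw [← T.cover]
  exact subset_biUnion_of_mem (u := fun t : Finset Plane => convexHull ℝ (t : Set Plane)) ht

lemma mem_of_mem_tri {s t : Finset Plane} (hs : s ∈ T.elems) (ht : t ∈ T.elems) {z : Plane}
    (hz : z ∈ s) (hzt : z ∈ tri t) : z ∈ t := by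
  by_contra h
  have h1 : z ∈ convexHull ℝ ((s : Set Plane) ∩ t) := by
    rw [← T.inter_eq s hs t ht]
    exact ⟨subset_tri s hz, hzt⟩
  exact (T.isTriangle hs).notMem_affineSpan hz (s := (s : Set Plane) ∩ t) inter_subset_left
    (fun hz' => h hz'.2) (convexHull_subset_affineSpan _ h1)

/-- The element chosen in `interp` is immaterial. Two elements containing `x` meet in the hull of
their common vertices, where their affine interpolants agree. -/
lemma interp_eq {F : Type*} [AddCommGroup F] [Module ℝ F] (g : Plane → F) {t : Finset Plane}
    (ht : t ∈ T.elems) {x : Plane} (hx : x ∈ tri t) : T.interp g x = localAffine t g x := by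
  have hex : ∃ t ∈ T.elems, x ∈ tri t := ⟨t, ht, hx⟩
  rw [interp, dif_pos hex]
  obtain ⟨h1, h2⟩ := hex.choose_spec
  set s := hex.choose
  have h3 : x ∈ convexHull ℝ ((s : Set Plane) ∩ t) := by
    rw [← T.inter_eq s h1 t ht]
    exact ⟨h2, hx⟩
  refine affineMap_eqOn_convexHull (fun z hz => ?_) x h3
  rw [(T.isTriangle h1).localAffine_eq g hz.1, (T.isTriangle ht).localAffine_eq g hz.2]

lemma interp_vertex {F : Type*} [AddCommGroup F] [Module ℝ F] (g : Plane → F) {z : Plane}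
    (hz : z ∈ T.vertices) : T.interp g z = g z := by
  obtain ⟨t, ht, hzt⟩ := hz
  rw [T.interp_eq g ht (subset_tri t hzt), (T.isTriangle ht).localAffine_eq g hzt]

lemma interp_mem_V (g : Plane → ℝ) : T.interp g ∈ T.V := fun t ht =>
  ⟨localAffine t g, fun _ hx => T.interp_eq g ht hx⟩

/-- Distinct elements meet in the hull of their common vertices, whose affine span misses some
vertex of `s` and is therefore a proper subspace. -/
lemma volume_tri_inter {s t : Finset Plane} (hs : s ∈ T.elems) (ht : t ∈ T.elems) (hst : s ≠ t) :
    volume (tri s ∩ tri t) = 0 := by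
  obtain ⟨z, hzs, hzt⟩ : ∃ z ∈ s, z ∉ t := by
    by_contra! h
    exact hst (Finset.eq_of_subset_of_card_le h (by rw [T.card_eq s hs, T.card_eq t ht]))
  have hz := (T.isTriangle hs).notMem_affineSpan hzs (s := (s : Set Plane) ∩ t)
    inter_subset_left (fun h => hzt h.2)
  have hne : affineSpan ℝ ((s : Set Plane) ∩ t) ≠ ⊤ := fun h => hz (by rw [h]; trivial)
  have h0 := Measure.addHaar_affineSubspace (volume : Measure Plane) _ hne
  refine measure_mono_null ?_ h0
  rw [tri, tri, T.inter_eq s hs t ht]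
  exact convexHull_subset_affineSpan _

lemma exists_mem_tri {x : Plane} (hx : x ∈ closure Ω) : ∃ t ∈ T.elems, x ∈ tri t := by
  rw [← T.cover] at hx
  simpa [tri] using hx

end Triangulation

/-! ### Gradients of nodal interpolants -/

/-- The derivative matrix, with entries `∂_i g_j`, of the affine interpolant on `t` of `g`. -/
def nodalGrad (t : Finset Plane) (g : Plane → Plane) : Matrix (Fin 2) (Fin 2) ℝ :=
  fun i j => (localAffine t g).linear (basisVec i) j

lemma DG_eq_nodalGrad (S : Plane → Finset Plane) (v : Plane → ℝ) (t : Finset Plane) :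
    DG S v t = nodalGrad t (recoverAt S v) := rfl

/-- The Hessian matrix of the polynomial `quad e`. -/
def quadHess (e : Fin 6 → ℝ) : Matrix (Fin 2) (Fin 2) ℝ := !![2 * e 3, e 4; e 4, 2 * e 5]

lemma linear_sub_eq {F : Type*} [AddCommGroup F] [Module ℝ F] (f : Plane →ᵃ[ℝ] F) (x y : Plane) :
    f.linear (x - y) = f x - f y := by
  simpa using f.linearMap_vsub x y

/-- The area of the reference triangle. -/
def refArea : ℝ := volume.real (convexHull ℝ ({0, basisVec 0, basisVec 1} : Set Plane))

/-- The triangle is an affine image of the reference triangle with determinant the cross product.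
The value of `refArea` is never needed: it is only a common factor. -/
lemma volume_real_tri {t : Finset Plane} {a b c : Plane} (habc : t = {a, b, c}) :
    volume.real (tri t) = refArea * |cross (b - a) (c - a)| := by
  let bs := (EuclideanSpace.basisFun (Fin 2) ℝ).toBasis
  let M : Matrix (Fin 2) (Fin 2) ℝ := !![(b - a) 0, (c - a) 0; (b - a) 1, (c - a) 1]
  let f : Plane →ₗ[ℝ] Plane := Matrix.toLin bs bs M
  have hdet : LinearMap.det f = cross (b - a) (c - a) := by
    rw [LinearMap.det_toLin, Matrix.det_fin_two_of, cross]
    ring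
  have hf : ∀ i, f (basisVec i) = ![b - a, c - a] i := by
    intro i
    have hb : basisVec i = bs i := by simp [bs, basisVec]
    rw [hb, Matrix.toLin_self]
    ext j
    fin_cases i <;> fin_cases j <;> simp [bs, M]
  have himg : tri t = (fun x => a + x) '' (f '' convexHull ℝ {0, basisVec 0, basisVec 1}) := by
    rw [LinearMap.image_convexHull, tri, habc]
    have h1 := (AffineEquiv.constVAdd ℝ Plane a).toAffineMap.image_convexHull
      (f '' {0, basisVec 0, basisVec 1})
    have h2 : (fun x => a + x) = (AffineEquiv.constVAdd ℝ Plane a).toAffineMap := by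
      funext x
      simp
    rw [h2, h1]
    congr 1
    simp [image_insert_eq, hf]
  rw [himg, measureReal_def, image_add_left, measure_preimage_add,
    Measure.addHaar_image_linearMap, hdet, ENNReal.toReal_mul, ENNReal.toReal_ofReal (abs_nonneg _),
    mul_comm, refArea, measureReal_def]

namespace IsTriangle

variable {t : Finset Plane} (ht : IsTriangle t)
include ht

lemma localAffine_sub {F : Type*} [AddCommGroup F] [Module ℝ F] (g g' : Plane → F) :
    localAffine t (fun z => g z - g' z) = localAffine t g - localAffine t g' :=
  ht.localAffine_eq_of_forall fun z hz => by
    simp [ht.localAffine_eq g hz, ht.localAffine_eq g' hz]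

lemma nodalGrad_sub (g g' : Plane → Plane) :
    nodalGrad t (fun z => g z - g' z) = nodalGrad t g - nodalGrad t g' := by
  ext i j
  simp [nodalGrad, ht.localAffine_sub]

/-- The gradient of a quadratic is affine, so nodal interpolation reproduces it. This lets Taylor
polynomials be subtracted before estimating. -/
lemma nodalGrad_quadGrad (e : Fin 6 → ℝ) : nodalGrad t (quadGrad e) = quadHess e := by
  let M : Plane →ₗ[ℝ] Plane :=
    { toFun := fun x => !₂[2 * e 3 * x 0 + e 4 * x 1, e 4 * x 0 + 2 * e 5 * x 1]
      map_add' := fun x y => by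
        ext i
        fin_cases i <;> simp <;> ring
      map_smul' := fun c x => by
        ext i
        fin_cases i <;> simp <;> ring }
  let f : Plane →ᵃ[ℝ] Plane := M.toAffineMap + AffineMap.const ℝ Plane (!₂[e 1, e 2] : Plane)
  have hf : localAffine t (quadGrad e) = f := ht.localAffine_eq_of_forall fun z _ => by
    ext i
    fin_cases i <;> simp [f, M, quadGrad] <;> ring
  ext i j
  simp only [nodalGrad, hf]
  fin_cases i <;> fin_cases j <;> simp [f, M, quadHess, basisVec]

/-- Inverse estimate: the affine field is bounded by its vertex values on all of the triangle, and
its directional derivatives are differences across diameters of the disc. -/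
lemma contract_nodalGrad_le {g : Plane → Plane} {m : ℝ} (hg : ∀ z ∈ t, ‖g z‖ ≤ m)
    {c : Plane} {ρ : ℝ} (hρ : 0 < ρ) (hsub : Metric.closedBall c ρ ⊆ tri t) :
    contract (nodalGrad t g) (nodalGrad t g) ≤ 4 * (m / ρ) ^ 2 := by
  set f := localAffine t g with hf
  have hmem : ∀ x ∈ tri t, ‖f x‖ ≤ m := by
    intro x hx
    have h1 : tri t ⊆ f ⁻¹' Metric.closedBall 0 m := by
      refine convexHull_min (fun z hz => ?_) ((convex_closedBall _ _).affine_preimage f)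
      rw [mem_preimage, mem_closedBall_zero_iff, hf, ht.localAffine_eq g hz]
      exact hg z hz
    simpa using h1 hx
  have hb : ∀ i, ‖f.linear (basisVec i)‖ ≤ m / ρ := by
    intro i
    have hn : ‖basisVec i‖ = 1 := by simp [basisVec]
    have h1 : c + ρ • basisVec i ∈ tri t := hsub (by
      rw [Metric.mem_closedBall, dist_eq_norm, add_sub_cancel_left, norm_smul, hn,
        Real.norm_of_nonneg hρ.le, mul_one])
    have h2 : c - ρ • basisVec i ∈ tri t := hsub (by
      rw [Metric.mem_closedBall, dist_eq_norm, sub_sub_cancel_left, norm_neg, norm_smul, hn,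
        Real.norm_of_nonneg hρ.le, mul_one])
    have h3 := linear_sub_eq f (c + ρ • basisVec i) (c - ρ • basisVec i)
    have e : c + ρ • basisVec i - (c - ρ • basisVec i) = (2 * ρ) • basisVec i := by
      rw [two_mul, add_smul]
      abel
    rw [e, map_smul] at h3
    have h4 : ‖(2 * ρ) • f.linear (basisVec i)‖ ≤ m + m := by
      rw [h3]
      exact (norm_sub_le _ _).trans (add_le_add (hmem _ h1) (hmem _ h2))
    rw [norm_smul, Real.norm_of_nonneg (by positivity)] at h4
    rw [le_div_iff₀ hρ]
    linarith
  have hent : ∀ i j, nodalGrad t g i j * nodalGrad t g i j ≤ (m / ρ) ^ 2 := by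
    intro i j
    have h1 : |nodalGrad t g i j| ≤ m / ρ := (abs_coord_le_norm _ j).trans (hb i)
    rw [← sq]
    exact sq_le_sq' (by linarith [(abs_le.mp h1).1]) (abs_le.mp h1).2
  simp only [contract, Fin.sum_univ_two]
  linarith [hent 0 0, hent 0 1, hent 1 0, hent 1 1]

lemma nodalGrad_vecMul {g : Plane → Plane} {x y : Plane} (hx : x ∈ t) (hy : y ∈ t) (j : Fin 2) :
    (x - y) 0 * nodalGrad t g 0 j + (x - y) 1 * nodalGrad t g 1 j = g x j - g y j := by
  have h := linear_sub_eq (localAffine t g) x y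
  rw [ht.localAffine_eq g hx, ht.localAffine_eq g hy, ← sum_smul_basisVec (x - y), map_sum] at h
  have h' := congrArg (fun v : Plane => v j) h
  simpa [Fin.sum_univ_two, nodalGrad] using h'

/-- The signed area of the image of a triangle under an affine map. -/
lemma volume_mul_det_nodalGrad (g : Plane → Plane) {a b c : Plane} (habc : t = {a, b, c}) :
    volume.real (tri t) * (nodalGrad t g).det
      = refArea * (Real.sign (cross (b - a) (c - a))
        * (cross (g a) (g b) + cross (g b) (g c) + cross (g c) (g a))) := by
  have ha : a ∈ t := by simp [habc]
  have hb : b ∈ t := by simp [habc]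
  have hc : c ∈ t := by simp [habc]
  rw [volume_real_tri habc, mul_assoc]
  congr 1
  have hs : |cross (b - a) (c - a)|
      = Real.sign (cross (b - a) (c - a)) * cross (b - a) (c - a) := by
    rcases lt_trichotomy (cross (b - a) (c - a)) 0 with h | h | h
    · rw [Real.sign_of_neg h, abs_of_neg h]; ring
    · rw [h]; simp
    · rw [Real.sign_of_pos h, abs_of_pos h]; ring
  rw [hs, mul_assoc]
  congr 1
  have b0 := ht.nodalGrad_vecMul (g := g) hb ha 0
  have b1 := ht.nodalGrad_vecMul (g := g) hb ha 1
  have c0 := ht.nodalGrad_vecMul (g := g) hc ha 0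
  have c1 := ht.nodalGrad_vecMul (g := g) hc ha 1
  rw [Matrix.det_fin_two]
  have e : cross (g a) (g b) + cross (g b) (g c) + cross (g c) (g a)
      = (g b 0 - g a 0) * (g c 1 - g a 1) - (g b 1 - g a 1) * (g c 0 - g a 0) := by
    simp only [cross]
    ring
  rw [e, ← b0, ← b1, ← c0, ← c1, cross]
  ring

end IsTriangle

/-! ### Interior edges -/

/-- The orientation of the edge `a b` of the triangle `t`: the side of the line through `a` and `b`
on which the third vertex lies. -/
def side (t : Finset Plane) (a b : Plane) : ℝ := ∑ c ∈ t, Real.sign (cross (b - a) (c - a))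

lemma cross_sub_swap (a b c : Plane) : cross (a - b) (c - b) = -cross (b - a) (c - a) := by
  simp only [cross, PiLp.sub_apply]
  ring

lemma cross_sub_rotate (a b c : Plane) : cross (c - b) (a - b) = cross (b - a) (c - a) := by
  simp only [cross, PiLp.sub_apply]
  ring

lemma side_eq {t : Finset Plane} {a b c : Plane} (habc : t = {a, b, c}) (hab : a ≠ b)
    (hac : a ≠ c) (hbc : b ≠ c) : side t a b = Real.sign (cross (b - a) (c - a)) := by
  classical
  rw [side, habc, Finset.sum_insert (by simp [hab, hac]), Finset.sum_insert (by simp [hbc]),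
    Finset.sum_singleton, sub_self, cross_zero_right, cross_self, Real.sign_zero, zero_add,
    zero_add]

/-- Both `side` and `cross` change sign when an edge is reversed, so every edge is counted twice
with the same sign. This is the factor `2`. -/
lemma IsTriangle.sum_side_mul {t : Finset Plane} (ht : IsTriangle t) (g : Plane → Plane) :
    ∑ a ∈ t, ∑ b ∈ t, side t a b * cross (g a) (g b) * refArea
      = 2 * (volume.real (tri t) * (nodalGrad t g).det) := by
  classical
  obtain ⟨a, b, c, habc, hab, hac, hbc⟩ := ht.exists_vertices
  have h1 := side_eq habc hab hac hbc
  have h2 : side t b c = Real.sign (cross (b - a) (c - a)) := by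
    rw [side_eq (a := b) (b := c) (c := a) (by rw [habc]; ext; simp; tauto) hbc hab.symm hac.symm,
      cross_sub_rotate]
  have h3 : side t c a = Real.sign (cross (b - a) (c - a)) := by
    rw [side_eq (a := c) (b := a) (c := b) (by rw [habc]; ext; simp; tauto) hac.symm hbc.symm hab,
      cross_sub_rotate, cross_sub_rotate]
  have h4 : side t b a = -Real.sign (cross (b - a) (c - a)) := by
    rw [side_eq (a := b) (b := a) (c := c) (by rw [habc]; ext; simp; tauto) hab.symm hbc hac,
      cross_sub_swap, Real.sign_neg]
  have h5 : side t c b = -Real.sign (cross (b - a) (c - a)) := by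
    rw [side_eq (a := c) (b := b) (c := a) (by rw [habc]; ext; simp; tauto) hbc.symm hac.symm
      hab.symm, cross_sub_swap, Real.sign_neg, cross_sub_rotate]
  have h6 : side t a c = -Real.sign (cross (b - a) (c - a)) := by
    rw [side_eq (a := a) (b := c) (c := b) (by rw [habc]; ext; simp; tauto) hac hab hbc.symm,
      ← Real.sign_neg]
    congr 1
    simp only [cross]
    ring
  have hsum : ∀ f : Plane → ℝ, ∑ x ∈ t, f x = f a + f b + f c := fun f => by
    rw [habc, Finset.sum_insert (by simp [hab, hac]), Finset.sum_insert (by simp [hbc]),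
      Finset.sum_singleton]
    ring
  rw [ht.volume_mul_det_nodalGrad g habc]
  simp only [hsum, h1, h2, h3, h4, h5, h6, cross]
  ring

namespace Triangulation

variable {Ω : Set Plane} (T : Triangulation Ω)
include T

/-- Two triangles on the same side of a common edge overlap near its midpoint, off the edge. If
their third vertices differed, conformity would confine the intersection to the edge. -/
lemma eq_of_side_eq {s t : Finset Plane} (hs : s ∈ T.elems) (ht : t ∈ T.elems) {a b : Plane}
    (has : a ∈ s) (hbs : b ∈ s) (hat : a ∈ t) (hbt : b ∈ t) (hab : a ≠ b)
    (h : side s a b = side t a b) : s = t := by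
  classical
  have hS := T.isTriangle hs
  have hT := T.isTriangle ht
  obtain ⟨c, hca, hcb, hsc⟩ := exists_third_vertex hS.card_eq has hbs hab
  obtain ⟨d, hda, hdb, htd⟩ := exists_third_vertex hT.card_eq hat hbt hab
  by_contra hne
  have hcd : c ≠ d := fun e => hne (by rw [hsc, htd, e])
  have hcs := hS.cross_ne_zero hsc hab hca.symm hcb.symm
  have hct := hT.cross_ne_zero htd hab hda.symm hdb.symm
  rw [side_eq hsc hab hca.symm hcb.symm, side_eq htd hab hda.symm hdb.symm] at h
  have hint : (s : Set Plane) ∩ t ⊆ {a, b} := by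
    rintro x ⟨hxs, hxt⟩
    rw [hsc] at hxs
    rw [htd] at hxt
    simp only [Finset.coe_insert, Finset.coe_singleton, mem_insert_iff, mem_singleton_iff]
      at hxs hxt ⊢
    rcases hxs with e | e | e
    · exact Or.inl e
    · exact Or.inr e
    · rcases hxt with e' | e' | e'
      · exact Or.inl e'
      · exact Or.inr e'
      · exact absurd (e.symm.trans e') hcd
  set v := b - a with hv
  set w := c - a with hw
  set w' := d - a with hw'
  set l := cross w w' / cross v w' with hl
  set μ := cross v w / cross v w' with hμ
  have hwl : w = l • v + μ • w' := hT.eq_combination htd hab hda.symm hdb.symm c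
  have hμ0 : 0 < μ := by
    rcases hcs.lt_or_gt with h1 | h1 <;> rcases hct.lt_or_gt with h2 | h2
    · exact div_pos_of_neg_of_neg h1 h2
    · rw [Real.sign_of_neg h1, Real.sign_of_pos h2] at h; norm_num at h
    · rw [Real.sign_of_pos h1, Real.sign_of_neg h2] at h; norm_num at h
    · exact div_pos h1 h2
  have hmem : ∀ {r : Finset Plane} {e : Plane}, a ∈ r → b ∈ r → e ∈ r → ∀ α β : ℝ, 0 ≤ α → 0 ≤ β →
      α + β ≤ 1 → a + (α • v + β • (e - a)) ∈ tri r := by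
    intro r e har hbr her α β hα hβ hαβ
    have h1 := (convex_tri r).sum_mem (t := Finset.univ) (w := ![1 - α - β, α, β])
      (z := ![a, b, e]) (by
        intro i _
        fin_cases i
        · simp; linarith
        · simpa using hα
        · simpa using hβ) (by
        simp only [Fin.sum_univ_three, Matrix.cons_val]
        ring) (by
        intro i _
        fin_cases i
        · exact subset_tri r har
        · exact subset_tri r hbr
        · exact subset_tri r her)
    convert h1 using 1
    simp only [Fin.sum_univ_three, Matrix.cons_val_zero, Matrix.cons_val_one, Matrix.cons_val]
    rw [hv]
    module
  -- Small enough that the coordinates of the point in both triangles are nonnegative with sum at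
  -- most one: the shifts `ε`, `ε l` and `ε μ + |ε l|` are all at most `1/4` in absolute value.
  set ε := 1 / (4 * (1 + |l| + μ)) with hε
  have hD : 0 < 1 + |l| + μ := by positivity
  have hε0 : 0 < ε := by positivity
  have hε1 : ε * (1 + |l| + μ) = 1 / 4 := by rw [hε]; field_simp
  have hεl : |ε * l| ≤ 1 / 4 := by
    rw [abs_mul, abs_of_pos hε0]
    nlinarith [abs_nonneg l]
  have hεμ : ε * μ + |ε * l| ≤ 1 / 4 := by
    rw [abs_mul, abs_of_pos hε0]
    nlinarith [abs_nonneg l]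
  have hεle : ε ≤ 1 / 4 := by nlinarith [abs_nonneg l]
  have hl1 := abs_le.mp hεl
  set x := a + ((1 / 2 : ℝ) • v + ε • w) with hx
  have hxs : x ∈ tri s := hmem has hbs (by simp [hsc]) _ _ (by norm_num) hε0.le (by linarith)
  have hxt : x ∈ tri t := by
    have e : x = a + ((1 / 2 + ε * l) • v + (ε * μ) • w') := by
      rw [hx]
      conv_lhs => rw [hwl]
      module
    rw [e]
    refine hmem hat hbt (by simp [htd]) _ _ (by linarith) (by positivity) ?_
    linarith [le_abs_self (ε * l)]
  have hxc : x ∈ convexHull ℝ {a, b} := by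
    refine convexHull_mono hint ?_
    rw [← T.inter_eq s hs t ht]
    exact ⟨hxs, hxt⟩
  rw [convexHull_pair, segment_eq_image'] at hxc
  obtain ⟨τ, -, hτ⟩ := hxc
  have hcr : cross v (x - a) = 0 := by
    rw [← hτ, ← hv]
    simp [cross]
    ring
  have : cross v (x - a) = ε * cross v w := by
    rw [hx, add_sub_cancel_left]
    simp [cross]
    ring
  rw [this] at hcr
  rcases mul_eq_zero.mp hcr with h1 | h1
  · exact hε0.ne' h1
  · exact hcs h1

/-- Step across the edge from a point that is in `Ω` and inside the edge. The element reached
contains the edge by conformity, and cannot lie on the same side as `t`. -/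
lemma exists_opposite (hΩo : IsOpen Ω) {t : Finset Plane} (ht : t ∈ T.elems) {a b : Plane}
    (ha : a ∈ t) (hb : b ∈ t) (hab : a ≠ b) (hfr : ¬ segment ℝ a b ⊆ frontier Ω) :
    ∃ s ∈ T.elems, a ∈ s ∧ b ∈ s ∧ side s a b = -side t a b := by
  classical
  have hT := T.isTriangle ht
  obtain ⟨c, hca, hcb, htc⟩ := exists_third_vertex hT.card_eq ha hb hab
  have hc : c ∈ t := by simp [htc]
  have hct := hT.cross_ne_zero htc hab hca.symm hcb.symm
  have hseg : segment ℝ a b ⊆ tri t :=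
    (convex_tri t).segment_subset (subset_tri t ha) (subset_tri t hb)
  obtain ⟨x0, hx0, hx0f⟩ := not_subset.mp hfr
  have hx0Ω : x0 ∈ Ω := by
    have h1 := T.tri_subset_closure ht (hseg hx0)
    by_contra h2
    exact hx0f ⟨h1, by rwa [hΩo.interior_eq]⟩
  -- The given point may be an endpoint; openness of `Ω` moves it into the relative interior, where
  -- both barycentric coordinates are nonzero.
  obtain ⟨τ, hτ, hτΩ⟩ : ∃ τ ∈ Ioo (0 : ℝ) 1, a + τ • (b - a) ∈ Ω := by
    rw [segment_eq_image'] at hx0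
    obtain ⟨τ0, hτ0, rfl⟩ := hx0
    have hopen : IsOpen ((fun τ : ℝ => a + τ • (b - a)) ⁻¹' Ω) := hΩo.preimage (by fun_prop)
    have hcl : τ0 ∈ closure (Ioo (0 : ℝ) 1) := by rwa [closure_Ioo zero_ne_one]
    obtain ⟨τ, h1, h2⟩ := mem_closure_iff.mp hcl _ hopen hx0Ω
    exact ⟨τ, h2, h1⟩
  set x := a + τ • (b - a) with hx
  have hxseg : x ∈ segment ℝ a b := by
    rw [segment_eq_image']
    exact ⟨τ, ⟨hτ.1.le, hτ.2.le⟩, rfl⟩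
  -- The step `η` stays in `Ω` and avoids all elements not containing `x`, which are finitely many
  -- closed sets. Whichever element contains the new point must then contain `x`.
  obtain ⟨η, hη0, hηΩ, hη⟩ : ∃ η > (0 : ℝ), x - η • (c - a) ∈ Ω ∧
      ∀ s ∈ T.elems, x ∉ tri s → x - η • (c - a) ∉ tri s := by
    have hev : ∀ᶠ y in 𝓝 x, y ∈ Ω ∧ ∀ s ∈ T.elems, x ∉ tri s → y ∉ tri s := by
      refine (hΩo.eventually_mem hτΩ).and ?_
      rw [Filter.eventually_all_finset]
      intro s _
      by_cases hxs : x ∈ tri s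
      · exact Eventually.of_forall fun y h => absurd hxs h
      · filter_upwards [(isClosed_tri s).isOpen_compl.mem_nhds hxs] with y hy _ using hy
    have hcont : Tendsto (fun η : ℝ => x - η • (c - a)) (𝓝[>] 0) (𝓝 x) := by
      have : Continuous fun η : ℝ => x - η • (c - a) := by fun_prop
      simpa using (this.tendsto 0).mono_left nhdsWithin_le_nhds
    obtain ⟨η, h1, h2⟩ := ((hcont.eventually hev).and self_mem_nhdsWithin).exists
    exact ⟨η, h2, h1.1, h1.2⟩
  obtain ⟨s, hs, hys⟩ := T.exists_mem_tri (subset_closure hηΩ)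
  have hxs : x ∈ tri s := by
    by_contra h
    exact hη s hs h hys
  have hxst : x ∈ convexHull ℝ ((t : Set Plane) ∩ s) := by
    rw [← T.inter_eq t ht s hs]
    exact ⟨hseg hxseg, hxs⟩
  -- A vertex with nonzero barycentric coordinate at `x` must be shared: otherwise its nodal
  -- function would vanish on the hull of the common vertices.
  have hvert : ∀ z ∈ t, localAffine t (fun y => if y = z then (1 : ℝ) else 0) x ≠ 0 → z ∈ s := by
    intro z hz hne
    by_contra hzs
    refine hne ?_
    have h1 : ∀ y ∈ (t : Set Plane) ∩ s, localAffine t (fun y => if y = z then (1 : ℝ) else 0) y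
        = AffineMap.const ℝ Plane (0 : ℝ) y := by
      intro y hy
      rw [hT.localAffine_eq _ hy.1, if_neg (fun e => hzs (by rw [← e]; exact hy.2))]
      simp
    simpa using affineMap_eqOn_convexHull h1 x hxst
  have hval : ∀ f : Plane →ᵃ[ℝ] ℝ, f x = (1 - τ) * f a + τ * f b := by
    intro f
    have h1 := linear_sub_eq f x a
    have h2 := linear_sub_eq f b a
    rw [hx, add_sub_cancel_left, map_smul, h2, smul_eq_mul, ← hx] at h1
    linarith
  have has : a ∈ s := hvert a ha (by
    rw [hval, hT.localAffine_eq _ ha, hT.localAffine_eq _ hb, if_pos rfl, if_neg hab.symm]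
    have := hτ.2
    simp
    linarith)
  have hbs : b ∈ s := hvert b hb (by
    rw [hval, hT.localAffine_eq _ ha, hT.localAffine_eq _ hb, if_neg hab, if_pos rfl]
    have := hτ.1
    simp
    linarith)
  refine ⟨s, hs, has, hbs, ?_⟩
  have hS := T.isTriangle hs
  obtain ⟨d, hda, hdb, hsd⟩ := exists_third_vertex hS.card_eq has hbs hab
  have hds := hS.cross_ne_zero hsd hab hda.symm hdb.symm
  rw [side_eq htc hab hca.symm hcb.symm, side_eq hsd hab hda.symm hdb.symm]
  have hy : cross (b - a) (x - η • (c - a) - a) = -(η * cross (b - a) (c - a)) := by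
    rw [hx]
    simp [cross]
    ring
  have hconv : ∀ r : ℝ, Convex ℝ {y : Plane | 0 ≤ r * cross (b - a) (y - a)} := by
    intro r y hy z hz p q hp hq hpq
    simp only [mem_ofPred_eq] at hy hz ⊢
    have e : cross (b - a) (p • y + q • z - a)
        = p * cross (b - a) (y - a) + q * cross (b - a) (z - a) := by
      have hq' : q = 1 - p := by linarith
      simp [cross, hq']
      ring
    rw [e]
    nlinarith [mul_nonneg hp hy, mul_nonneg hq hz]
  -- The element lies in one half-plane of the line through `a` and `b`, fixed by its third vertex.
  -- It contains a point across the edge from `c`, so equal signs are excluded.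
  have hmain : ∀ r : ℝ, 0 ≤ r * cross (b - a) (d - a) →
      0 ≤ r * cross (b - a) (x - η • (c - a) - a) := by
    intro r hr
    have h1 : tri s ⊆ {y : Plane | 0 ≤ r * cross (b - a) (y - a)} := by
      refine convexHull_min ?_ (hconv r)
      intro z hz
      rw [hsd] at hz
      simp only [Finset.coe_insert, Finset.coe_singleton, mem_insert_iff, mem_singleton_iff] at hz
      simp only [mem_ofPred_eq]
      rcases hz with rfl | rfl | rfl
      · rw [sub_self, cross_zero_right, mul_zero]
      · rw [cross_self, mul_zero]
      · exact hr
    exact h1 hys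
  rcases hct.lt_or_gt with h1 | h1 <;> rcases hds.lt_or_gt with h2 | h2
  · have := hmain (-1) (by linarith)
    rw [hy] at this
    nlinarith
  · rw [Real.sign_of_neg h1, Real.sign_of_pos h2]; norm_num
  · rw [Real.sign_of_pos h1, Real.sign_of_neg h2]
  · have := hmain 1 (by linarith)
    rw [hy] at this
    nlinarith

-- An element is determined by an edge and its side, so passing to the opposite element is an
-- involution that pairs the terms into cancelling couples.
open Classical in
lemma sum_side_eq_zero (hΩo : IsOpen Ω) {a b : Plane} (hab : a ≠ b)
    (hfr : ¬ segment ℝ a b ⊆ frontier Ω) :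
    ∑ t ∈ T.elems with a ∈ t ∧ b ∈ t, side t a b = 0 := by
  have hopp : ∀ t ∈ T.elems.filter (fun t => a ∈ t ∧ b ∈ t),
      ∃ s ∈ T.elems, a ∈ s ∧ b ∈ s ∧ side s a b = -side t a b := by
    intro t ht
    rw [Finset.mem_filter] at ht
    exact T.exists_opposite hΩo ht.1 ht.2.1 ht.2.2 hab hfr
  choose! o ho1 ho2 ho3 ho4 using hopp
  refine Finset.sum_involution (fun t _ => o t) ?_ ?_ ?_ ?_
  · intro t ht
    rw [ho4 t ht, add_neg_cancel]
  · intro t ht hne h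
    have h1 := ho4 t ht
    rw [h] at h1
    exact hne (by linarith)
  · intro t ht
    exact Finset.mem_filter.mpr ⟨ho1 t ht, ho2 t ht, ho3 t ht⟩
  · intro t ht
    have hot : o t ∈ T.elems.filter (fun t => a ∈ t ∧ b ∈ t) :=
      Finset.mem_filter.mpr ⟨ho1 t ht, ho2 t ht, ho3 t ht⟩
    have ht' := Finset.mem_filter.mp ht
    refine T.eq_of_side_eq (ho1 _ hot) ht'.1 (ho2 _ hot) (ho3 _ hot) ht'.2.1 ht'.2.2 hab ?_
    rw [ho4 _ hot, ho4 _ ht, neg_neg]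

/-- The mean of the Jacobian of a continuous piecewise linear field vanishes when the tangential
component of the field vanishes on the boundary. -/
theorem sum_volume_mul_det_eq_zero (hΩo : IsOpen Ω) {g : Plane → Plane}
    (hg : ∀ t ∈ T.elems, ∀ a ∈ t, ∀ b ∈ t, segment ℝ a b ⊆ frontier Ω →
      ⟪g a, b - a⟫ = 0) :
    ∑ t ∈ T.elems, volume.real (tri t) * (nodalGrad t g).det = 0 := by
  classical
  set W := T.elems.biUnion id with hW
  have hsub : ∀ t ∈ T.elems, t ⊆ W := fun t ht x hx =>
    Finset.mem_biUnion.mpr ⟨t, ht, hx⟩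
  -- Extending the sums by zero to all vertex pairs of the mesh allows the order to be exchanged and
  -- the terms collected edge by edge.
  have h1 : ∀ t ∈ T.elems, ∑ a ∈ W, ∑ b ∈ W,
      (if a ∈ t ∧ b ∈ t then side t a b * cross (g a) (g b) * refArea else 0)
      = 2 * (volume.real (tri t) * (nodalGrad t g).det) := by
    intro t ht
    rw [← (T.isTriangle ht).sum_side_mul g]
    rw [← Finset.sum_subset (hsub t ht) (fun a _ ha => Finset.sum_eq_zero fun b _ =>
      if_neg fun h => ha h.1)]
    refine Finset.sum_congr rfl fun a ha => ?_
    rw [← Finset.sum_subset (hsub t ht) (fun b _ hb => if_neg fun h => hb h.2)]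
    exact Finset.sum_congr rfl fun b hb => if_pos ⟨ha, hb⟩
  have h2 : ∑ t ∈ T.elems, 2 * (volume.real (tri t) * (nodalGrad t g).det) = 0 := by
    rw [← Finset.sum_congr rfl h1, Finset.sum_comm]
    refine Finset.sum_eq_zero fun a _ => ?_
    rw [Finset.sum_comm]
    refine Finset.sum_eq_zero fun b _ => ?_
    rw [← Finset.sum_filter, ← Finset.sum_mul, ← Finset.sum_mul]
    rcases eq_or_ne a b with rfl | hab
    · rw [cross_self, mul_zero, zero_mul]
    by_cases hfr : segment ℝ a b ⊆ frontier Ω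
    · rcases (T.elems.filter (fun t => a ∈ t ∧ b ∈ t)).eq_empty_or_nonempty with he | ⟨t, ht⟩
      · rw [he, Finset.sum_empty, zero_mul, zero_mul]
      · rw [Finset.mem_filter] at ht
        have ga := hg t ht.1 a ht.2.1 b ht.2.2 hfr
        have gb := hg t ht.1 b ht.2.2 a ht.2.1 (by rwa [segment_symm])
        rw [inner_eq_sum] at ga gb
        -- Both values are orthogonal to the same nonzero edge vector, hence parallel in the plane.
        have hc : cross (g a) (g b) = 0 := by
          have hne : (b - a) 0 ≠ 0 ∨ (b - a) 1 ≠ 0 := by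
            by_contra! h
            refine hab (sub_eq_zero.mp ?_).symm
            ext i
            fin_cases i
            · simpa using h.1
            · simpa using h.2
          simp only [PiLp.sub_apply] at ga gb hne
          simp only [cross]
          rcases hne with h | h
          · refine (mul_eq_zero.mp ?_).resolve_left h
            linear_combination (g b 1) * ga + (g a 1) * gb
          · refine (mul_eq_zero.mp ?_).resolve_left h
            linear_combination -(g b 0) * ga - (g a 0) * gb
        rw [hc, mul_zero, zero_mul]
    · rw [T.sum_side_eq_zero hΩo hab hfr, zero_mul, zero_mul]
  rw [← Finset.mul_sum] at h2
  linarith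

end Triangulation

/-! ### Stability of the recovery -/

lemma quad_eq_sum (d : Fin 6 → ℝ) (x : Plane) : quad d x = ∑ i, d i * quad (Pi.single i 1) x := by
  simp [quad, Fin.sum_univ_six, Pi.single_apply]

lemma quad_add_coeff (c d : Fin 6 → ℝ) (x : Plane) : quad (c + d) x = quad c x + quad d x := by
  simp only [quad, Pi.add_apply]
  ring

lemma quad_smul_coeff (r : ℝ) (c : Fin 6 → ℝ) (x : Plane) : quad (r • c) x = r * quad c x := by
  simp only [quad, Pi.smul_apply, smul_eq_mul]
  ring

/-- The coefficients of `quad c` in the coordinates centred at `z` and scaled by `d`. -/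
def rescale (c : Fin 6 → ℝ) (z : Plane) (d : ℝ) : Fin 6 → ℝ :=
  ![quad c z, d * quadGrad c z 0, d * quadGrad c z 1, d ^ 2 * c 3, d ^ 2 * c 4, d ^ 2 * c 5]

lemma quad_rescale (c : Fin 6 → ℝ) (z : Plane) {d : ℝ} (hd : d ≠ 0) (x : Plane) :
    quad (rescale c z d) (d⁻¹ • (x - z)) = quad c x := by
  have h := quad_add c z (x - z)
  rw [add_sub_cancel, inner_eq_sum] at h
  rw [h]
  simp only [quad, rescale, PiLp.smul_apply, smul_eq_mul, Matrix.cons_val]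
  field_simp
  ring

/-- The normal equations form a square linear system; it is injective because a kernel element has
zero sum of squares on `P`, hence it is surjective. -/
lemma exists_isFit {P : Finset Plane}
    (hP : ∀ c : Fin 6 → ℝ, ∑ x ∈ P, quad c x ^ 2 = 0 → c = 0) (v : Plane → ℝ) :
    ∃ c, IsFit P v c := by
  let Φ : (Fin 6 → ℝ) →ₗ[ℝ] (Fin 6 → ℝ) :=
    { toFun := fun c i => ∑ x ∈ P, quad c x * quad (Pi.single i 1) x
      map_add' := fun c d => by
        funext i
        simp only [quad_add_coeff, add_mul, Finset.sum_add_distrib, Pi.add_apply]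
      map_smul' := fun r c => by
        funext i
        simp only [quad_smul_coeff, mul_assoc, ← Finset.mul_sum, Pi.smul_apply, smul_eq_mul,
          RingHom.id_apply] }
  have hpair : ∀ (w : Plane → ℝ) (d : Fin 6 → ℝ), ∑ x ∈ P, w x * quad d x
      = ∑ i, d i * ∑ x ∈ P, w x * quad (Pi.single i 1) x := by
    intro w d
    simp_rw [Finset.mul_sum]
    rw [Finset.sum_comm]
    refine Finset.sum_congr rfl fun x _ => ?_
    rw [quad_eq_sum d x, Finset.mul_sum]
    exact Finset.sum_congr rfl fun i _ => by ring
  have hinj : Function.Injective Φ := by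
    rw [← LinearMap.ker_eq_bot, LinearMap.ker_eq_bot']
    intro c hc
    refine hP c ?_
    have h1 := hpair (quad c) c
    simp_rw [sq]
    rw [h1]
    refine Finset.sum_eq_zero fun i _ => ?_
    have h2 : ∑ x ∈ P, quad c x * quad (Pi.single i 1) x = 0 := congrFun hc i
    rw [h2, mul_zero]
  obtain ⟨c, hc⟩ := LinearMap.surjective_of_injective hinj
    (fun i => ∑ x ∈ P, v x * quad (Pi.single i 1) x)
  refine ⟨c, fun d => ?_⟩
  have h1 := hpair (quad c) d
  have h2 := hpair v d
  simp_rw [sub_mul]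
  rw [Finset.sum_sub_distrib, h1, h2, sub_eq_zero]
  refine Finset.sum_congr rfl fun i _ => ?_
  have h3 : ∑ x ∈ P, quad c x * quad (Pi.single i 1) x
      = ∑ x ∈ P, v x * quad (Pi.single i 1) x := congrFun hc i
  rw [h3]

lemma IsFit.sub {P : Finset Plane} {v w : Plane → ℝ} {c d : Fin 6 → ℝ} (hv : IsFit P v c)
    (hw : IsFit P w d) : IsFit P (v - w) (c - d) := by
  intro e
  have h1 := hv e
  have h2 := hw e
  rw [← sub_eq_zero.mpr (h1.trans h2.symm), ← Finset.sum_sub_distrib]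
  refine Finset.sum_congr rfl fun x _ => ?_
  rw [quad_sub, Pi.sub_apply]
  ring

/-- The fit is an orthogonal projection onto quadratics, so the distance from any quadratic does not
increase under fitting. -/
lemma IsFit.sum_sq_sub_le {P : Finset Plane} {v : Plane → ℝ} {c : Fin 6 → ℝ} (hv : IsFit P v c)
    (e : Fin 6 → ℝ) : ∑ x ∈ P, quad (c - e) x ^ 2 ≤ ∑ x ∈ P, (v x - quad e x) ^ 2 := by
  have h1 := hv (c - e)
  have h2 : ∑ x ∈ P, (v x - quad e x) ^ 2 - ∑ x ∈ P, quad (c - e) x ^ 2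
      = ∑ x ∈ P, ((quad c x - v x) ^ 2 - 2 * ((quad c x - v x) * quad (c - e) x)) := by
    rw [← Finset.sum_sub_distrib]
    refine Finset.sum_congr rfl fun x _ => ?_
    rw [quad_sub]
    ring
  rw [Finset.sum_sub_distrib, ← Finset.mul_sum, h1] at h2
  have h3 : 0 ≤ ∑ x ∈ P, (quad c x - v x) ^ 2 := Finset.sum_nonneg fun _ _ => sq_nonneg _
  linarith

lemma recoverAt_congr {S : Plane → Finset Plane} {v w : Plane → ℝ} {z : Plane}
    (h : ∀ x ∈ S z, v x = w x) : recoverAt S v z = recoverAt S w z := by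
  have : (fun c => IsFit (S z) v c) = fun c => IsFit (S z) w c := by
    funext c
    refine propext (forall_congr' fun d => ?_)
    rw [Finset.sum_congr rfl fun x hx => by rw [h x hx]]
  rw [recoverAt, recoverAt, this]

namespace Triangulation

variable {Ω : Set Plane} {T : Triangulation Ω} {R κ : ℝ} {S : Plane → Finset Plane}

lemma IsSampling.card_pos (hκ : 0 < κ) (hS : T.IsSampling R κ S) {z : Plane}
    (hz : z ∈ T.vertices) : 0 < (S z).card := by
  by_contra h
  have h0 : (S z).card = 0 := by omega
  have := hS.unisolvent z hz 1
  rw [h0] at this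
  simp at this
  linarith

lemma IsSampling.coeff_eq_zero (hκ : 0 < κ) (hS : T.IsSampling R κ S) {z : Plane}
    (hz : z ∈ T.vertices) (hd : 0 < Metric.diam (T.patch z)) (c : Fin 6 → ℝ)
    (hc : ∑ x ∈ S z, quad c x ^ 2 = 0) : c = 0 := by
  set d := Metric.diam (T.patch z) with hdd
  have h1 := hS.unisolvent z hz (rescale c z d)
  simp only [← hdd, quad_rescale c z hd.ne', hc, zero_div] at h1
  have h2 : ∀ i, rescale c z d i = 0 := by
    have h3 : ∑ i, rescale c z d i ^ 2 = 0 :=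
      le_antisymm (by by_contra! h; nlinarith) (Finset.sum_nonneg fun _ _ => sq_nonneg _)
    rw [Finset.sum_eq_zero_iff_of_nonneg fun _ _ => sq_nonneg _] at h3
    exact fun i => pow_eq_zero_iff two_ne_zero |>.mp (h3 i (Finset.mem_univ i))
  have hd2 : d ^ 2 ≠ 0 := by positivity
  have e3 : c 3 = 0 := by simpa [rescale, hd2, hd.ne'] using h2 3
  have e4 : c 4 = 0 := by simpa [rescale, hd2, hd.ne'] using h2 4
  have e5 : c 5 = 0 := by simpa [rescale, hd2, hd.ne'] using h2 5
  have e1 : c 1 = 0 := by simpa [rescale, hd.ne', quadGrad, e3, e4] using h2 1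
  have e2 : c 2 = 0 := by simpa [rescale, hd.ne', quadGrad, e5, e4] using h2 2
  have e0 : c 0 = 0 := by simpa [rescale, quad, e1, e2, e3, e4, e5] using h2 0
  funext i
  fin_cases i <;> assumption

lemma IsSampling.exists_fit (hκ : 0 < κ) (hS : T.IsSampling R κ S) {z : Plane}
    (hz : z ∈ T.vertices) (hd : 0 < Metric.diam (T.patch z)) (v : Plane → ℝ) :
    ∃ c, IsFit (S z) v c ∧ recoverAt S v z = quadGrad c z :=
  ⟨_, Classical.epsilon_spec (exists_isFit (hS.coeff_eq_zero hκ hz hd) v), rfl⟩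

/-- Projection bounds the mean square of the difference on the sampling points by `m ^ 2`, and
unisolvence bounds its scaled coefficients. The scaled linear ones are the patch diameter times the
gradient at `z`, whence the denominator. -/
lemma IsSampling.norm_recoverAt_sub_le (hκ : 0 < κ) (hS : T.IsSampling R κ S) {z : Plane}
    (hz : z ∈ T.vertices) (hd : 0 < Metric.diam (T.patch z)) {v : Plane → ℝ} {e : Fin 6 → ℝ}
    {m : ℝ} (hm : ∀ x ∈ S z, |v x - quad e x| ≤ m) :
    ‖recoverAt S v z - quadGrad e z‖ ≤ m / (√κ * Metric.diam (T.patch z)) := by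
  obtain ⟨c, hc, hrec⟩ := hS.exists_fit hκ hz hd v
  have hcard : 0 < ((S z).card : ℝ) := by exact_mod_cast hS.card_pos hκ hz
  have hm0 : 0 ≤ m := by
    obtain ⟨x, hx⟩ := Finset.card_pos.mp (hS.card_pos hκ hz)
    exact (abs_nonneg _).trans (hm x hx)
  set d := Metric.diam (T.patch z) with hdd
  have h1 := hS.unisolvent z hz (rescale (c - e) z d)
  simp only [← hdd, quad_rescale (c - e) z hd.ne'] at h1
  have h2 : (∑ x ∈ S z, quad (c - e) x ^ 2) / (S z).card ≤ m ^ 2 := by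
    rw [div_le_iff₀ hcard]
    refine (hc.sum_sq_sub_le e).trans ?_
    rw [mul_comm, ← nsmul_eq_mul]
    refine Finset.sum_le_card_nsmul _ _ _ fun x hx => ?_
    exact sq_le_sq' (by linarith [(abs_le.mp (hm x hx)).1]) (abs_le.mp (hm x hx)).2
  set g := quadGrad (c - e) z with hg
  have h3 : d ^ 2 * (g 0 ^ 2 + g 1 ^ 2) ≤ ∑ i, rescale (c - e) z d i ^ 2 := by
    simp only [Fin.sum_univ_six, rescale, Matrix.cons_val, ← hg]
    nlinarith [sq_nonneg (quad (c - e) z), sq_nonneg (d ^ 2 * (c - e) 3),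
      sq_nonneg (d ^ 2 * (c - e) 4), sq_nonneg (d ^ 2 * (c - e) 5)]
  have h4 : κ * (d ^ 2 * (g 0 ^ 2 + g 1 ^ 2)) ≤ m ^ 2 :=
    (mul_le_mul_of_nonneg_left h3 hκ.le).trans (h1.trans h2)
  rw [hrec, ← quadGrad_sub, ← hg, le_div_iff₀ (by positivity)]
  refine abs_le_of_sq_le_sq' ?_ hm0 |>.2
  rw [mul_pow, mul_pow, Real.sq_sqrt hκ.le, EuclideanSpace.norm_sq_eq, Fin.sum_univ_two]
  simp only [Real.norm_eq_abs, sq_abs]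
  linarith

/-- The fit is picked by choice, but unisolvence makes it unique, which makes the recovery linear.
-/
lemma IsSampling.recoverAt_sub (hκ : 0 < κ) (hS : T.IsSampling R κ S) {z : Plane}
    (hz : z ∈ T.vertices) (hd : 0 < Metric.diam (T.patch z)) (v w : Plane → ℝ) :
    recoverAt S (v - w) z = recoverAt S v z - recoverAt S w z := by
  obtain ⟨c1, h1, e1⟩ := hS.exists_fit hκ hz hd v
  obtain ⟨c2, h2, e2⟩ := hS.exists_fit hκ hz hd w
  obtain ⟨c3, h3, e3⟩ := hS.exists_fit hκ hz hd (v - w)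
  have h4 := h3.sub (h1.sub h2)
  rw [sub_self] at h4
  have h5 : c3 - (c1 - c2) = 0 := by
    refine hS.coeff_eq_zero hκ hz hd _ ?_
    have := h4 (c3 - (c1 - c2))
    simpa [sq] using this
  rw [e1, e2, e3, sub_eq_zero.mp h5, quadGrad_sub]

end Triangulation

/-! ### Regular meshes -/

lemma le_diam_of_closedBall_subset {s : Set Plane} (hs : Bornology.IsBounded s) {c : Plane} {ρ : ℝ}
    (hρ : 0 < ρ) (hsub : Metric.closedBall c ρ ⊆ s) : ρ ≤ Metric.diam s := by
  have h1 : c + !₂[ρ, 0] ∈ Metric.closedBall c ρ := by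
    rw [Metric.mem_closedBall, dist_eq_norm, add_sub_cancel_left]
    exact norm_vec_le _ _ _ hρ.le (by nlinarith)
  have h2 := Metric.dist_le_diam_of_mem hs (hsub h1) (hsub (Metric.mem_closedBall_self hρ.le))
  rw [dist_eq_norm, add_sub_cancel_left] at h2
  have h3 := abs_coord_le_norm (!₂[ρ, 0] : Plane) 0
  simp only [Matrix.cons_val_zero] at h3
  exact (le_abs_self ρ).trans (h3.trans h2)

lemma volume_real_tri_le (t : Finset Plane) (ht : (tri t).Nonempty) :
    volume.real (tri t) ≤ Real.pi * Metric.diam (tri t) ^ 2 := by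
  obtain ⟨z, hz⟩ := ht
  rw [← volume_real_closedBall z Metric.diam_nonneg]
  refine measureReal_mono (fun y hy => ?_) measure_closedBall_lt_top.ne
  exact Metric.mem_closedBall.mpr (Metric.dist_le_diam_of_mem (isBounded_tri t) hy hz)

lemma ae_eq_interior_tri (t : Finset Plane) : tri t =ᵐ[volume] interior (tri t) :=
  (interior_ae_eq_of_null_frontier ((convex_tri t).addHaar_frontier _)).symm

/-- The integral of `‖y‖ ^ (2α - 2)` over the unit disc. -/
def rieszConst (α : ℝ) : ℝ := ∫ y in Metric.ball (0 : Plane) 1, ‖y‖ ^ (2 * α - 2)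

lemma rieszConst_nonneg (α : ℝ) : 0 ≤ rieszConst α :=
  integral_nonneg fun _ => by positivity

/-- In polar coordinates the radial exponent is `2α - 1`, which exceeds `-1`. -/
lemma integrableOn_norm_rpow {α : ℝ} (hα : 0 < α) (r : ℝ) :
    IntegrableOn (fun y : Plane => ‖y‖ ^ (2 * α - 2)) (Metric.ball 0 r) := by
  rw [integrableOn_fun_norm_addHaar volume (f := fun y : ℝ => y ^ (2 * α - 2))]
  simp only [finrank_euclideanSpace, Fintype.card_fin, smul_eq_mul]
  rcases le_or_gt r 0 with hr | hr
  · rw [Ioo_eq_empty (by linarith)]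
    exact integrableOn_empty
  have h1 := intervalIntegral.intervalIntegrable_rpow' (a := 0) (b := r) (r := 2 * α - 1)
    (by linarith)
  rw [intervalIntegrable_iff_integrableOn_Ioo_of_le hr.le] at h1
  refine h1.congr_fun (fun y hy => ?_) measurableSet_Ioo
  have : (2 * α - 1) = (2 * α - 2) + 1 := by ring
  simp only [this]
  rw [Real.rpow_add_one hy.1.ne']
  ring

lemma setIntegral_ball_norm_rpow {α : ℝ} (x : Plane) {r : ℝ} (hr : 0 < r) :
    ∫ y in Metric.ball x r, ‖y - x‖ ^ (2 * α - 2) = r ^ (2 * α) * rieszConst α := by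
  have h1 : ∫ y in Metric.ball x r, ‖y - x‖ ^ (2 * α - 2)
      = ∫ y in Metric.ball (0 : Plane) r, ‖y‖ ^ (2 * α - 2) := by
    have hmp := measurePreserving_sub_right (volume : Measure Plane) x
    have := hmp.setIntegral_preimage_emb (MeasurableEquiv.subRight x).measurableEmbedding
      (fun y : Plane => ‖y‖ ^ (2 * α - 2)) (Metric.ball 0 r)
    rw [← this]
    congr 2
    ext y
    simp [dist_eq_norm]
  rw [h1, rieszConst]
  have h2 := Measure.setIntegral_comp_smul_of_pos (volume : Measure Plane)
    (fun y : Plane => ‖y‖ ^ (2 * α - 2)) (Metric.ball 0 1) hr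
  rw [smul_unitBall hr.ne', Real.norm_of_nonneg hr.le] at h2
  simp only [finrank_euclideanSpace, Fintype.card_fin, smul_eq_mul, norm_smul,
    Real.norm_of_nonneg hr.le, Real.mul_rpow hr.le (norm_nonneg _)] at h2
  rw [integral_const_mul, eq_inv_mul_iff_mul_eq₀ (by positivity), ← mul_assoc] at h2
  rw [← h2]
  congr 1
  rw [← Real.rpow_natCast, ← Real.rpow_add hr]
  congr 1
  push_cast
  ring

namespace Triangulation

variable {Ω : Set Plane} (T : Triangulation Ω)

lemma interior_tri_subset (hΩo : IsOpen Ω) (hΩc : Convex ℝ Ω) (hΩne : Ω.Nonempty)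
    {t : Finset Plane} (ht : t ∈ T.elems) : interior (tri t) ⊆ Ω := by
  have h1 := interior_mono (T.tri_subset_closure ht)
  rwa [hΩc.interior_closure_eq_interior_of_nonempty_interior
    (by rwa [hΩo.interior_eq]), hΩo.interior_eq] at h1

/-- Triangles agree almost everywhere with their interiors, and these are genuinely disjoint: an
open null set is empty. -/
lemma sum_setIntegral_tri_le {A : Finset (Finset Plane)} (hA : A ⊆ T.elems) {s : Set Plane}
    (hsub : ∀ t ∈ A, tri t ⊆ s) {F : Plane → ℝ} (hF : IntegrableOn F s)
    (hF0 : ∀ x, 0 ≤ F x) : ∑ t ∈ A, ∫ x in tri t, F x ≤ ∫ x in s, F x := by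
  have h1 : ∀ t ∈ A, ∫ x in tri t, F x = ∫ x in interior (tri t), F x := fun t _ =>
    setIntegral_congr_set (ae_eq_interior_tri t)
  have hsub' : ∀ t ∈ A, interior (tri t) ⊆ s := fun t ht => interior_subset.trans (hsub t ht)
  rw [Finset.sum_congr rfl h1, ← integral_biUnion_finset A
    (fun t _ => isOpen_interior.measurableSet) ?_ (fun t ht => hF.mono_set (hsub' t ht))]
  · exact setIntegral_mono_set hF (Eventually.of_forall hF0)
      (Eventually.of_forall (iUnion₂_subset hsub'))
  · intro t ht t' ht' hne
    have h2 : volume (interior (tri t) ∩ interior (tri t')) = 0 :=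
      measure_mono_null (inter_subset_inter interior_subset interior_subset)
        (T.volume_tri_inter (hA ht) (hA ht') hne)
    rw [Function.onFun, disjoint_iff_inter_eq_empty]
    exact ((isOpen_interior.inter isOpen_interior).measure_eq_zero_iff volume).mp h2

lemma diam_tri_le_meshSize {t : Finset Plane} (ht : t ∈ T.elems) :
    Metric.diam (tri t) ≤ T.meshSize :=
  le_ciSup (f := fun t : T.elems => Metric.diam (tri t)) (Set.finite_range _).bddAbove ⟨t, ht⟩

lemma tri_subset_patch {t : Finset Plane} (ht : t ∈ T.elems) {z : Plane} (hz : z ∈ t) :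
    tri t ⊆ T.patch z :=
  subset_biUnion_of_mem (u := tri) (show t ∈ {t | t ∈ T.elems ∧ z ∈ tri t} from
    ⟨ht, subset_tri t hz⟩)

lemma isBounded_patch (z : Plane) : Bornology.IsBounded (T.patch z) := by
  refine (Bornology.isBounded_biUnion ?_).mpr fun t _ => isBounded_tri t
  exact T.elems.finite_toSet.subset fun t ht => ht.1

lemma diam_tri_le_diam_patch {t : Finset Plane} (ht : t ∈ T.elems) {z : Plane} (hz : z ∈ t) :
    Metric.diam (tri t) ≤ Metric.diam (T.patch z) :=
  Metric.diam_mono (T.tri_subset_patch ht hz) (T.isBounded_patch z)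

/-- Take the largest element at `z`: every point of the patch is within its diameter of `z`. Errors
at `z` can then be charged to one element of comparable size. -/
lemma exists_diam_patch_le {z : Plane} (hz : z ∈ T.vertices) :
    ∃ t ∈ T.elems, z ∈ t ∧ Metric.diam (T.patch z) ≤ 2 * Metric.diam (tri t) := by
  classical
  obtain ⟨t0, ht0, hzt0⟩ := hz
  obtain ⟨t, ht, hmax⟩ := Finset.exists_max_image (T.elems.filter fun t => z ∈ t)
    (fun t => Metric.diam (tri t)) ⟨t0, Finset.mem_filter.mpr ⟨ht0, hzt0⟩⟩
  rw [Finset.mem_filter] at ht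
  refine ⟨t, ht.1, ht.2, Metric.diam_le_of_forall_dist_le
    (mul_nonneg zero_le_two Metric.diam_nonneg) ?_⟩
  have key : ∀ x ∈ T.patch z, dist x z ≤ Metric.diam (tri t) := by
    intro x hx
    obtain ⟨s, ⟨hs, hzs⟩, hxs⟩ := mem_iUnion₂.mp hx
    have hzs' := T.mem_of_mem_tri ht0 hs hzt0 hzs
    exact (Metric.dist_le_diam_of_mem (isBounded_tri s) hxs hzs).trans
      (hmax s (Finset.mem_filter.mpr ⟨hs, hzs'⟩))
  intro x hx y hy
  linarith [dist_triangle_right x y z, key x hx, key y hy]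

variable {T} {σ : ℝ}

lemma IsRegular.diam_pos (hreg : T.IsRegular σ) {t : Finset Plane} (ht : t ∈ T.elems) :
    0 < Metric.diam (tri t) := by
  obtain ⟨c, ρ, hρ, hsub, -⟩ := hreg t ht
  exact hρ.trans_le (le_diam_of_closedBall_subset (isBounded_tri t) hρ hsub)

lemma IsRegular.pos (hreg : T.IsRegular σ) {t : Finset Plane} (ht : t ∈ T.elems) : 0 < σ := by
  have h1 := hreg.diam_pos ht
  obtain ⟨c, ρ, hρ, -, h⟩ := hreg t ht
  by_contra! h2
  nlinarith

lemma IsRegular.volume_ge (hreg : T.IsRegular σ) {t : Finset Plane} (ht : t ∈ T.elems) :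
    Metric.diam (tri t) ^ 2 ≤ σ ^ 2 * volume.real (tri t) := by
  have hσ := hreg.pos ht
  obtain ⟨c, ρ, hρ, hsub, h⟩ := hreg t ht
  have h1 : Real.pi * ρ ^ 2 ≤ volume.real (tri t) := by
    rw [← volume_real_closedBall c hρ.le]
    exact measureReal_mono hsub (volume_tri_ne_top t)
  have h2 : ρ ^ 2 ≤ volume.real (tri t) := by nlinarith [Real.pi_gt_three, sq_nonneg ρ]
  calc Metric.diam (tri t) ^ 2 ≤ (σ * ρ) ^ 2 := by
        gcongr
    _ = σ ^ 2 * ρ ^ 2 := by ring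
    _ ≤ _ := by gcongr

open Classical in
/-- The number of elements at a vertex of a regular mesh is bounded. -/
lemma IsRegular.card_le (hreg : T.IsRegular σ) (z : Plane) :
    ((T.elems.filter fun t => z ∈ t).card : ℝ) ≤ σ ^ 2 := by
  set A := T.elems.filter fun t => z ∈ t with hA
  rcases A.eq_empty_or_nonempty with h0 | hne
  · rw [h0]
    simp [sq_nonneg]
  have hAe : A ⊆ T.elems := Finset.filter_subset _ _
  obtain ⟨t0, ht0, hmin⟩ := Finset.exists_min_image A (fun t => Metric.diam (tri t)) hne
  set r := Metric.diam (tri t0) with hr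
  have hr0 : 0 < r := hreg.diam_pos (hAe ht0)
  have hσ := hreg.pos (hAe ht0)
  -- Shrink every element towards `z` until its diameter is that of the smallest one. Its disc keeps
  -- radius at least `r / σ` and lies in the ball of radius `r`; counting areas of nonoverlapping
  -- discs gives the bound.
  have hball : ∀ t ∈ A, ∃ c : Plane, Metric.closedBall c (r / σ) ⊆ tri t ∩ Metric.closedBall z r := by
    intro t ht
    have hzt : z ∈ t := (Finset.mem_filter.mp ht).2
    obtain ⟨c, ρ, hρ, hsub, hd⟩ := hreg t (hAe ht)
    set h := Metric.diam (tri t) with hh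
    have hh0 : 0 < h := hreg.diam_pos (hAe ht)
    set s := r / h with hs
    have hs0 : 0 < s := by positivity
    have hs1 : s ≤ 1 := (div_le_one hh0).mpr (hmin t ht)
    refine ⟨z + s • (c - z), fun y hy => ?_⟩
    have hy' : z + s⁻¹ • (y - z) ∈ tri t := by
      refine hsub ?_
      rw [Metric.mem_closedBall, dist_eq_norm] at hy ⊢
      have e : z + s⁻¹ • (y - z) - c = s⁻¹ • (y - (z + s • (c - z))) := by
        rw [← sub_sub, smul_sub s⁻¹ (y - z), smul_smul, inv_mul_cancel₀ hs0.ne', one_smul]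
        abel
      rw [e, norm_smul, norm_inv, Real.norm_of_nonneg hs0.le, inv_mul_le_iff₀ hs0]
      refine hy.trans ?_
      rw [hs, div_mul_eq_mul_div, div_le_div_iff₀ hσ hh0]
      nlinarith
    have hyt : y = (1 - s) • z + s • (z + s⁻¹ • (y - z)) := by
      rw [smul_add, smul_smul, mul_inv_cancel₀ hs0.ne', one_smul, sub_smul, one_smul]
      abel
    constructor
    · rw [hyt]
      exact (convex_tri t) (subset_tri t hzt) hy' (sub_nonneg.mpr hs1) hs0.le (by ring)
    · have h1 := Metric.dist_le_diam_of_mem (isBounded_tri t) hy' (subset_tri t hzt)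
      rw [dist_eq_norm, add_sub_cancel_left, norm_smul, norm_inv, Real.norm_of_nonneg hs0.le,
        inv_mul_le_iff₀ hs0, ← hh] at h1
      rw [Metric.mem_closedBall, dist_eq_norm]
      refine h1.trans (le_of_eq ?_)
      rw [hs]
      field_simp
  set D := ⋃ t ∈ A, tri t with hD
  have h1 : ∑ t ∈ A, ∫ x in tri t, (Metric.closedBall z r).indicator (fun _ => (1 : ℝ)) x
      ≤ ∫ x in Metric.closedBall z r ∪ D,
        (Metric.closedBall z r).indicator (fun _ => (1 : ℝ)) x := by
    refine T.sum_setIntegral_tri_le hAe (fun t ht => (subset_biUnion_of_mem (u := tri)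
      (show t ∈ (A : Set (Finset Plane)) from ht)).trans subset_union_right) ?_ ?_
    · exact ((integrable_indicator_iff measurableSet_closedBall).mpr
        (integrableOn_const measure_closedBall_lt_top.ne)).integrableOn
    · exact fun x => indicator_nonneg (fun _ _ => zero_le_one) x
  have h2 : ∫ x in Metric.closedBall z r ∪ D,
      (Metric.closedBall z r).indicator (fun _ => (1 : ℝ)) x = Real.pi * r ^ 2 := by
    rw [setIntegral_indicator measurableSet_closedBall, union_inter_cancel_left, setIntegral_const,
      smul_eq_mul, mul_one, volume_real_closedBall z hr0.le]
  have h3 : ∀ t ∈ A, Real.pi * (r / σ) ^ 2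
      ≤ ∫ x in tri t, (Metric.closedBall z r).indicator (fun _ => (1 : ℝ)) x := by
    intro t ht
    obtain ⟨c, hc⟩ := hball t ht
    rw [setIntegral_indicator measurableSet_closedBall, setIntegral_const, smul_eq_mul, mul_one,
      ← volume_real_closedBall c (by positivity)]
    exact measureReal_mono hc (ne_top_of_le_ne_top (volume_tri_ne_top t)
      (measure_mono inter_subset_left))
  have h4 := Finset.card_nsmul_le_sum A _ _ h3
  rw [nsmul_eq_mul] at h4
  have h5 := h4.trans (h1.trans_eq h2)
  have h6 : (A.card : ℝ) * (Real.pi * (r / σ) ^ 2) = (A.card : ℝ) * (Real.pi * r ^ 2) / σ ^ 2 := by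
    field_simp
  rw [h6, div_le_iff₀ (by positivity)] at h5
  have hpr : 0 < Real.pi * r ^ 2 := by positivity
  nlinarith

/-- The elements whose enlargements contain a given point have summable sizes. -/
lemma IsRegular.sum_diam_rpow_le (hreg : T.IsRegular σ) {α : ℝ} (hα : 0 < α) (hα1 : α < 1)
    {K : ℝ} (hK : 0 < K) (x : Plane) {A : Finset (Finset Plane)} (hA : A ⊆ T.elems)
    (hx : ∀ t ∈ A, ∀ y ∈ tri t, dist y x ≤ K * Metric.diam (tri t)) :
    ∑ t ∈ A, Metric.diam (tri t) ^ (2 * α)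
      ≤ σ ^ 2 * K ^ (2 - 2 * α) * (2 * K) ^ (2 * α) * rieszConst α * T.meshSize ^ (2 * α) := by
  rcases A.eq_empty_or_nonempty with h0 | ⟨t0, ht0⟩
  · have hm : 0 ≤ T.meshSize := Real.iSup_nonneg fun _ => Metric.diam_nonneg
    rw [h0, Finset.sum_empty]
    have := rieszConst_nonneg α
    positivity
  have hm : 0 < T.meshSize := (hreg.diam_pos (hA ht0)).trans_le (T.diam_tri_le_meshSize (hA ht0))
  have hsub : ∀ t ∈ A, tri t ⊆ Metric.ball x (2 * K * T.meshSize) := by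
    intro t ht y hy
    rw [Metric.mem_ball]
    have h1 := hx t ht y hy
    have h2 := mul_le_mul_of_nonneg_left (T.diam_tri_le_meshSize (hA ht)) hK.le
    nlinarith [mul_pos hK hm]
  have hint : IntegrableOn (fun y : Plane => ‖y - x‖ ^ (2 * α - 2))
      (Metric.ball x (2 * K * T.meshSize)) := by
    have h1 := integrableOn_norm_rpow hα (2 * K * T.meshSize)
    have hmp := measurePreserving_sub_right (volume : Measure Plane) x
    have h2 := (hmp.integrableOn_comp_preimage
      (MeasurableEquiv.subRight x).measurableEmbedding).mpr h1
    have e : (fun y => y - x) ⁻¹' Metric.ball 0 (2 * K * T.meshSize)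
        = Metric.ball x (2 * K * T.meshSize) := by
      ext y
      simp [dist_eq_norm]
    rw [e] at h2
    exact h2
  have h1 := T.sum_setIntegral_tri_le hA hsub hint fun y => by positivity
  rw [setIntegral_ball_norm_rpow x (by positivity)] at h1
  -- The exponent `2α - 2` is negative, so the upper bound on the distance bounds the kernel below
  -- on the whole element, while regularity gives area at least `diam² / σ²`.
  have h2 : ∀ t ∈ A, Metric.diam (tri t) ^ (2 * α)
      ≤ σ ^ 2 * K ^ (2 - 2 * α) * ∫ y in tri t, ‖y - x‖ ^ (2 * α - 2) := by
    intro t ht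
    set h := Metric.diam (tri t) with hh
    have hh0 : 0 < h := hreg.diam_pos (hA ht)
    have h3 : ∫ y in tri t, (K * h) ^ (2 * α - 2) ≤ ∫ y in tri t, ‖y - x‖ ^ (2 * α - 2) := by
      refine integral_mono_ae (integrableOn_const (volume_tri_ne_top t))
        (hint.mono_set (hsub t ht)) ?_
      have hne : ∀ᵐ y ∂(volume.restrict (tri t)), y ≠ x :=
        ae_restrict_of_ae (Measure.ae_ne volume x)
      filter_upwards [ae_restrict_mem (measurableSet_tri t), hne] with y hy hyx
      refine Real.rpow_le_rpow_of_nonpos (norm_pos_iff.mpr (sub_ne_zero.mpr hyx)) ?_ (by linarith)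
      rw [← dist_eq_norm]
      exact hx t ht y hy
    rw [setIntegral_const, smul_eq_mul] at h3
    have h4 := hreg.volume_ge (hA ht)
    calc h ^ (2 * α) = h ^ 2 * h ^ (2 * α - 2) := by
          rw [← Real.rpow_natCast, ← Real.rpow_add hh0]
          congr 1
          push_cast
          ring
      _ ≤ (σ ^ 2 * volume.real (tri t)) * h ^ (2 * α - 2) := by gcongr
      _ = σ ^ 2 * K ^ (2 - 2 * α) * (volume.real (tri t) * (K * h) ^ (2 * α - 2)) := by
          have e : K ^ (2 - 2 * α) * K ^ (2 * α - 2) = 1 := by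
            rw [← Real.rpow_add hK]
            norm_num
          rw [Real.mul_rpow hK.le hh0.le]
          linear_combination -(σ ^ 2 * volume.real (tri t) * h ^ (2 * α - 2)) * e
      _ ≤ _ := by gcongr
  refine (Finset.sum_le_sum h2).trans ?_
  rw [← Finset.mul_sum]
  refine (mul_le_mul_of_nonneg_left h1 (by positivity)).trans (le_of_eq ?_)
  rw [Real.mul_rpow (by positivity) hm.le]
  ring

end Triangulation

/-! ### Local error estimates -/

lemma contract_sub_le (X Y : Matrix (Fin 2) (Fin 2) ℝ) :
    contract (X - Y) (X - Y) ≤ 2 * contract X X + 2 * contract Y Y := by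
  simp only [contract, Fin.sum_univ_two, Matrix.sub_apply]
  nlinarith [sq_nonneg (X 0 0 + Y 0 0), sq_nonneg (X 0 1 + Y 0 1), sq_nonneg (X 1 0 + Y 1 0),
    sq_nonneg (X 1 1 + Y 1 1)]

lemma integrableOn_contract_sub {H : Plane → Matrix (Fin 2) (Fin 2) ℝ} {s : Set Plane}
    (hs : volume s ≠ ⊤) (hH : ∀ i j, MemLp (fun x => H x i j) 2 (volume.restrict s))
    (M : Matrix (Fin 2) (Fin 2) ℝ) : IntegrableOn (fun x => contract (H x - M) (H x - M)) s := by
  have : IsFiniteMeasure (volume.restrict s) := ⟨by simpa using hs.lt_top⟩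
  simp only [contract, Matrix.sub_apply, ← sq]
  exact integrable_finsetSum _ fun i _ => integrable_finsetSum _ fun j _ =>
    ((hH i j).sub (memLp_const _)).integrable_sq

/-- `g` is the gradient of `u` at `z` along the homotheties with centre `z` and ratio `2⁻ᵏ`. -/
def IsPointGrad (U : Set Plane) (u : Plane → ℝ) (z g : Plane) : Prop :=
  ∀ v, z + v ∈ closure U →
    Tendsto (fun k : ℕ => (2 : ℝ) ^ k * (u (z + (1 / 2 : ℝ) ^ k • v) - u z)) atTop (𝓝 ⟪g, v⟫)

/-- The difference of the gradients is orthogonal to `x - z` for all `x` in the open set `U`; moving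
one such `x` in its own direction forces it to vanish. So gradients found on an element and on `Ω`
coincide. -/
lemma IsPointGrad.eq {U V : Set Plane} {u : Plane → ℝ} {z g g' : Plane} (hg : IsPointGrad V u z g)
    (hg' : IsPointGrad U u z g') (hUV : U ⊆ V) (hUo : IsOpen U) (hUne : U.Nonempty) : g = g' := by
  obtain ⟨y, hy⟩ := hUne
  have key : ∀ x ∈ U, ⟪g - g', x - z⟫ = 0 := by
    intro x hx
    have hx' : z + (x - z) ∈ closure U := by
      rw [add_sub_cancel]
      exact subset_closure hx
    have := tendsto_nhds_unique (hg _ (closure_mono hUV hx')) (hg' _ hx')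
    rw [inner_sub_left, this, sub_self]
  have hcont : Tendsto (fun ε : ℝ => y + ε • (g - g')) (𝓝[>] 0) (𝓝 y) := by
    have : Continuous fun ε : ℝ => y + ε • (g - g') := by fun_prop
    simpa using (this.tendsto 0).mono_left nhdsWithin_le_nhds
  obtain ⟨ε, h1, h2⟩ := ((hcont.eventually (hUo.eventually_mem hy)).and self_mem_nhdsWithin).exists
  have h3 := key _ h1
  have h4 := key _ hy
  have e : y + ε • (g - g') - z = (y - z) + ε • (g - g') := by abel
  rw [e, inner_add_right, h4, zero_add, inner_smul_right] at h3
  have h5 := (mul_eq_zero.mp h3).resolve_left (ne_of_gt h2)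
  exact sub_eq_zero.mp (inner_self_eq_zero.mp h5)

lemma quadHess_taylorCoeff (Ω : Set Plane) (u : Plane → ℝ) (p : Plane → Plane)
    {M : Matrix (Fin 2) (Fin 2) ℝ} (hM : ∀ i j, M i j = M j i) (c : Plane) (ρ : ℝ) :
    quadHess (taylorCoeff Ω u p M c ρ) = M := by
  ext i j
  fin_cases i <;> fin_cases j <;> simp [quadHess, taylorCoeff, hM 1 0] <;> ring

section

variable {Ω : Set Plane} {α : ℝ} {u : Plane → ℝ} {p : Plane → Plane}
  {H : Plane → Matrix (Fin 2) (Fin 2) ℝ}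

/-- Only existence is wanted, so any disc in `Ω` and its possibly poor chunkiness will do;
quantitative bounds come later from the elements. -/
lemma IsSobolev.exists_isPointGrad (hα : 0 < α) (hα1 : α < 1) (hΩo : IsOpen Ω)
    (hΩc : Convex ℝ Ω) (hΩb : Bornology.IsBounded Ω) (hΩne : Ω.Nonempty)
    (h : IsSobolev Ω α u p H) (hu : ContinuousOn u (closure Ω)) :
    ∃ g : Plane → Plane, ∀ z ∈ closure Ω, IsPointGrad Ω u z (g z) := by
  obtain ⟨c, hc⟩ := hΩne
  obtain ⟨ρ, hρ, hsub⟩ := Metric.nhds_basis_closedBall.mem_iff.mp (hΩo.mem_nhds hc)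
  have hex : ∀ z ∈ closure Ω, ∃ g, IsPointGrad Ω u z g := fun z hz => by
    obtain ⟨g, -, hg⟩ := exists_pointwise_gradient hα hα1 hΩo hΩb h hu hΩo hΩc subset_rfl
      (fun y hy y' hy' => Metric.dist_le_diam_of_mem hΩb hy hy') hρ
      (θ := Metric.diam Ω / ρ) (by field_simp; rfl) hsub hz
    exact ⟨g, hg⟩
  choose! g hg using hex
  exact ⟨g, hg⟩

lemma mem_closure_interior_tri {t : Finset Plane} (hne : (interior (tri t)).Nonempty) {z : Plane}
    (hz : z ∈ tri t) : z ∈ closure (interior (tri t)) := by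
  rw [(convex_tri t).closure_interior_eq_closure_of_nonempty_interior hne]
  exact subset_closure hz

lemma closedBall_half_subset_interior {s : Set Plane} {c : Plane} {ρ : ℝ} (hρ : 0 < ρ)
    (h : Metric.closedBall c ρ ⊆ s) : Metric.closedBall c (ρ / 2) ⊆ interior s :=
  (Metric.closedBall_subset_ball (by linarith)).trans
    (interior_maximal (Metric.ball_subset_closedBall.trans h) Metric.isOpen_ball)

/-- The averaged Taylor polynomial of the disc with centre `c` and radius `ρ`. -/
def discTaylor (Ω : Set Plane) (u : Plane → ℝ) (p : Plane → Plane)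
    (H : Plane → Matrix (Fin 2) (Fin 2) ℝ) (c : Plane) (ρ : ℝ) : Fin 6 → ℝ :=
  taylorCoeff Ω u p (discMean H c ρ) c ρ

lemma IsSobolev.mono_slobodeckij (h : IsSobolev Ω α u p H) {U : Set Plane} (hU : U ⊆ Ω) :
    Integrable (slobodeckij α H) ((volume.restrict U).prod (volume.restrict U)) :=
  h.integrable_slobodeckij.mono_measure
    (Measure.prod_mono (Measure.restrict_mono_set _ hU) (Measure.restrict_mono_set _ hU))

variable {T : Triangulation Ω} {σ : ℝ}

/-- The estimate is applied on the interior of the element, with the disc halved so that its closure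
fits; this doubles the chunkiness. Uniqueness identifies the gradient found there with `g`. -/
lemma norm_sub_quadGrad_le (hα : 0 < α) (hα1 : α < 1) (hΩo : IsOpen Ω)
    (hΩc : Convex ℝ Ω) (hΩb : Bornology.IsBounded Ω) (hΩne : Ω.Nonempty)
    (h : IsSobolev Ω α u p H) (hu : ContinuousOn u (closure Ω))
    {t : Finset Plane} (ht : t ∈ T.elems) {c : Plane} {ρ : ℝ} (hρ : 0 < ρ)
    (hsub : Metric.closedBall c ρ ⊆ tri t) (hd : Metric.diam (tri t) ≤ σ * ρ) {z g : Plane}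
    (hz : z ∈ t) (hg : IsPointGrad Ω u z g) :
    ‖g - quadGrad (discTaylor Ω u p H c (ρ / 2)) z‖ ≤ gradConst α (2 * σ) *
      (Metric.diam (tri t) ^ α * √(slobSq α H (interior (tri t)))) := by
  have hball := closedBall_half_subset_interior hρ hsub
  have hne : (interior (tri t)).Nonempty :=
    ⟨c, hball (Metric.mem_closedBall_self (by positivity))⟩
  have hsubΩ := T.interior_tri_subset hΩo hΩc hΩne ht
  obtain ⟨g', hg'1, hg'2⟩ := exists_pointwise_gradient hα hα1 hΩo hΩb h hu isOpen_interior
    (convex_tri t).interior hsubΩ (L := Metric.diam (tri t)) (θ := 2 * σ)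
    (fun y hy y' hy' => Metric.dist_le_diam_of_mem (isBounded_tri t) (interior_subset hy)
      (interior_subset hy')) (half_pos hρ) (by linarith) hball
    (mem_closure_interior_tri hne (subset_tri t hz))
  rw [hg.eq hg'2 hsubΩ isOpen_interior hne]
  exact hg'1

lemma volume_mul_contract_nodalGrad_le {t : Finset Plane} (ht : t ∈ T.elems) {c : Plane} {ρ : ℝ}
    (hρ : 0 < ρ) (hsub : Metric.closedBall c ρ ⊆ tri t) (hd : Metric.diam (tri t) ≤ σ * ρ)
    {f : Plane → Plane} {m : ℝ} (hf : ∀ z ∈ t, ‖f z‖ ≤ m) :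
    volume.real (tri t) * contract (nodalGrad t f) (nodalGrad t f) ≤ 16 * σ ^ 2 * m ^ 2 := by
  have h1 := (T.isTriangle ht).contract_nodalGrad_le hf hρ hsub
  have h2 := volume_real_tri_le t ⟨c, hsub (Metric.mem_closedBall_self hρ.le)⟩
  have h3 : Metric.diam (tri t) ^ 2 ≤ (σ * ρ) ^ 2 := pow_le_pow_left₀ Metric.diam_nonneg hd 2
  calc volume.real (tri t) * contract (nodalGrad t f) (nodalGrad t f)
      ≤ (4 * (σ * ρ) ^ 2) * (4 * (m / ρ) ^ 2) := by
        refine mul_le_mul (h2.trans ?_) h1 (contract_self_nonneg _) (by positivity)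
        exact mul_le_mul Real.pi_le_four h3 (by positivity) (by norm_num)
    _ = _ := by field_simp; ring

/-- The error of the nodal interpolant of the gradient on one element. -/
lemma integral_contract_sub_nodalGrad_le (hα : 0 < α) (hα1 : α < 1) (hΩo : IsOpen Ω)
    (hΩc : Convex ℝ Ω) (hΩb : Bornology.IsBounded Ω) (hΩne : Ω.Nonempty)
    (h : IsSobolev Ω α u p H) (hu : ContinuousOn u (closure Ω))
    {t : Finset Plane} (ht : t ∈ T.elems) {c : Plane} {ρ : ℝ} (hρ : 0 < ρ)
    (hsub : Metric.closedBall c ρ ⊆ tri t) (hd : Metric.diam (tri t) ≤ σ * ρ)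
    {g : Plane → Plane} (hg : ∀ z ∈ t, IsPointGrad Ω u z (g z)) :
    ∫ x in tri t, contract (H x - nodalGrad t g) (H x - nodalGrad t g)
      ≤ (8 + 32 * gradConst α (2 * σ) ^ 2) * σ ^ 2 *
        (Metric.diam (tri t) ^ (2 * α) * slobSq α H (interior (tri t))) := by
  have hT := T.isTriangle ht
  have hball := closedBall_half_subset_interior hρ hsub
  have hsubΩ := T.interior_tri_subset hΩo hΩc hΩne ht
  have hfin : volume Ω ≠ ⊤ := hΩb.measure_lt_top.ne
  set U := interior (tri t) with hU
  have hUfin : volume U ≠ ⊤ := ne_top_of_le_ne_top hfin (measure_mono hsubΩ)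
  have hHU : ∀ i j, MemLp (fun x => H x i j) 2 (volume.restrict U) := fun i j =>
    (h.memLp_hess i j).mono_measure (Measure.restrict_mono_set _ hsubΩ)
  set D := Metric.diam (tri t) with hD
  have hDρ : ρ ≤ D := le_diam_of_closedBall_subset (isBounded_tri t) hρ hsub
  have hD0 : 0 < D := hρ.trans_le hDρ
  have hσ : 0 < σ := by
    by_contra! h2
    nlinarith
  set e := discTaylor Ω u p H c (ρ / 2) with he
  set M := discMean H c (ρ / 2) with hM
  have hMs : ∀ i j, M i j = M j i :=
    discMean_symm (hball.trans hsubΩ) (fun i j => h.hess_symm hΩo hfin i j)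
  have hess : nodalGrad t (quadGrad e) = M := by
    rw [hT.nodalGrad_quadGrad, he, discTaylor, quadHess_taylorCoeff Ω u p hMs]
  set Y := nodalGrad t (fun z => g z - quadGrad e z) with hY
  -- The Taylor polynomial has Hessian exactly `M`, so the error splits into the oscillation of `H`
  -- about its mean and the nodal deviation of the gradients.
  have hYeq : nodalGrad t g = M + Y := by
    rw [hY, hT.nodalGrad_sub, hess]
    abel
  have hN := slobSq_nonneg α H U
  have hY2 : volume.real (tri t) * contract Y Y
      ≤ 16 * σ ^ 2 * (gradConst α (2 * σ) * (D ^ α * √(slobSq α H U))) ^ 2 :=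
    volume_mul_contract_nodalGrad_le ht hρ hsub hd fun z hz =>
      norm_sub_quadGrad_le hα hα1 hΩo hΩc hΩb hΩne h hu ht hρ hsub hd hz (hg z hz)
  have hpow : (D ^ α) ^ 2 = D ^ (2 * α) := by
    rw [← Real.rpow_natCast, ← Real.rpow_mul hD0.le]
    congr 1
    push_cast
    ring
  have hvol : volume.real U = volume.real (tri t) :=
    (measureReal_congr (ae_eq_interior_tri t)).symm
  have hX := integral_contract_sub_discMean_le hα isOpen_interior.measurableSet hUfin hHU
    (h.mono_slobodeckij hsubΩ) (L := D) (fun y hy y' hy' => Metric.dist_le_diam_of_mem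
      (isBounded_tri t) (interior_subset hy) (interior_subset hy')) (half_pos hρ) hball
  have hX2 : D ^ (2 + 2 * α) * (Real.pi * (ρ / 2) ^ 2)⁻¹ * slobSq α H U
      ≤ 4 * σ ^ 2 * (D ^ (2 * α) * slobSq α H U) := by
    rw [Real.rpow_add hD0, ← mul_assoc (4 * σ ^ 2)]
    refine mul_le_mul_of_nonneg_right ?_ hN
    rw [mul_comm (D ^ (2 : ℝ)), mul_assoc, mul_comm]
    refine mul_le_mul_of_nonneg_right ?_ (by positivity)
    rw [mul_inv_le_iff₀ (by positivity), Real.rpow_two]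
    have h3 : D ^ 2 ≤ (σ * ρ) ^ 2 := pow_le_pow_left₀ hD0.le hd 2
    have h4 : 0 ≤ (σ * ρ) ^ 2 := by positivity
    nlinarith [Real.pi_gt_three]
  calc ∫ x in tri t, contract (H x - nodalGrad t g) (H x - nodalGrad t g)
      = ∫ x in U, contract (H x - nodalGrad t g) (H x - nodalGrad t g) :=
        setIntegral_congr_set (ae_eq_interior_tri t)
    _ ≤ ∫ x in U, (2 * contract (H x - M) (H x - M) + 2 * contract Y Y) := by
        refine integral_mono (integrableOn_contract_sub hUfin hHU _)
          (((integrableOn_contract_sub hUfin hHU _).const_mul 2).add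
            (integrableOn_const hUfin)) fun x => ?_
        have e1 : H x - nodalGrad t g = (H x - M) - Y := by
          rw [hYeq]
          abel
        simp only [e1]
        exact contract_sub_le _ _
    _ = 2 * (∫ x in U, contract (H x - M) (H x - M))
        + 2 * (volume.real (tri t) * contract Y Y) := by
        rw [integral_add ((integrableOn_contract_sub hUfin hHU _).const_mul 2)
          (integrableOn_const hUfin), integral_const_mul, setIntegral_const, smul_eq_mul, hvol]
        ring
    _ ≤ 2 * (4 * σ ^ 2 * (D ^ (2 * α) * slobSq α H U))
        + 2 * (16 * σ ^ 2 * (gradConst α (2 * σ) * (D ^ α * √(slobSq α H U))) ^ 2) := by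
        linarith
    _ = _ := by
        rw [mul_pow, mul_pow, hpow, Real.sq_sqrt hN]
        ring

/-- The constant of the estimate of the recovered gradient at a vertex. -/
def recoveryConst (α σ R κ : ℝ) : ℝ :=
  8 * bumpBound * (8 * (|R| + 1) * σ) ^ 2 * (4 * (|R| + 1)) ^ (1 + α) / √κ
    + gradConst α (2 * σ)

lemma gradConst_nonneg (hα : 0 < α) {θ : ℝ} (hθ : 0 ≤ θ) : 0 ≤ gradConst α θ := by
  have h1 := bumpBound_nonneg
  have h2 : (1 / 2 : ℝ) ^ α < 1 := Real.rpow_lt_one (by norm_num) (by norm_num) hα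
  have h3 : 0 ≤ 1 - (1 / 2 : ℝ) ^ α := by linarith
  unfold gradConst
  positivity

/-- The recovered gradient at a vertex approximates the gradient. -/
lemma norm_recoverAt_sub_le_of_mem (hα : 0 < α) (hα1 : α < 1) (hΩo : IsOpen Ω)
    (hΩc : Convex ℝ Ω) (hΩb : Bornology.IsBounded Ω) (hΩne : Ω.Nonempty)
    (h : IsSobolev Ω α u p H) (hu : ContinuousOn u (closure Ω)) {R κ : ℝ} (hκ : 0 < κ)
    {S : Plane → Finset Plane} (hS : T.IsSampling R κ S)
    {t : Finset Plane} (ht : t ∈ T.elems) {c : Plane} {ρ : ℝ} (hρ : 0 < ρ)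
    (hsub : Metric.closedBall c ρ ⊆ tri t) (hd : Metric.diam (tri t) ≤ σ * ρ) {z g : Plane}
    (hz : z ∈ t) (hdz : Metric.diam (T.patch z) ≤ 2 * Metric.diam (tri t))
    (hg : IsPointGrad Ω u z g) :
    ‖recoverAt S u z - g‖ ≤ recoveryConst α σ R κ * (Metric.diam (tri t) ^ α *
      √(slobSq α H (Ω ∩ Metric.ball c (2 * (|R| + 1) * Metric.diam (tri t))))) := by
  have hK0 := bumpBound_nonneg
  set D := Metric.diam (tri t) with hD
  have hDρ : ρ ≤ D := le_diam_of_closedBall_subset (isBounded_tri t) hρ hsub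
  have hD0 : 0 < D := hρ.trans_le hDρ
  have hσ : 0 < σ := by
    by_contra! h2
    nlinarith
  have hRn := abs_nonneg R
  set K := 2 * (|R| + 1) with hK
  have hK2 : 2 ≤ K := by linarith
  set U := Ω ∩ Metric.ball c (K * D) with hU
  have hUΩ : U ⊆ Ω := inter_subset_left
  have hUo : IsOpen U := hΩo.inter Metric.isOpen_ball
  have hUc : Convex ℝ U := hΩc.inter (convex_ball _ _)
  have hball := closedBall_half_subset_interior hρ hsub
  have hsubΩ := T.interior_tri_subset hΩo hΩc hΩne ht
  have hct : c ∈ tri t := hsub (Metric.mem_closedBall_self hρ.le)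
  have htriball : tri t ⊆ Metric.ball c (K * D) := fun y hy => by
    have := Metric.dist_le_diam_of_mem (isBounded_tri t) hy hct
    rw [Metric.mem_ball]
    nlinarith
  have hballU : Metric.closedBall c (ρ / 2) ⊆ U := fun y hy =>
    ⟨hsubΩ (hball hy), htriball (interior_subset (hball hy))⟩
  set e := discTaylor Ω u p H c (ρ / 2) with he
  set N := √(slobSq α H U) with hN
  have hN0 : 0 ≤ N := Real.sqrt_nonneg _
  have hgrad : ‖g - quadGrad e z‖ ≤ gradConst α (2 * σ) * (D ^ α * N) := by
    refine (norm_sub_quadGrad_le hα hα1 hΩo hΩc hΩb hΩne h hu ht hρ hsub hd hz hg).trans ?_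
    refine mul_le_mul_of_nonneg_left ?_ (gradConst_nonneg hα (by positivity))
    refine mul_le_mul_of_nonneg_left (Real.sqrt_le_sqrt ?_) (by positivity)
    exact slobSq_mono (fun y hy => ⟨hsubΩ hy, htriball (interior_subset hy)⟩)
      (h.mono_slobodeckij hUΩ)
  have hzv : z ∈ T.vertices := ⟨t, ht, hz⟩
  have hDd : D ≤ Metric.diam (T.patch z) := T.diam_tri_le_diam_patch ht hz
  -- Sampling points lie within `2 |R| D` of `z`, hence inside the ball of radius `2 (|R| + 1) D`
  -- about `c`. Its intersection with `Ω` is convex and contains the element's disc, so one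
  -- polynomial serves all of them and the gradient as well.
  have hm : ∀ x ∈ S z, |u x - quad e x|
      ≤ 8 * bumpBound * (8 * (|R| + 1) * σ) ^ 2 * ((4 * (|R| + 1)) ^ (1 + α) * (D * D ^ α) * N) := by
    intro x hx
    have hxΩ : x ∈ closure Ω := by
      obtain ⟨s, hs, hxs⟩ := hS.subset z hzv x hx
      exact T.tri_subset_closure hs (subset_tri s hxs)
    have hxball : x ∈ Metric.ball c (K * D) := by
      have h1 := hS.dist_le z hzv x hx
      have h2 := Metric.dist_le_diam_of_mem (isBounded_tri t) (subset_tri t hz) hct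
      have h3 : R * Metric.diam (T.patch z) ≤ |R| * (2 * D) :=
        mul_le_mul (le_abs_self R) hdz Metric.diam_nonneg hRn
      rw [Metric.mem_ball]
      nlinarith [dist_triangle x z c]
    have key := abs_sub_quad_taylorCoeff_le hα hΩo hΩb h hu hUo hUc hUΩ (L := 2 * K * D)
      (fun y hy y' hy' => by
        have h1 := Metric.mem_ball.mp hy.2
        have h2 := Metric.mem_ball.mp hy'.2
        linarith [dist_triangle_right y y' c]) (half_pos hρ) hballU
      (Metric.isOpen_ball.closure_inter ⟨hxΩ, hxball⟩)
    refine key.trans ?_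
    have e1 : 2 * K * D / (ρ / 2) ≤ 8 * (|R| + 1) * σ := by
      rw [div_le_iff₀ (by positivity), hK]
      nlinarith
    have e2 : (2 * K * D) ^ (1 + α) = (4 * (|R| + 1)) ^ (1 + α) * (D * D ^ α) := by
      have : 2 * K = 4 * (|R| + 1) := by rw [hK]; ring
      rw [this, Real.mul_rpow (by positivity) hD0.le, Real.rpow_add hD0, Real.rpow_one]
    rw [e2]
    gcongr
  have hrec := hS.norm_recoverAt_sub_le hκ hzv (hD0.trans_le hDd) hm
  have hsκ : 0 < √κ := Real.sqrt_pos.mpr hκ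
  have hrec2 : ‖recoverAt S u z - quadGrad e z‖
      ≤ 8 * bumpBound * (8 * (|R| + 1) * σ) ^ 2 * (4 * (|R| + 1)) ^ (1 + α) / √κ * (D ^ α * N) := by
    refine hrec.trans ?_
    refine (div_le_div_of_nonneg_left (by positivity) (by positivity)
      (mul_le_mul_of_nonneg_left hDd hsκ.le)).trans (le_of_eq ?_)
    field_simp
  have e3 : recoverAt S u z - g = (recoverAt S u z - quadGrad e z) - (g - quadGrad e z) := by abel
  rw [e3, recoveryConst, add_mul]
  exact (norm_sub_le _ _).trans (add_le_add hrec2 hgrad)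

end

/-! ### Summation over the mesh -/

lemma rpow_two_mul {x : ℝ} (hx : 0 ≤ x) (α : ℝ) : x ^ (2 * α) = (x ^ α) ^ 2 := by
  rw [mul_comm, Real.rpow_mul hx]
  norm_num

/-- The constant of the overlap estimate for neighbourhoods of relative size `K`. -/
def overlapConst (α σ K : ℝ) : ℝ :=
  σ ^ 2 * K ^ (2 - 2 * α) * (2 * K) ^ (2 * α) * rieszConst α

section

variable {Ω : Set Plane} {α : ℝ} {u : Plane → ℝ} {p : Plane → Plane}
  {H : Plane → Matrix (Fin 2) (Fin 2) ℝ} {T : Triangulation Ω} {σ : ℝ}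

lemma slobSq_eq_integral_indicator {W : Set Plane} (hW : W ⊆ Ω) (hWm : MeasurableSet W) :
    slobSq α H W = ∫ xy, (W ×ˢ W).indicator (slobodeckij α H) xy
      ∂((volume.restrict Ω).prod (volume.restrict Ω)) := by
  rw [integral_indicator (hWm.prod hWm), ← Measure.prod_restrict,
    Measure.restrict_restrict_of_subset hW]
  rfl

-- Exchange sum and double integral: at a pair of points only elements whose set contains the first
-- point contribute, and their weights have a bounded sum by the overlap estimate.
open Classical in
lemma IsSobolev.sum_slobSq_le (hα : 0 < α) (hα1 : α < 1) (h : IsSobolev Ω α u p H)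
    (hreg : T.IsRegular σ) {K : ℝ} (hK : 0 < K) {W : Finset Plane → Set Plane}
    (hW : ∀ t ∈ T.elems, W t ⊆ Ω) (hWm : ∀ t ∈ T.elems, MeasurableSet (W t))
    (hdist : ∀ t ∈ T.elems, ∀ x ∈ W t, ∀ y ∈ tri t, dist y x ≤ K * Metric.diam (tri t)) :
    ∑ t ∈ T.elems, Metric.diam (tri t) ^ (2 * α) * slobSq α H (W t)
      ≤ overlapConst α σ K * T.meshSize ^ (2 * α) * slobSq α H Ω := by
  set μ := (volume.restrict Ω).prod (volume.restrict Ω) with hμ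
  have hint := h.integrable_slobodeckij
  have hi : ∀ t ∈ T.elems, Integrable (fun xy => Metric.diam (tri t) ^ (2 * α) *
      (W t ×ˢ W t).indicator (slobodeckij α H) xy) μ := fun t ht =>
    (hint.indicator ((hWm t ht).prod (hWm t ht))).const_mul _
  calc ∑ t ∈ T.elems, Metric.diam (tri t) ^ (2 * α) * slobSq α H (W t)
      = ∑ t ∈ T.elems, ∫ xy, Metric.diam (tri t) ^ (2 * α) *
          (W t ×ˢ W t).indicator (slobodeckij α H) xy ∂μ := by
        refine Finset.sum_congr rfl fun t ht => ?_
        rw [slobSq_eq_integral_indicator (hW t ht) (hWm t ht), integral_const_mul]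
    _ = ∫ xy, ∑ t ∈ T.elems, Metric.diam (tri t) ^ (2 * α) *
          (W t ×ˢ W t).indicator (slobodeckij α H) xy ∂μ := (integral_finsetSum _ hi).symm
    _ ≤ ∫ xy, overlapConst α σ K * T.meshSize ^ (2 * α) * slobodeckij α H xy ∂μ := by
        refine integral_mono (integrable_finsetSum _ hi) (hint.const_mul _) fun xy => ?_
        have h0 := slobodeckij_nonneg α H xy
        have h1 := hreg.sum_diam_rpow_le hα hα1 hK xy.1 (A := T.elems.filter (xy.1 ∈ W ·))
          (Finset.filter_subset _ _) fun t ht => by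
            rw [Finset.mem_filter] at ht
            exact hdist t ht.1 _ ht.2
        refine le_trans ?_ (mul_le_mul_of_nonneg_right h1 h0)
        rw [Finset.sum_mul, Finset.sum_filter]
        refine Finset.sum_le_sum fun t _ => ?_
        split_ifs with hx
        · refine mul_le_mul_of_nonneg_left ?_ (Real.rpow_nonneg Metric.diam_nonneg _)
          exact indicator_le_self' (fun _ _ => h0) _
        · rw [indicator_of_notMem (fun hm => hx hm.1), mul_zero]
    _ = _ := by rw [integral_const_mul]; rfl

/-- The relative size of the neighbourhoods that carry the recovery error. -/
def reach (R : ℝ) : ℝ := 2 * (|R| + 1) + 1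

lemma reach_pos (R : ℝ) : 0 < reach R := by
  unfold reach
  positivity

lemma IsSobolev.sum_slobSq_ball_le (hα : 0 < α) (hα1 : α < 1) (hΩo : IsOpen Ω)
    (h : IsSobolev Ω α u p H) (hreg : T.IsRegular σ) (R : ℝ) {c : Finset Plane → Plane}
    (hc : ∀ t ∈ T.elems, c t ∈ tri t) :
    ∑ t ∈ T.elems, Metric.diam (tri t) ^ (2 * α) *
        slobSq α H (Ω ∩ Metric.ball (c t) (2 * (|R| + 1) * Metric.diam (tri t)))
      ≤ overlapConst α σ (reach R) * T.meshSize ^ (2 * α) * slobSq α H Ω := by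
  refine h.sum_slobSq_le hα hα1 hreg (reach_pos R) (fun _ _ => inter_subset_left)
    (fun _ _ => hΩo.measurableSet.inter measurableSet_ball) fun t ht x hx y hy => ?_
  have h1 : dist y (c t) ≤ Metric.diam (tri t) :=
    Metric.dist_le_diam_of_mem (isBounded_tri t) hy (hc t ht)
  have h2 := Metric.mem_ball'.mp hx.2
  have h3 := dist_triangle y (c t) x
  unfold reach
  linarith

/-- The constant in the error estimate for the nodal interpolant of the gradient. -/
def interpConst (α σ R : ℝ) : ℝ :=
  (8 + 32 * gradConst α (2 * σ) ^ 2) * σ ^ 2 * overlapConst α σ (reach R)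

lemma IsSobolev.sum_integral_sub_nodalGrad_le (hα : 0 < α) (hα1 : α < 1) (hΩo : IsOpen Ω)
    (hΩc : Convex ℝ Ω) (hΩb : Bornology.IsBounded Ω) (hΩne : Ω.Nonempty)
    (h : IsSobolev Ω α u p H) (hu : ContinuousOn u (closure Ω)) (hreg : T.IsRegular σ) (R : ℝ)
    {g : Plane → Plane} (hg : ∀ z ∈ closure Ω, IsPointGrad Ω u z (g z)) :
    ∑ t ∈ T.elems, ∫ x in tri t, contract (H x - nodalGrad t g) (H x - nodalGrad t g)
      ≤ interpConst α σ R * (T.meshSize ^ (2 * α) * slobSq α H Ω) := by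
  have hreg' := hreg
  choose! c ρ hρ hsub hd using hreg'
  have hc : ∀ t ∈ T.elems, c t ∈ tri t := fun t ht =>
    hsub t ht (Metric.mem_closedBall_self (hρ t ht).le)
  have hsum := h.sum_slobSq_ball_le hα hα1 hΩo hreg R hc
  have hk : 0 ≤ (8 + 32 * gradConst α (2 * σ) ^ 2) * σ ^ 2 := by positivity
  calc _ ≤ ∑ t ∈ T.elems, (8 + 32 * gradConst α (2 * σ) ^ 2) * σ ^ 2 *
        (Metric.diam (tri t) ^ (2 * α) *
          slobSq α H (Ω ∩ Metric.ball (c t) (2 * (|R| + 1) * Metric.diam (tri t)))) := by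
        refine Finset.sum_le_sum fun t ht => ?_
        refine (integral_contract_sub_nodalGrad_le hα hα1 hΩo hΩc hΩb hΩne h hu ht (hρ t ht)
          (hsub t ht) (hd t ht) fun z hz => hg z (T.tri_subset_closure ht (subset_tri t hz))).trans ?_
        refine mul_le_mul_of_nonneg_left (mul_le_mul_of_nonneg_left ?_
          (Real.rpow_nonneg Metric.diam_nonneg _)) hk
        have hpos := hreg.diam_pos ht
        refine slobSq_mono (fun x hx => ⟨T.interior_tri_subset hΩo hΩc hΩne ht hx, ?_⟩)
          (h.mono_slobodeckij inter_subset_left)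
        have h1 := Metric.dist_le_diam_of_mem (isBounded_tri t) (interior_subset hx) (hc t ht)
        rw [Metric.mem_ball]
        nlinarith [mul_nonneg (abs_nonneg R) hpos.le]
    _ ≤ (8 + 32 * gradConst α (2 * σ) ^ 2) * σ ^ 2 *
        (overlapConst α σ (reach R) * T.meshSize ^ (2 * α) * slobSq α H Ω) := by
        rw [← Finset.mul_sum]
        exact mul_le_mul_of_nonneg_left hsum hk
    _ = _ := by unfold interpConst; ring

/-- The constant in the error estimate for the recovery of the gradient of the interpolant. -/
def recoveryErrorConst (α σ R κ : ℝ) : ℝ :=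
  48 * σ ^ 4 * recoveryConst α σ R κ ^ 2 * overlapConst α σ (reach R)

-- Inverse estimates reduce the mesh sum to errors at vertices, each charged to one element. The
-- constant collects `16 σ²` from the inverse estimate, `σ²` for elements per vertex and `3` for
-- vertices per element.
open Classical in
lemma IsSobolev.sum_volume_mul_sub_DG_le (hα : 0 < α) (hα1 : α < 1) (hΩo : IsOpen Ω)
    (hΩc : Convex ℝ Ω) (hΩb : Bornology.IsBounded Ω) (hΩne : Ω.Nonempty)
    (h : IsSobolev Ω α u p H) (hu : ContinuousOn u (closure Ω)) (hreg : T.IsRegular σ)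
    {R κ : ℝ} (hκ : 0 < κ) {S : Plane → Finset Plane} (hS : T.IsSampling R κ S)
    {g : Plane → Plane} (hg : ∀ z ∈ closure Ω, IsPointGrad Ω u z (g z)) :
    ∑ t ∈ T.elems, volume.real (tri t) * contract (DG S (T.interp u) t - nodalGrad t g)
        (DG S (T.interp u) t - nodalGrad t g)
      ≤ recoveryErrorConst α σ R κ * (T.meshSize ^ (2 * α) * slobSq α H Ω) := by
  have hreg' := hreg
  choose! c ρ hρ hsub hd using hreg'
  have hc : ∀ t ∈ T.elems, c t ∈ tri t := fun t ht =>
    hsub t ht (Metric.mem_closedBall_self (hρ t ht).le)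
  have hsum := h.sum_slobSq_ball_le hα hα1 hΩo hreg R hc
  set b : Finset Plane → ℝ := fun t => Metric.diam (tri t) ^ (2 * α) *
    slobSq α H (Ω ∩ Metric.ball (c t) (2 * (|R| + 1) * Metric.diam (tri t))) with hb
  have hb0 : ∀ t, 0 ≤ b t := fun t =>
    mul_nonneg (Real.rpow_nonneg Metric.diam_nonneg _) (slobSq_nonneg _ _ _)
  set w : Plane → Plane := fun z => recoverAt S (T.interp u) z - g z with hw
  set Z : Finset Plane := T.elems.biUnion id with hZ
  have hvert : ∀ z ∈ Z, z ∈ T.vertices := fun z hz => by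
    obtain ⟨t, ht, hzt⟩ := Finset.mem_biUnion.mp hz
    exact ⟨t, ht, hzt⟩
  -- The recovery sees only values at mesh vertices, where `u` and its interpolant agree, so the
  -- estimate for `u` itself applies.
  have hnode : ∀ z ∈ Z, ∃ t ∈ T.elems, z ∈ t ∧ ‖w z‖ ^ 2 ≤ recoveryConst α σ R κ ^ 2 * b t := by
    intro z hz
    have hzv := hvert z hz
    obtain ⟨t, ht, hzt, hdz⟩ := T.exists_diam_patch_le hzv
    refine ⟨t, ht, hzt, ?_⟩
    have h1 := norm_recoverAt_sub_le_of_mem hα hα1 hΩo hΩc hΩb hΩne h hu hκ hS ht (hρ t ht)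
      (hsub t ht) (hd t ht) hzt hdz (hg z (T.tri_subset_closure ht (subset_tri t hzt)))
    have e : recoverAt S u z = recoverAt S (T.interp u) z :=
      recoverAt_congr fun x hx => (T.interp_vertex u (hS.subset z hzv x hx)).symm
    rw [e] at h1
    refine (pow_le_pow_left₀ (norm_nonneg _) h1 2).trans (le_of_eq ?_)
    rw [mul_pow, mul_pow, Real.sq_sqrt (slobSq_nonneg _ _ _), ← rpow_two_mul Metric.diam_nonneg]
  choose! τ hτ hzτ hwτ using hnode
  have hvol : ∀ t ∈ T.elems, volume.real (tri t) *
      contract (DG S (T.interp u) t - nodalGrad t g) (DG S (T.interp u) t - nodalGrad t g)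
      ≤ 16 * σ ^ 2 * ∑ z ∈ t, ‖w z‖ ^ 2 := by
    intro t ht
    have e : DG S (T.interp u) t - nodalGrad t g = nodalGrad t w := by
      rw [DG_eq_nodalGrad, hw, (T.isTriangle ht).nodalGrad_sub]
    have h1 := volume_mul_contract_nodalGrad_le ht (hρ t ht) (hsub t ht) (hd t ht) (f := w)
      (m := √(∑ z ∈ t, ‖w z‖ ^ 2)) fun z hz => Real.le_sqrt_of_sq_le
        (Finset.single_le_sum (f := fun z => ‖w z‖ ^ 2) (fun _ _ => sq_nonneg _) hz)
    rwa [Real.sq_sqrt (Finset.sum_nonneg fun _ _ => sq_nonneg _), ← e] at h1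
  have hswap : ∑ t ∈ T.elems, ∑ z ∈ t, ‖w z‖ ^ 2 ≤ σ ^ 2 * ∑ z ∈ Z, ‖w z‖ ^ 2 := by
    have e : ∑ t ∈ T.elems, ∑ z ∈ t, ‖w z‖ ^ 2
        = ∑ z ∈ Z, ∑ t ∈ T.elems.filter (z ∈ ·), ‖w z‖ ^ 2 := by
      refine Finset.sum_comm' fun t z => ?_
      simp only [hZ, Finset.mem_filter, Finset.mem_biUnion, id]
      exact ⟨fun hh => ⟨hh, t, hh⟩, fun hh => hh.1⟩
    rw [e, Finset.mul_sum]
    refine Finset.sum_le_sum fun z _ => ?_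
    rw [Finset.sum_const, nsmul_eq_mul]
    exact mul_le_mul_of_nonneg_right (hreg.card_le z) (sq_nonneg _)
  have hfiber : ∑ z ∈ Z, b (τ z) ≤ 3 * ∑ t ∈ T.elems, b t := by
    rw [← Finset.sum_fiberwise_of_maps_to (g := τ) hτ, Finset.mul_sum]
    refine Finset.sum_le_sum fun t ht => ?_
    rw [Finset.sum_congr rfl (g := fun _ => b t) fun z hz => by rw [(Finset.mem_filter.mp hz).2],
      Finset.sum_const, nsmul_eq_mul]
    refine mul_le_mul_of_nonneg_right ?_ (hb0 t)
    have hcard : (Z.filter (τ · = t)).card ≤ t.card := Finset.card_le_card fun z hz => by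
      obtain ⟨h1, h2⟩ := Finset.mem_filter.mp hz
      exact h2 ▸ hzτ z h1
    rw [T.card_eq t ht] at hcard
    exact_mod_cast hcard
  calc _ ≤ ∑ t ∈ T.elems, 16 * σ ^ 2 * ∑ z ∈ t, ‖w z‖ ^ 2 := Finset.sum_le_sum hvol
    _ ≤ 16 * σ ^ 2 * (σ ^ 2 * ∑ z ∈ Z, ‖w z‖ ^ 2) := by
        rw [← Finset.mul_sum]
        exact mul_le_mul_of_nonneg_left hswap (by positivity)
    _ ≤ 16 * σ ^ 2 * (σ ^ 2 * (recoveryConst α σ R κ ^ 2 * (3 * ∑ t ∈ T.elems, b t))) := by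
        gcongr
        refine (Finset.sum_le_sum hwτ).trans ?_
        rw [← Finset.mul_sum]
        exact mul_le_mul_of_nonneg_left hfiber (by positivity)
    _ ≤ 16 * σ ^ 2 * (σ ^ 2 * (recoveryConst α σ R κ ^ 2 *
          (3 * (overlapConst α σ (reach R) * T.meshSize ^ (2 * α) * slobSq α H Ω)))) := by
        gcongr
    _ = _ := by unfold recoveryErrorConst; ring

end

/-! ### The coefficient tensor -/

lemma contract_sub_right (A X Y : Matrix (Fin 2) (Fin 2) ℝ) :
    contract A (X - Y) = contract A X - contract A Y := by
  simp only [contract, Fin.sum_univ_two, Matrix.sub_apply]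
  ring

lemma contract_add_right (A X Y : Matrix (Fin 2) (Fin 2) ℝ) :
    contract A (X + Y) = contract A X + contract A Y := by
  simp only [contract, Fin.sum_univ_two, Matrix.add_apply]
  ring

lemma rot_add (X Y : Matrix (Fin 2) (Fin 2) ℝ) : rot (X + Y) = rot X + rot Y := by
  simp only [rot, Matrix.add_apply]
  ring

lemma rot_sub (X Y : Matrix (Fin 2) (Fin 2) ℝ) : rot (X - Y) = rot X - rot Y := by
  simp only [rot, Matrix.sub_apply]
  ring

lemma rot_sq_le (M : Matrix (Fin 2) (Fin 2) ℝ) : rot M ^ 2 ≤ 2 * contract M M := by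
  simp only [rot, contract, Fin.sum_univ_two]
  nlinarith [sq_nonneg (M 1 0 + M 0 1), sq_nonneg (M 0 0), sq_nonneg (M 1 1)]

namespace IsElliptic

variable {Ω : Set Plane} {lam Lam : ℝ} {A : Plane → Matrix (Fin 2) (Fin 2) ℝ}

lemma quadratic_mem (hA : IsElliptic Ω lam Lam A) {x : Plane} (hx : x ∈ Ω) (s r : ℝ) :
    lam * (s ^ 2 + r ^ 2) ≤ A x 0 0 * s ^ 2 + 2 * A x 0 1 * s * r + A x 1 1 * r ^ 2 ∧
      A x 0 0 * s ^ 2 + 2 * A x 0 1 * s * r + A x 1 1 * r ^ 2 ≤ Lam * (s ^ 2 + r ^ 2) := by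
  have h1 := hA.lower x hx ![s, r]
  have h2 := hA.upper x hx ![s, r]
  have h3 : A x 1 0 = A x 0 1 := (hA.isSymm x hx).apply 0 1
  simp only [dotProduct, Matrix.mulVec, Fin.sum_univ_two, Matrix.cons_val_zero,
    Matrix.cons_val_one, h3] at h1 h2
  constructor <;> linarith

lemma abs_apply_le (hA : IsElliptic Ω lam Lam A) (hlam : 0 < lam) {x : Plane} (hx : x ∈ Ω)
    (i j : Fin 2) : |A x i j| ≤ Lam := by
  have h1 := hA.quadratic_mem hx 1 0
  have h2 := hA.quadratic_mem hx 0 1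
  have h3 := hA.quadratic_mem hx 1 1
  have h4 := hA.quadratic_mem hx 1 (-1)
  have h5 : A x 1 0 = A x 0 1 := (hA.isSymm x hx).apply 0 1
  rw [abs_le]
  fin_cases i <;> fin_cases j <;> simp only [Fin.zero_eta, Fin.mk_one, h5] <;>
    constructor <;> linarith [h1.1, h1.2, h2.1, h2.2, h3.1, h3.2, h4.1, h4.2]

lemma contract_sq_le (hA : IsElliptic Ω lam Lam A) (hlam : 0 < lam) {x : Plane} (hx : x ∈ Ω)
    (M : Matrix (Fin 2) (Fin 2) ℝ) : contract (A x) M ^ 2 ≤ 4 * Lam ^ 2 * contract M M := by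
  have hsq : ∀ i j, A x i j ^ 2 ≤ Lam ^ 2 := fun i j => by
    have := hA.abs_apply_le hlam hx i j
    rw [← sq_abs]
    exact pow_le_pow_left₀ (abs_nonneg _) this 2
  have hcs : contract (A x) M ^ 2 ≤ contract (A x) (A x) * contract M M := by
    simp only [contract, ← Fintype.sum_prod_type', ← sq]
    exact Finset.sum_mul_sq_le_sq_mul_sq _ _ _
  refine hcs.trans (mul_le_mul_of_nonneg_right ?_ (contract_self_nonneg M))
  simp only [contract, Fin.sum_univ_two, ← sq]
  linarith [hsq 0 0, hsq 0 1, hsq 1 0, hsq 1 1]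

/-- Coercivity up to the determinant. -/
lemma contract_self_le (hA : IsElliptic Ω lam Lam A) (hlam : 0 < lam) {x : Plane} (hx : x ∈ Ω)
    (M : Matrix (Fin 2) (Fin 2) ℝ) :
    lam / (4 * Lam) * contract M M
      ≤ contract (A x) M ^ 2 / (2 * lam ^ 2) + rot M ^ 2 / 2 - M.det := by
  have hsymm : A x 1 0 = A x 0 1 := (hA.isSymm x hx).apply 0 1
  have ha := hA.quadratic_mem hx 1 0
  have hc := hA.quadratic_mem hx 0 1
  set y := (M 0 1 + M 1 0) / 2 with hy
  have h1 := (hA.quadratic_mem hx (M 0 0) y).1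
  have h2 := (hA.quadratic_mem hx y (M 1 1)).1
  set τ := contract (A x) M with hτ
  have hτ' : τ = A x 0 0 * M 0 0 + 2 * A x 0 1 * y + A x 1 1 * M 1 1 := by
    simp only [hτ, hy, contract, Fin.sum_univ_two, hsymm]
    ring
  have hdet : M.det = M 0 0 * M 1 1 - y ^ 2 + rot M ^ 2 / 4 := by
    simp only [Matrix.det_fin_two, hy, rot]
    ring
  have hnorm : contract M M = M 0 0 ^ 2 + M 1 1 ^ 2 + 2 * y ^ 2 + rot M ^ 2 / 2 := by
    simp only [contract, Fin.sum_univ_two, hy, rot]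
    ring
  set s := A x 0 0 + A x 1 1 with hs
  have hs1 : 2 * lam ≤ s := by linarith [ha.1, hc.1]
  have hs2 : s ≤ 2 * Lam := by linarith [ha.2, hc.2]
  have hs0 : 0 < s := by linarith
  -- Cayley–Hamilton for the symmetric part `X` of `M`, contracted with `A`: `-tr A · det X = A : X²
  -- - tr X · (A : X)`. Ellipticity bounds `A : X²` below by `lam |X|²`, which yields coercivity.
  have hid : s * (y ^ 2 - M 0 0 * M 1 1)
      = (A x 0 0 * M 0 0 ^ 2 + 2 * A x 0 1 * M 0 0 * y + A x 1 1 * y ^ 2)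
        + (A x 0 0 * y ^ 2 + 2 * A x 0 1 * y * M 1 1 + A x 1 1 * M 1 1 ^ 2)
        - (M 0 0 + M 1 1) * τ := by
    rw [hτ']
    ring
  -- Young's inequality, weighted so that half of the coercive term absorbs the trace.
  have hyoung : (M 0 0 + M 1 1) * τ ≤ lam / 2 * (M 0 0 ^ 2 + M 1 1 ^ 2) + τ ^ 2 / lam := by
    have e : τ ^ 2 / lam = lam * (τ / lam) ^ 2 := by field_simp
    have e' : (M 0 0 + M 1 1) * τ = lam * ((M 0 0 + M 1 1) * (τ / lam)) := by field_simp
    rw [e, e']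
    nlinarith [mul_nonneg hlam.le (sq_nonneg ((M 0 0 + M 1 1) / 2 - τ / lam)),
      mul_nonneg hlam.le (sq_nonneg (M 0 0 - M 1 1))]
  have hmain : lam / 2 * contract M M
      ≤ τ ^ 2 / lam + lam / 2 * rot M ^ 2 + s * (rot M ^ 2 / 4 - M.det) := by
    rw [hdet, hnorm]
    nlinarith [mul_nonneg hlam.le (sq_nonneg y), mul_nonneg hlam.le (sq_nonneg (rot M))]
  have hdiv : lam / (2 * s) * contract M M
      ≤ τ ^ 2 / (lam * s) + lam / (2 * s) * rot M ^ 2 + (rot M ^ 2 / 4 - M.det) := by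
    have := div_le_div_of_nonneg_right hmain hs0.le
    have e1 : lam / 2 * contract M M / s = lam / (2 * s) * contract M M := by field_simp
    have e2 : (τ ^ 2 / lam + lam / 2 * rot M ^ 2 + s * (rot M ^ 2 / 4 - M.det)) / s
        = τ ^ 2 / (lam * s) + lam / (2 * s) * rot M ^ 2 + (rot M ^ 2 / 4 - M.det) := by
      field_simp
    rwa [e1, e2] at this
  have hN := contract_self_nonneg M
  have g1 : lam / (4 * Lam) * contract M M ≤ lam / (2 * s) * contract M M :=
    mul_le_mul_of_nonneg_right
      (div_le_div_of_nonneg_left hlam.le (by linarith) (by linarith)) hN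
  have g2 : τ ^ 2 / (lam * s) ≤ τ ^ 2 / (2 * lam ^ 2) :=
    div_le_div_of_nonneg_left (sq_nonneg _) (by positivity) (by nlinarith)
  have g3 : lam / (2 * s) * rot M ^ 2 ≤ 1 / 4 * rot M ^ 2 := by
    refine mul_le_mul_of_nonneg_right ?_ (sq_nonneg _)
    rw [div_le_iff₀ (by positivity)]
    linarith
  linarith

end IsElliptic

/-! ### Consistency and stability of the discrete problem -/

section

variable {Ω : Set Plane} {lam Lam : ℝ} {A : Plane → Matrix (Fin 2) (Fin 2) ℝ}
  {T : Triangulation Ω}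

lemma restrict_tri_le (hΩo : IsOpen Ω) (hΩc : Convex ℝ Ω) (hΩne : Ω.Nonempty) {t : Finset Plane}
    (ht : t ∈ T.elems) : volume.restrict (tri t) ≤ volume.restrict Ω := by
  rw [Measure.restrict_congr_set (ae_eq_interior_tri t)]
  exact Measure.restrict_mono_set _ (T.interior_tri_subset hΩo hΩc hΩne ht)

lemma IsElliptic.memLp_contract (hA : IsElliptic Ω lam Lam A) (hlam : 0 < lam) (hΩo : IsOpen Ω)
    {μ : Measure Plane} (hμ : μ ≤ volume.restrict Ω)
    {X : Plane → Matrix (Fin 2) (Fin 2) ℝ} (hX : ∀ i j, MemLp (fun x => X x i j) 2 μ) :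
    MemLp (fun x => contract (A x) (X x)) 2 μ := by
  refine memLp_finsetSum _ fun i _ => memLp_finsetSum _ fun j _ => ?_
  refine (hX i j).of_le_mul (c := Lam)
    (((hA.aestronglyMeasurable i j).mono_measure hμ).mul (hX i j).aestronglyMeasurable) ?_
  filter_upwards [ae_mono hμ (ae_restrict_mem hΩo.measurableSet)] with x hx
  rw [norm_mul]
  exact mul_le_mul_of_nonneg_right (hA.abs_apply_le hlam hx i j) (norm_nonneg _)

variable {α : ℝ} {f u : Plane → ℝ} {p : Plane → Plane} {H : Plane → Matrix (Fin 2) (Fin 2) ℝ}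
  {S : Plane → Finset Plane}

lemma integral_mul_add_sub {X : Type*} [MeasurableSpace X] {μ : Measure X} {φ ψ χ : X → ℝ}
    (hφ : Integrable φ μ) (hψ : Integrable ψ μ) (hχ : Integrable χ μ) (k l m : ℝ) :
    ∫ x, (k * φ x + l * ψ x - m * χ x) ∂μ
      = k * (∫ x, φ x ∂μ) + l * (∫ x, ψ x ∂μ) - m * ∫ x, χ x ∂μ := by
  rw [integral_sub (f := fun x => k * φ x + l * ψ x) ((hφ.const_mul k).add (hψ.const_mul l)) (hχ.const_mul m),
    integral_add (hφ.const_mul k) (hψ.const_mul l), integral_const_mul, integral_const_mul,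
    integral_const_mul]

/-- Galerkin orthogonality bounds the energy of the discrete error by the consistency error. -/
lemma form_self_le (hΩo : IsOpen Ω) (hΩc : Convex ℝ Ω) (hΩb : Bornology.IsBounded Ω)
    (hΩne : Ω.Nonempty) (hlam : 0 < lam) (hA : IsElliptic Ω lam Lam A)
    (hf : MemLp f 2 (volume.restrict Ω)) (h : IsSobolev Ω α u p H)
    (heq : ∀ᵐ x ∂(volume.restrict Ω), contract (A x) (H x) = f x) {v w e : Plane → ℝ}
    (he : ∀ t ∈ T.elems, DG S e t = DG S v t - DG S w t)
    (hv : T.form S A v e = T.load S A f e) :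
    T.form S A e e ≤ (4 * Lam ^ 2 + 2) *
      ∑ t ∈ T.elems, ∫ x in tri t, contract (H x - DG S w t) (H x - DG S w t) := by
  have hloc : ∀ t ∈ T.elems,
      ∫ x in tri t, (contract (A x) (DG S e t) * contract (A x) (DG S e t)
        + rot (DG S e t) * rot (DG S e t))
      ≤ (4 * Lam ^ 2 + 2) * (∫ x in tri t, contract (H x - DG S w t) (H x - DG S w t))
        + 2 * (∫ x in tri t, (contract (A x) (DG S v t) * contract (A x) (DG S e t)
          + rot (DG S v t) * rot (DG S e t)))
        - 2 * ∫ x in tri t, f x * contract (A x) (DG S e t) := by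
    intro t ht
    have hle := restrict_tri_le hΩo hΩc hΩne ht
    have hfin : IsFiniteMeasure (volume.restrict (tri t)) :=
      ⟨by simpa using (volume_tri_ne_top t).lt_top⟩
    have hconst : ∀ M : Matrix (Fin 2) (Fin 2) ℝ,
        MemLp (fun x => contract (A x) M) 2 (volume.restrict (tri t)) := fun M =>
      hA.memLp_contract hlam hΩo hle (X := fun _ => M) fun _ _ => memLp_const _
    have hpair : ∀ M N : Matrix (Fin 2) (Fin 2) ℝ, IntegrableOn (fun x =>
        contract (A x) M * contract (A x) N + rot M * rot N) (tri t) := fun M N =>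
      ((hconst M).integrable_mul (hconst N)).add (integrable_const _)
    have hload : IntegrableOn (fun x => f x * contract (A x) (DG S e t)) (tri t) :=
      (hf.mono_measure hle).integrable_mul (hconst _)
    have hX := integrableOn_contract_sub (volume_tri_ne_top t)
      (fun i j => (h.memLp_hess i j).mono_measure hle) (DG S w t)
    rw [← integral_mul_add_sub hX (hpair _ _) hload]
    refine integral_mono_ae (hpair _ _)
      (((hX.const_mul _).add ((hpair _ _).const_mul _)).sub (hload.const_mul _)) ?_
    have hsymm := h.hess_symm hΩo hΩb.measure_lt_top.ne 1 0
    filter_upwards [ae_mono hle heq, ae_mono hle hsymm,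
      ae_mono hle (ae_restrict_mem hΩo.measurableSet)] with x h1 h2 h3
    have hc := hA.contract_sq_le hlam h3 (H x - DG S w t)
    have hr := rot_sq_le (H x - DG S w t)
    have hrH : rot (H x) = 0 := sub_eq_zero.mpr h2
    rw [contract_sub_right, h1] at hc
    rw [rot_sub, hrH] at hr
    rw [he t ht, contract_sub_right, rot_sub]
    set X := contract (H x - DG S w t) (H x - DG S w t)
    -- Once the constant has bounded the residual of `w`, what remains is the least-squares residual
    -- of `v`, a sum of two squares. The linear terms cancel after summation by the discrete
    -- equation.
    nlinarith [sq_nonneg (f x - contract (A x) (DG S v t)), sq_nonneg (rot (DG S v t))]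
  have hsum := Finset.sum_le_sum hloc
  rw [Finset.sum_sub_distrib, Finset.sum_add_distrib, ← Finset.mul_sum, ← Finset.mul_sum,
    ← Finset.mul_sum] at hsum
  unfold Triangulation.form Triangulation.load at *
  linarith

/-- Stability of a discrete gradient field with vanishing tangential trace. -/
lemma sum_volume_mul_contract_le (hΩo : IsOpen Ω) (hΩc : Convex ℝ Ω) (hΩne : Ω.Nonempty)
    (hlam : 0 < lam) (hA : IsElliptic Ω lam Lam A) {w : Plane → Plane}
    (hw : ∀ t ∈ T.elems, ∀ a ∈ t, ∀ b ∈ t, segment ℝ a b ⊆ frontier Ω → ⟪w a, b - a⟫ = 0)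
    {e : Plane → ℝ} {P : Finset Plane → Matrix (Fin 2) (Fin 2) ℝ}
    (hP : ∀ t ∈ T.elems, nodalGrad t w = P t + DG S e t) :
    lam / (4 * Lam) * ∑ t ∈ T.elems, volume.real (tri t) *
        contract (nodalGrad t w) (nodalGrad t w)
      ≤ (4 * Lam ^ 2 / lam ^ 2 + 2) * ∑ t ∈ T.elems, volume.real (tri t) * contract (P t) (P t)
        + (1 / lam ^ 2 + 1) * T.form S A e e := by
  have hloc : ∀ t ∈ T.elems,
      volume.real (tri t) * (lam / (4 * Lam) * contract (nodalGrad t w) (nodalGrad t w)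
        + (nodalGrad t w).det - (4 * Lam ^ 2 / lam ^ 2 + 2) * contract (P t) (P t))
      ≤ (1 / lam ^ 2 + 1) * ∫ x in tri t, (contract (A x) (DG S e t) * contract (A x) (DG S e t)
        + rot (DG S e t) * rot (DG S e t)) := by
    intro t ht
    have hle := restrict_tri_le hΩo hΩc hΩne ht
    have hfin : IsFiniteMeasure (volume.restrict (tri t)) :=
      ⟨by simpa using (volume_tri_ne_top t).lt_top⟩
    have hconst : MemLp (fun x => contract (A x) (DG S e t)) 2 (volume.restrict (tri t)) :=
      hA.memLp_contract hlam hΩo hle (X := fun _ => DG S e t) fun _ _ => memLp_const _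
    have hint : IntegrableOn (fun x => contract (A x) (DG S e t) * contract (A x) (DG S e t)
        + rot (DG S e t) * rot (DG S e t)) (tri t) :=
      (hconst.integrable_mul hconst).add (integrable_const _)
    rw [← smul_eq_mul, ← setIntegral_const, ← integral_const_mul]
    refine integral_mono_ae (integrable_const _) (hint.const_mul _) ?_
    filter_upwards [ae_mono hle (ae_restrict_mem hΩo.measurableSet)] with x hx
    have h1 := hA.contract_self_le hlam hx (nodalGrad t w)
    have h2 := hA.contract_sq_le hlam hx (P t)
    have h3 := rot_sq_le (P t)
    have h4 : contract (A x) (nodalGrad t w) ^ 2 ≤ 8 * Lam ^ 2 * contract (P t) (P t)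
        + 2 * contract (A x) (DG S e t) ^ 2 := by
      rw [hP t ht, contract_add_right]
      nlinarith [sq_nonneg (contract (A x) (P t) - contract (A x) (DG S e t))]
    have h5 : rot (nodalGrad t w) ^ 2 ≤ 4 * contract (P t) (P t) + 2 * rot (DG S e t) ^ 2 := by
      rw [hP t ht, rot_add]
      nlinarith [sq_nonneg (rot (P t) - rot (DG S e t))]
    have h6 := div_le_div_of_nonneg_right h4 (by positivity : 0 ≤ 2 * lam ^ 2)
    have e6 : (8 * Lam ^ 2 * contract (P t) (P t) + 2 * contract (A x) (DG S e t) ^ 2)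
        / (2 * lam ^ 2) = 4 * Lam ^ 2 / lam ^ 2 * contract (P t) (P t)
          + 1 / lam ^ 2 * contract (A x) (DG S e t) ^ 2 := by
      field_simp
      ring
    rw [e6] at h6
    have h7 : 0 ≤ 1 / lam ^ 2 * rot (DG S e t) ^ 2 := by positivity
    nlinarith [sq_nonneg (contract (A x) (DG S e t))]
  have hsum := Finset.sum_le_sum hloc
  -- The determinant can be discarded only after summation over the mesh, so the elementwise
  -- inequalities carry it along.
  have hdet := T.sum_volume_mul_det_eq_zero hΩo hw
  rw [← Finset.mul_sum] at hsum
  have e1 : ∑ t ∈ T.elems, volume.real (tri t) * (lam / (4 * Lam) *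
        contract (nodalGrad t w) (nodalGrad t w)
        + (nodalGrad t w).det - (4 * Lam ^ 2 / lam ^ 2 + 2) * contract (P t) (P t))
      = lam / (4 * Lam) * ∑ t ∈ T.elems, volume.real (tri t) *
          contract (nodalGrad t w) (nodalGrad t w)
        + ∑ t ∈ T.elems, volume.real (tri t) * (nodalGrad t w).det
        - (4 * Lam ^ 2 / lam ^ 2 + 2) *
          ∑ t ∈ T.elems, volume.real (tri t) * contract (P t) (P t) := by
    rw [Finset.mul_sum, Finset.mul_sum, ← Finset.sum_add_distrib, ← Finset.sum_sub_distrib]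
    exact Finset.sum_congr rfl fun t _ => by ring
  rw [e1, hdet] at hsum
  unfold Triangulation.form
  linarith

/-- The square of the distance in `L²` of `H` to a piecewise constant matrix field, compared with
the distance to another one. -/
lemma sum_integral_contract_sub_le (hΩo : IsOpen Ω) (hΩc : Convex ℝ Ω) (hΩne : Ω.Nonempty)
    (h : IsSobolev Ω α u p H) (M N : Finset Plane → Matrix (Fin 2) (Fin 2) ℝ) :
    ∑ t ∈ T.elems, ∫ x in tri t, contract (H x - M t) (H x - M t)
      ≤ 2 * (∑ t ∈ T.elems, ∫ x in tri t, contract (H x - N t) (H x - N t))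
        + 2 * ∑ t ∈ T.elems, volume.real (tri t) * contract (M t - N t) (M t - N t) := by
  rw [Finset.mul_sum, Finset.mul_sum, ← Finset.sum_add_distrib]
  refine Finset.sum_le_sum fun t ht => ?_
  have hle := restrict_tri_le hΩo hΩc hΩne ht
  have hfin : IsFiniteMeasure (volume.restrict (tri t)) :=
    ⟨by simpa using (volume_tri_ne_top t).lt_top⟩
  have hX := fun M => integrableOn_contract_sub (volume_tri_ne_top t)
    (fun i j => (h.memLp_hess i j).mono_measure hle) M
  rw [← smul_eq_mul (a := volume.real (tri t)), ← setIntegral_const, ← integral_const_mul,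
    ← integral_const_mul, ← integral_add ((hX _).const_mul _) ((integrable_const _).const_mul _)]
  refine integral_mono (hX _) (((hX _).const_mul _).add ((integrable_const _).const_mul _))
    fun x => ?_
  have := contract_sub_le (H x - N t) (M t - N t)
  rwa [sub_sub_sub_cancel_right] at this

end

/-! ### The discrete error -/

section

variable {Ω : Set Plane} {T : Triangulation Ω} {S : Plane → Finset Plane} {σ R κ : ℝ}

/-- Along a boundary edge the homotheties stay on the edge, where `u` vanishes, so all difference
quotients are zero. -/
lemma IsPointGrad.inner_eq_zero {u : Plane → ℝ} (hu : ∀ x ∈ frontier Ω, u x = 0) {a b g : Plane}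
    (hab : segment ℝ a b ⊆ frontier Ω) (hg : IsPointGrad Ω u a g) : ⟪g, b - a⟫ = 0 := by
  have hb : a + (b - a) ∈ closure Ω := by
    rw [add_sub_cancel]
    exact frontier_subset_closure (hab (right_mem_segment ℝ a b))
  refine tendsto_nhds_unique (hg _ hb) (tendsto_const_nhds.congr fun k => ?_)
  have hk : a + (1 / 2 : ℝ) ^ k • (b - a) ∈ segment ℝ a b := by
    rw [segment_eq_image']
    exact ⟨_, ⟨by positivity, pow_le_one₀ (by norm_num) (by norm_num)⟩, rfl⟩
  rw [hu _ (hab hk), hu _ (hab (left_mem_segment ℝ a b)), sub_zero, mul_zero]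

namespace Triangulation

lemma inner_recoverAt_eq_zero {v : Plane → ℝ} (hv : v ∈ T.V00 S) {t : Finset Plane}
    (ht : t ∈ T.elems) {a b : Plane} (ha : a ∈ t) (hb : b ∈ t)
    (hab : segment ℝ a b ⊆ frontier Ω) : ⟪recoverAt S v a, b - a⟫ = 0 := by
  have h := hv.2 t ht a ha b hb hab a (left_mem_segment ℝ a b)
  rwa [G, T.interp_vertex _ ⟨t, ht, ha⟩] at h

lemma sub_mem_V {v w : Plane → ℝ} (hv : v ∈ T.V) (hw : w ∈ T.V) : v - w ∈ T.V := fun t ht => by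
  obtain ⟨a, ha⟩ := hv t ht
  obtain ⟨b, hb⟩ := hw t ht
  exact ⟨a - b, fun x hx => by simp [ha x hx, hb x hx]⟩

lemma IsSampling.recoverAt_sub_of_mem (hκ : 0 < κ) (hreg : T.IsRegular σ)
    (hS : T.IsSampling R κ S) {t : Finset Plane} (ht : t ∈ T.elems) {z : Plane} (hz : z ∈ t)
    (v w : Plane → ℝ) : recoverAt S (v - w) z = recoverAt S v z - recoverAt S w z :=
  hS.recoverAt_sub hκ ⟨t, ht, hz⟩ ((hreg.diam_pos ht).trans_le (T.diam_tri_le_diam_patch ht hz)) v w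

lemma IsSampling.localAffine_recoverAt_sub (hκ : 0 < κ) (hreg : T.IsRegular σ)
    (hS : T.IsSampling R κ S) {t : Finset Plane} (ht : t ∈ T.elems) (v w : Plane → ℝ) :
    localAffine t (recoverAt S (v - w))
      = localAffine t (recoverAt S v) - localAffine t (recoverAt S w) := by
  have hT := T.isTriangle ht
  rw [← hT.localAffine_sub]
  exact hT.localAffine_eq_of_forall fun z hz => by
    rw [hT.localAffine_eq _ hz, hS.recoverAt_sub_of_mem hκ hreg ht hz]

lemma IsSampling.DG_sub (hκ : 0 < κ) (hreg : T.IsRegular σ) (hS : T.IsSampling R κ S)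
    {t : Finset Plane} (ht : t ∈ T.elems) (v w : Plane → ℝ) :
    DG S (v - w) t = DG S v t - DG S w t := by
  ext i j
  simp [DG, hS.localAffine_recoverAt_sub hκ hreg ht]

lemma IsSampling.sub_mem_V00 (hκ : 0 < κ) (hreg : T.IsRegular σ) (hS : T.IsSampling R κ S)
    {v w : Plane → ℝ} (hv : v ∈ T.V00 S) (hw : w ∈ T.V00 S) : v - w ∈ T.V00 S := by
  refine ⟨⟨sub_mem_V hv.1.1 hw.1.1, fun x hx => by simp [hv.1.2 x hx, hw.1.2 x hx]⟩,
    fun t ht a ha b hb hab x hx => ?_⟩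
  have hxt : x ∈ tri t :=
    (convex_tri t).segment_subset (subset_tri t ha) (subset_tri t hb) hx
  have h1 := hv.2 t ht a ha b hb hab x hx
  have h2 := hw.2 t ht a ha b hb hab x hx
  rw [G, T.interp_eq _ ht hxt] at h1 h2 ⊢
  rw [hS.localAffine_recoverAt_sub hκ hreg ht, AffineMap.coe_sub, Pi.sub_apply, inner_sub_left,
    h1, h2, sub_zero]

end Triangulation

end

/-! ### Assembly of the two error bounds -/

lemma slobSq_le_sobolevNorm_sq (Ω : Set Plane) (α : ℝ) (u : Plane → ℝ) (p : Plane → Plane)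
    (H : Plane → Matrix (Fin 2) (Fin 2) ℝ) : slobSq α H Ω ≤ sobolevNorm Ω α u p H ^ 2 := by
  have h1 : 0 ≤ ∫ x in Ω, u x ^ 2 := integral_nonneg fun _ => sq_nonneg _
  have h2 : 0 ≤ ∫ x in Ω, ‖p x‖ ^ 2 := integral_nonneg fun _ => sq_nonneg _
  have h3 : 0 ≤ ∫ x in Ω, contract (H x) (H x) := integral_nonneg fun _ => contract_self_nonneg _
  have h4 := slobSq_nonneg α H Ω
  unfold slobSq at *
  rw [sobolevNorm, Real.sq_sqrt (by positivity)]
  linarith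

lemma sqrt_le_mul_rpow_mul {E K C h α N s : ℝ} (hC : √K ≤ C) (hh : 0 ≤ h)
    (hN : 0 ≤ N) (hs0 : 0 ≤ s) (hs : s ≤ N ^ 2) (hE : E ≤ K * (h ^ (2 * α) * s)) :
    √E ≤ C * h ^ α * N := by
  have hC0 : 0 ≤ C := (Real.sqrt_nonneg K).trans hC
  refine Real.sqrt_le_iff.mpr ⟨by positivity, hE.trans ?_⟩
  rw [rpow_two_mul hh, mul_pow, mul_pow, mul_assoc]
  have hKC : K ≤ C ^ 2 := (Real.sqrt_le_left hC0).mp hC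
  gcongr

/-- The constant in the error estimate in the energy norm. -/
def energyConst (α Lam σ R κ : ℝ) : ℝ :=
  (4 * Lam ^ 2 + 2) * (2 * interpConst α σ R + 2 * recoveryErrorConst α σ R κ)

/-- The constant in the error estimate for the Hessian. -/
def hessConst (α lam Lam σ R κ : ℝ) : ℝ :=
  2 * interpConst α σ R + 2 * (4 * Lam / lam * ((4 * Lam ^ 2 / lam ^ 2 + 2) *
    recoveryErrorConst α σ R κ + (1 / lam ^ 2 + 1) * energyConst α Lam σ R κ))

section

variable {Ω : Set Plane} {α lam Lam σ R κ : ℝ} {A : Plane → Matrix (Fin 2) (Fin 2) ℝ}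
  {f u : Plane → ℝ} {p : Plane → Plane} {H : Plane → Matrix (Fin 2) (Fin 2) ℝ}
  {T : Triangulation Ω} {S : Plane → Finset Plane} {uh : Plane → ℝ}

/-- Galerkin orthogonality leaves the consistency error of the recovered interpolant, split through
the nodal interpolant of the gradient. -/
lemma form_sub_interp_le (hα : 0 < α) (hα1 : α < 1) (hΩo : IsOpen Ω)
    (hΩc : Convex ℝ Ω) (hΩb : Bornology.IsBounded Ω) (hΩne : Ω.Nonempty)
    (hlam : 0 < lam) (hκ : 0 < κ) (hA : IsElliptic Ω lam Lam A)
    (hf : MemLp f 2 (volume.restrict Ω)) (h : IsSobolev Ω α u p H)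
    (hu : IsStrongSolution Ω A f u H) (hreg : T.IsRegular σ) (hS : T.IsSampling R κ S)
    (heq : T.form S A uh (uh - T.interp u) = T.load S A f (uh - T.interp u)) :
    T.form S A (uh - T.interp u) (uh - T.interp u)
      ≤ energyConst α Lam σ R κ * (T.meshSize ^ (2 * α) * slobSq α H Ω) := by
  obtain ⟨g, hg⟩ := h.exists_isPointGrad hα hα1 hΩo hΩc hΩb hΩne hu.continuousOn
  have h1 := h.sum_integral_sub_nodalGrad_le hα hα1 hΩo hΩc hΩb hΩne hu.continuousOn hreg R hg
  have h2 := h.sum_volume_mul_sub_DG_le hα hα1 hΩo hΩc hΩb hΩne hu.continuousOn hreg hκ hS hg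
  have h3 := sum_integral_contract_sub_le (T := T) hΩo hΩc hΩne h (fun t => DG S (T.interp u) t)
    fun t => nodalGrad t g
  refine (form_self_le hΩo hΩc hΩb hΩne hlam hA hf h hu.equation
    (fun t ht => hS.DG_sub hκ hreg ht uh (T.interp u)) heq).trans ?_
  rw [energyConst, mul_assoc]
  refine mul_le_mul_of_nonneg_left ?_ (by positivity)
  linarith

lemma sum_integral_sub_DG_le (hα : 0 < α) (hα1 : α < 1) (hΩo : IsOpen Ω)
    (hΩc : Convex ℝ Ω) (hΩb : Bornology.IsBounded Ω) (hΩne : Ω.Nonempty)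
    (hlam : 0 < lam) (hLam : 0 < Lam) (hκ : 0 < κ) (hA : IsElliptic Ω lam Lam A)
    (hf : MemLp f 2 (volume.restrict Ω)) (h : IsSobolev Ω α u p H)
    (hu : IsStrongSolution Ω A f u H) (hreg : T.IsRegular σ) (hS : T.IsSampling R κ S)
    (hmem : uh ∈ T.V00 S)
    (heq : T.form S A uh (uh - T.interp u) = T.load S A f (uh - T.interp u)) :
    ∑ t ∈ T.elems, ∫ x in tri t, contract (H x - DG S uh t) (H x - DG S uh t)
      ≤ hessConst α lam Lam σ R κ * (T.meshSize ^ (2 * α) * slobSq α H Ω) := by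
  have hE := form_sub_interp_le hα hα1 hΩo hΩc hΩb hΩne hlam hκ hA hf h hu hreg hS heq
  obtain ⟨g, hg⟩ := h.exists_isPointGrad hα hα1 hΩo hΩc hΩb hΩne hu.continuousOn
  have h1 := h.sum_integral_sub_nodalGrad_le hα hα1 hΩo hΩc hΩb hΩne hu.continuousOn hreg R hg
  have h2 := h.sum_volume_mul_sub_DG_le hα hα1 hΩo hΩc hΩb hΩne hu.continuousOn hreg hκ hS hg
  have h3 := sum_integral_contract_sub_le (T := T) hΩo hΩc hΩne h (fun t => DG S uh t)
    fun t => nodalGrad t g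
  -- This field, unlike the recovered gradient of `uh - u_I`, always has vanishing tangential trace.
  -- Its derivative differs from that of the latter by the recovery error `P`, already estimated.
  set w : Plane → Plane := fun z => recoverAt S uh z - g z with hw
  have hwD : ∀ t ∈ T.elems, nodalGrad t w = DG S uh t - nodalGrad t g := fun t ht => by
    rw [hw, (T.isTriangle ht).nodalGrad_sub, DG_eq_nodalGrad]
  have hw0 : ∀ t ∈ T.elems, ∀ a ∈ t, ∀ b ∈ t, segment ℝ a b ⊆ frontier Ω → ⟪w a, b - a⟫ = 0 := by
    intro t ht a ha b hb hab
    rw [hw, inner_sub_left, Triangulation.inner_recoverAt_eq_zero hmem ht ha hb hab,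
      (hg a (T.tri_subset_closure ht (subset_tri t ha))).inner_eq_zero hu.boundary hab, sub_zero]
  have h4 := sum_volume_mul_contract_le hΩo hΩc hΩne hlam hA hw0 (S := S)
    (e := uh - T.interp u) (P := fun t => DG S (T.interp u) t - nodalGrad t g) fun t ht => by
      rw [hwD t ht, hS.DG_sub hκ hreg ht]
      abel
  rw [Finset.sum_congr rfl fun t ht => by rw [hwD t ht]] at h4
  set D := ∑ t ∈ T.elems, volume.real (tri t) *
    contract (DG S uh t - nodalGrad t g) (DG S uh t - nodalGrad t g) with hD
  set Q := T.meshSize ^ (2 * α) * slobSq α H Ω with hQ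
  have h5 : D ≤ 4 * Lam / lam * ((4 * Lam ^ 2 / lam ^ 2 + 2) * (recoveryErrorConst α σ R κ * Q)
      + (1 / lam ^ 2 + 1) * (energyConst α Lam σ R κ * Q)) := by
    have e : D = 4 * Lam / lam * (lam / (4 * Lam) * D) := by field_simp
    rw [e]
    refine mul_le_mul_of_nonneg_left (h4.trans ?_) (by positivity)
    gcongr
  refine h3.trans ?_
  unfold hessConst
  linarith

end

end GRBL

end

theorem mainTheorem1 (Ω : Set Plane) (hΩ_open : IsOpen Ω) (hΩ_conv : Convex ℝ Ω)
    (hΩ_bdd : Bornology.IsBounded Ω) (hΩ_ne : Ω.Nonempty)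
    (α : ℝ) (hα0 : 0 < α) (hα1 : α < 1)
    (lam Lam : ℝ) (hlam : 0 < lam) (hLam : 0 < Lam)
    (σ R κ : ℝ) (hκ : 0 < κ) :
    ∃ C : ℝ, 0 < C ∧
      ∀ (A : Plane → Matrix (Fin 2) (Fin 2) ℝ) (ε : ℝ) (f u : Plane → ℝ)
        (p : Plane → Plane) (H : Plane → Matrix (Fin 2) (Fin 2) ℝ),
        IsElliptic Ω lam Lam A → ε ∈ Set.Icc (0 : ℝ) 1 → IsCordes Ω ε A →
        MemLp f 2 (volume.restrict Ω) →
        IsSobolev Ω α u p H → IsStrongSolution Ω A f u H →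
      ∀ (T : Triangulation Ω) (S : Plane → Finset Plane),
        T.IsRegular σ → T.IsSampling R κ S →
      ∀ uh : Plane → ℝ,
        (T.IsGRBLSolution S A f T.V uh ∨
          (T.IsGRBLSolution S A f (T.V00 S) uh ∧ T.interp u ∈ T.V00 S)) →
        T.energyNorm S A (uh - T.interp u) ≤ C * T.meshSize ^ α * sobolevNorm Ω α u p H ∧
        T.hessError S H uh ≤ C * T.meshSize ^ α * sobolevNorm Ω α u p H := by
  -- The sum dominates both square roots, and the added `1` makes it positive.
  refine ⟨√(energyConst α Lam σ R κ) + √(hessConst α lam Lam σ R κ) + 1, by positivity, ?_⟩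
  intro A _ f u p H hA _ _ hf h hu T S hreg hS uh hsol
  have hmem : uh ∈ T.V00 S := hsol.elim (fun h => h.mem) fun h => h.1.mem
  have heq : T.form S A uh (uh - T.interp u) = T.load S A f (uh - T.interp u) := by
    -- Both variants are used only through the test function `uh - u_I`: it always belongs to `V`,
    -- and to `V00` when `u_I` does.
    rcases hsol with hs | ⟨hs, hI⟩
    · exact hs.equation _ (Triangulation.sub_mem_V hmem.1.1 (T.interp_mem_V u))
    · exact hs.equation _ (hS.sub_mem_V00 hκ hreg hmem hI)
  have hh : 0 ≤ T.meshSize := Real.iSup_nonneg fun _ => Metric.diam_nonneg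
  have hs := slobSq_le_sobolevNorm_sq Ω α u p H
  have hs0 := slobSq_nonneg α H Ω
  have k1 := Real.sqrt_nonneg (energyConst α Lam σ R κ)
  have k2 := Real.sqrt_nonneg (hessConst α lam Lam σ R κ)
  exact ⟨sqrt_le_mul_rpow_mul (by linarith) hh (Real.sqrt_nonneg _) hs0 hs
      (form_sub_interp_le hα0 hα1 hΩ_open hΩ_conv hΩ_bdd hΩ_ne hlam hκ hA hf h hu hreg hS heq),
    sqrt_le_mul_rpow_mul (by linarith) hh (Real.sqrt_nonneg _) hs0 hs
      (sum_integral_sub_DG_le hα0 hα1 hΩ_open hΩ_conv hΩ_bdd hΩ_ne hlam hLam hκ hA hf h hu hreg hS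
        hmem heq)⟩
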